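/- Let $X$ be a compact, oriented, smooth Riemannian 4-manifold with metric $g$, and let $\omega$ be a self-dual harmonic 2-form on $X$ which vanishes transversely (as a section of the bundle $\Lambda_+$ of self-dual 2-forms). Let $Z=\omega^{-1}(0)$, and let $N\to Z$ be its normal bundle, the orthogonal complement of $TZ$ in $TX|_Z$. The covariant derivative $\nabla\omega$ identifies $N$ with $\Lambda_+|_Z$; orient $N$ so that this isomorphism is orientation reversing, where $\Lambda_+$ has the orientation induced by that of $X$ (for an oriented orthonormal coframe $e^0,\dots,e^3$, the basis $e^0\wedge e^1+e^2\wedge e^3,\ e^0\wedge e^2-e^1\wedge e^3,\ e^0\wedge e^3+e^1\wedge e^2$ is positive). On $X\setminus Z$ let $J=\sqrt2\,g^{-1}\omega/|\omega|$, where $g^{-1}\omega$ is the endomorphism with $g(g^{-1}\omega\, v,w)=\omega(v,w)$ and $|\omega|^2=\sum_{i<j}\omega(e_i,e_j)^2$ in an orthonormal basis; let $T^{1,0}=\{\alpha\in T^*X\otimes\mathbb C:\alpha\circ J=i\alpha\}$, and let $K=\Lambda^2T^{1,0}$ be the canonical line bundle of $J$. Lemma 2.1. Let $\sigma\colon N\to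 X$ be the exponential map of the metric, and let $N^0\subset N$ be an open ball neighbourhood of the zero section, $N^0=\{v\in N_z: z\in Z,\ |v|<\varepsilon(z)\}$ with $\varepsilon\colon Z\to(0,\infty)$ continuous, which is embedded in $X$ by $\sigma$. Let $p\in Z$ and let $S\subset N^0|_p$ be a round 2-sphere with centre $0$, oriented in the standard way as $S^2\subset\mathbb R^3\cong N_p$, with $\mathbb R^3\cong N_p$ an orientation-preserving linear isometry. Then $\sigma(S)\subset X\setminus Z$, and the restriction of $K$ to $S$ (that is, $\sigma^*K|_S$) is a complex line bundle with first Chern class $\langle c_1(K|_S),[S]\rangle=2$; so $K|_S$ is non-trivial. In particular $J$ does not extend over $Z$: for no $p\in Z$ and no neighbourhood $U$ of $p$ in $X$ is there a continuous almost complex structure on $U$ that equals $J$ on $U\setminus Z$. -/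

import Mathlib

open Bundle Set
open scoped Manifold ContDiff Topology Bundle

noncomputable section

namespace NearSymplectic

/-- The model space of a 4-manifold. -/
abbrev E4 : Type := EuclideanSpace ℝ (Fin 4)

/-- The unit sphere `S² ⊂ ℝ³`. -/
abbrev S2 : Type := Metric.sphere (0 : EuclideanSpace ℝ (Fin 3)) 1

/-! ### Complex line bundles over `S²` and their first Chern number -/

section ChernNumber

variable {B : Type*} (F : Type*) [NormedAddCommGroup F]
  {V : B → Type*} [∀ b, AddCommGroup (V b)] [∀ b, Module ℂ (V b)]
  [TopologicalSpace (TotalSpace F V)]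

/-- Let `L b ⊂ V b` be complex subspaces of the fibres of a vector bundle `V → B`, and
`f : S² → B` a map. `IsFrameOn F f L A s` says that over `A ⊂ S²` the map `s` is a continuous
nowhere zero section of `f^* V` whose value at each point `y` spans `L (f y)`. In other words,
over `A` the family `f^* L` is a complex line bundle, trivialized by `s`. -/
structure IsFrameOn (f : S2 → B) (L : ∀ b, Submodule ℂ (V b)) (A : Set S2)
    (s : ∀ y, V (f y)) : Prop where
  continuousOn : ContinuousOn (fun y => (⟨f y, s y⟩ : TotalSpace F V)) A
  ne_zero : ∀ y ∈ A, s y ≠ 0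
  span_eq : ∀ y ∈ A, Submodule.span ℂ {s y} = L (f y)

/-- The closed northern hemisphere of `S²`. -/
def northHemisphere : Set S2 := {y | 0 ≤ (y : EuclideanSpace ℝ (Fin 3)) 2}

/-- The closed southern hemisphere of `S²`. -/
def southHemisphere : Set S2 := {y | (y : EuclideanSpace ℝ (Fin 3)) 2 ≤ 0}

/-- The equator of `S²`, run through counterclockwise as seen from the north pole (this is the
boundary orientation of the northern hemisphere for the standard orientation of `S²`). -/
def equator (t : ℝ) : S2 :=
  ⟨!₂[Real.cos t, Real.sin t, 0], by
    simp [EuclideanSpace.norm_eq, Fin.sum_univ_three]⟩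

/-- The complex line bundle `f^* L` over `S²`, with its standard orientation as the boundary of
the unit ball of `ℝ³`, has first Chern number `⟨c₁(f^* L), [S²]⟩ = c`.

`f^* L` has frames `s₊` and `s₋` over the two closed hemispheres, and whenever `s₊`, `s₋` are such
frames, then the transition function `s₋ = exp (h) s₊` along the equator has winding number `c`.
The sign is the usual one: a line bundle with a section whose zeros are nondegenerate has as first
Chern number the sum of the degrees of these zeros, and the tangent bundle of the Riemann sphere
has first Chern number `2`. -/
def HasFirstChernNumber (f : S2 → B) (L : ∀ b, Submodule ℂ (V b)) (c : ℤ) : Prop :=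
  (∃ sp sm : ∀ y, V (f y),
    IsFrameOn F f L northHemisphere sp ∧ IsFrameOn F f L southHemisphere sm) ∧
  ∀ sp sm : ∀ y, V (f y),
    IsFrameOn F f L northHemisphere sp → IsFrameOn F f L southHemisphere sm →
    ∃ h : ℝ → ℂ, ContinuousOn h (Icc 0 (2 * Real.pi)) ∧
      (∀ t ∈ Icc 0 (2 * Real.pi), sm (equator t) = Complex.exp (h t) • sp (equator t)) ∧
      h (2 * Real.pi) - h 0 = 2 * Real.pi * Complex.I * c

/-- The complex line bundle `f^* L` over `S²` is trivial. -/
def IsTrivialLineBundle (f : S2 → B) (L : ∀ b, Submodule ℂ (V b)) : Prop :=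
  ∃ s : ∀ y, V (f y), IsFrameOn F f L univ s

end ChernNumber

/-! ### Riemannian metrics, orientations and 2-forms on 4-manifolds -/

section Manifold

variable {X : Type*} [TopologicalSpace X] [ChartedSpace E4 X] [IsManifold (𝓡 4) ∞ X]

instance (x : X) : FiniteDimensional ℝ (TangentSpace (𝓡 4) x) :=
  inferInstanceAs (FiniteDimensional ℝ E4)

instance (x : X) : T2Space (TangentSpace (𝓡 4) x) :=
  inferInstanceAs (T2Space E4)

variable (X) in
/-- A smooth Riemannian metric on `X`. -/
abbrev Metric4 : Type _ :=
  ContMDiffRiemannianMetric (𝓡 4) ∞ E4 (fun x : X => TangentSpace (𝓡 4) x)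

variable (X) in
/-- A real 2-form on `X` (smoothness is required separately). -/
abbrev TwoForm : Type _ := ∀ x : X, TangentSpace (𝓡 4) x [⋀^Fin 2]→L[ℝ] ℝ

/-- `coordFrame x₀ x : ℝ⁴ → T_x X` takes the standard basis to the coordinate vector fields at `x`
of the chart around `x₀`. -/
def coordFrame (x₀ x : X) : E4 →L[ℝ] TangentSpace (𝓡 4) x :=
  (trivializationAt E4 (TangentSpace (𝓡 4) : X → Type _) x₀).symmL ℝ x

variable (X) in
/-- An orientation of `X`: orientations of the tangent spaces which, read in charts, are locally
constant. -/
structure Orientation4 where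
  at_ : ∀ x : X, Orientation ℝ (TangentSpace (𝓡 4) x) (Fin 4)
  locallyConstant : ∀ x₀ : X, ∃ o₀ : Orientation ℝ E4 (Fin 4), ∀ᶠ x in 𝓝 x₀,
    ∀ hx : x ∈ (trivializationAt E4 (TangentSpace (𝓡 4) : X → Type _) x₀).baseSet,
      Orientation.map (Fin 4)
        ((trivializationAt E4 (TangentSpace (𝓡 4) : X → Type _) x₀).continuousLinearEquivAt
          ℝ x hx).toLinearEquiv (at_ x) = o₀

/-- `e` is an orthonormal basis of `T_x X`, positively oriented. -/
def IsOrientedONB (g : Metric4 X) (o : Orientation4 X) (x : X)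
    (e : Module.Basis (Fin 4) ℝ (TangentSpace (𝓡 4) x)) : Prop :=
  (∀ i j, g.inner x (e i) (e j) = if i = j then 1 else 0) ∧ e.orientation = o.at_ x

/-- `β = ⋆α` for 2-forms at the point `x`, where `⋆` is the Hodge star of the metric and the
orientation: `⋆(e⁰ ∧ e¹) = e² ∧ e³` for every oriented orthonormal coframe. -/
def IsHodgeStar (g : Metric4 X) (o : Orientation4 X) (x : X)
    (α β : TangentSpace (𝓡 4) x [⋀^Fin 2]→L[ℝ] ℝ) : Prop :=
  ∀ e, IsOrientedONB g o x e → β ![e 2, e 3] = α ![e 0, e 1]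

/-- `α ∈ Λ₊` at the point `x`, that is, `⋆α = α`. -/
def IsSelfDualAt (g : Metric4 X) (o : Orientation4 X) (x : X)
    (α : TangentSpace (𝓡 4) x [⋀^Fin 2]→L[ℝ] ℝ) : Prop :=
  IsHodgeStar g o x α α

/-- The coordinate expression of a 2-form in the chart around `x₀`. -/
def formInChart (Ω : TwoForm X) (x₀ : X) (y : E4) : E4 [⋀^Fin 2]→L[ℝ] ℝ :=
  (Ω ((extChartAt (𝓡 4) x₀).symm y)).compContinuousLinearMap
    (coordFrame x₀ ((extChartAt (𝓡 4) x₀).symm y))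

/-- `Ω` is a smooth 2-form. -/
def IsSmoothForm (Ω : TwoForm X) : Prop :=
  ∀ x₀ : X, ContDiffOn ℝ ∞ (formInChart Ω x₀) (extChartAt (𝓡 4) x₀).target

/-- `dΩ = 0`. -/
def IsClosedForm (Ω : TwoForm X) : Prop :=
  ∀ x₀ : X, ∀ y ∈ (extChartAt (𝓡 4) x₀).target, extDeriv (formInChart Ω x₀) y = 0

/-- `Ω` is a smooth harmonic 2-form: `dΩ = 0` and `d ⋆Ω = 0`. -/
def IsHarmonicForm (g : Metric4 X) (o : Orientation4 X) (Ω : TwoForm X) : Prop :=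
  IsSmoothForm Ω ∧ IsClosedForm Ω ∧
    ∃ η : TwoForm X, (∀ x, IsHodgeStar g o x (Ω x) (η x)) ∧ IsSmoothForm η ∧ IsClosedForm η

/-- `Ω` is self-dual. -/
def IsSelfDualForm (g : Metric4 X) (o : Orientation4 X) (Ω : TwoForm X) : Prop :=
  ∀ x, IsSelfDualAt g o x (Ω x)

/-- The zero set `Z` of `Ω`. -/
def zeroSet (Ω : TwoForm X) : Set X := {x | Ω x = 0}

/-- The covariant derivative `v ↦ ∇_v Ω` at a zero `p` of `Ω`. As `Ω` vanishes at `p`, this does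
not depend on the connection: it is the derivative at `p` of the components of `Ω` in the
chart around `p`, which identifies `T_p X` with `ℝ⁴`. (Used only at zeros of `Ω`.) -/
def nablaAtZero (Ω : TwoForm X) (p : X) :
    TangentSpace (𝓡 4) p → TangentSpace (𝓡 4) p [⋀^Fin 2]→L[ℝ] ℝ :=
  fun v => fderiv ℝ (formInChart Ω p) (extChartAt (𝓡 4) p p) v

/-- The self-dual 2-form `Ω` vanishes transversely, as a section of `Λ₊`: at each zero,
`∇Ω : T_p X → Λ₊` is onto. -/
def VanishesTransversely (g : Metric4 X) (o : Orientation4 X) (Ω : TwoForm X) : Prop :=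
  ∀ p ∈ zeroSet Ω, ∀ α, IsSelfDualAt g o p α → ∃ v, nablaAtZero Ω p v = α

/-- The curve `γ` passes at time `t` through `x`, with velocity `v ∈ T_x X` (which is computed in
the chart around `x`). -/
def HasVelocityAt (γ : ℝ → X) (t : ℝ) (x : X) (v : TangentSpace (𝓡 4) x) : Prop :=
  γ t = x ∧ ContinuousAt γ t ∧ HasDerivAt (fun s => (extChartAt (𝓡 4) x (γ s) : E4)) v t

/-- `v` is tangent at `p` to the subset `Z` of `X`: it is the velocity of a curve in `Z`. -/
def IsTangentTo (Z : Set X) (p : X) (v : TangentSpace (𝓡 4) p) : Prop :=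
  ∃ γ : ℝ → X, (∀ t, γ t ∈ Z) ∧ HasVelocityAt γ 0 p v

/-- The fibre at `p` of the normal bundle `N` of `Z`, as the orthogonal complement of `T_p Z`. -/
def normalSpace (g : Metric4 X) (Z : Set X) (p : X) : Set (TangentSpace (𝓡 4) p) :=
  {n | ∀ v, IsTangentTo Z p v → g.inner p n v = 0}

/-- `n` is an oriented orthonormal basis of the normal space `N_p` to the zero set of `Ω`. Here
`Λ₊` has its standard orientation, in which `α₁, α₂, α₃` is positive if the matrix
`αᵢ(e₀, eⱼ)`, `i, j = 1, 2, 3`, has positive determinant for an oriented orthonormal basis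
`e₀, e₁, e₂, e₃` of `T_p X`; and `N` is so oriented that `∇Ω : N → Λ₊` reverses orientation. -/
structure IsOrientedNormalONB (g : Metric4 X) (o : Orientation4 X) (Ω : TwoForm X) (p : X)
    (n : Fin 3 → TangentSpace (𝓡 4) p) : Prop where
  mem : ∀ i, n i ∈ normalSpace g (zeroSet Ω) p
  orthonormal : ∀ i j, g.inner p (n i) (n j) = if i = j then 1 else 0
  reversing : ∀ e, IsOrientedONB g o p e →
    Matrix.det (Matrix.of fun i j : Fin 3 => nablaAtZero Ω p (n i) ![e 0, e j.succ]) < 0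

/-! ### Geodesics and the exponential map -/

/-- The metric in the coordinates of the chart around `x₀`, that is, the matrix of the products
of the coordinate vector fields. -/
def metricInChart (g : Metric4 X) (x₀ : X) (y : E4) : E4 →L[ℝ] E4 →L[ℝ] ℝ :=
  let A := coordFrame x₀ ((extChartAt (𝓡 4) x₀).symm y)
  (ContinuousLinearMap.precomp ℝ A).comp ((g.inner ((extChartAt (𝓡 4) x₀).symm y)).comp A)

/-- `γ` is a geodesic on the open set `T` of times: it is `C²`, and it satisfies in each chart the
geodesic equation `∇_{c'} c' = 0` of the Levi-Civita connection, that is, with `G` the metric in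
the chart,
`⟨∇_{c'} c', w⟩ = G(c'', w) + (D_{c'} G)(c', w) - (1/2) (D_w G)(c', c') = 0` for all `w`. -/
def IsGeodesicOn (g : Metric4 X) (γ : ℝ → X) (T : Set ℝ) : Prop :=
  ∀ t ∈ T, ContinuousAt γ t ∧ ∀ x₀ : X, γ t ∈ (extChartAt (𝓡 4) x₀).source →
    let c : ℝ → E4 := fun s => extChartAt (𝓡 4) x₀ (γ s)
    let G := metricInChart g x₀
    ContDiffAt ℝ 2 c t ∧ ∀ w : E4,
      G (c t) (deriv (deriv c) t) w + fderiv ℝ G (c t) (deriv c t) (deriv c t) w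
        - 1 / 2 * fderiv ℝ G (c t) w (deriv c t) (deriv c t) = 0

/-- `q` is the point at time `1` of a geodesic which starts at `p` with velocity `v`. -/
def IsExp (g : Metric4 X) (p : X) (v : TangentSpace (𝓡 4) p) (q : X) : Prop :=
  ∃ γ : ℝ → X, ∃ δ > 0, IsGeodesicOn g γ (Ioo (-δ) (1 + δ)) ∧ HasVelocityAt γ 0 p v ∧ γ 1 = q

open Classical in
/-- The exponential map of the metric. (Outside its domain of definition, which is all of `TX`
if `X` is compact, the value is the base point.) -/
def riemExp (g : Metric4 X) (u : TangentBundle (𝓡 4) X) : X :=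
  if h : ∃ q, IsExp g u.1 u.2 q then h.choose else u.1

/-- The open ball neighbourhood of radius `ε` of the zero section in the normal bundle `N` of `Z`,
where the radius may vary along `Z`. -/
def normalBall (g : Metric4 X) (Z : Set X) (ε : X → ℝ) : Set (TangentBundle (𝓡 4) X) :=
  {u | u.1 ∈ Z ∧ u.2 ∈ normalSpace g Z u.1 ∧ Real.sqrt (g.inner u.1 u.2 u.2) < ε u.1}

/-- The exponential map is defined on the subset `N₀` of `TX`, and embeds it in `X`. -/
def ExpEmbeds (g : Metric4 X) (N₀ : Set (TangentBundle (𝓡 4) X)) : Prop :=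
  (∀ u ∈ N₀, ∃ q, IsExp g u.1 u.2 q) ∧
    Topology.IsEmbedding (fun u : N₀ => riemExp g u.1)

/-- The sphere of radius `r` with centre zero in the span of `n 0, n 1, n 2` in `T_p X`,
parametrized by the unit sphere of `ℝ³`, and mapped to `X` by the exponential map. -/
def normalSphere (g : Metric4 X) (p : X) (n : Fin 3 → TangentSpace (𝓡 4) p) (r : ℝ) (y : S2) : X :=
  riemExp g ⟨p, r • ∑ i, (y : EuclideanSpace ℝ (Fin 3)) i • n i⟩

/-! ### The almost complex structure and its canonical bundle -/

/-- The metric at `x` as a bilinear form. -/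
def metricForm (g : Metric4 X) (x : X) : LinearMap.BilinForm ℝ (TangentSpace (𝓡 4) x) :=
  LinearMap.mk₂ ℝ (fun v w => g.inner x v w) (by simp) (by simp) (by simp) (by simp)

theorem metricForm_nondegenerate (g : Metric4 X) (x : X) : (metricForm g x).Nondegenerate := by
  constructor
  · intro v hv
    by_contra h
    exact (g.pos x v h).ne' (hv v)
  · intro v hv
    by_contra h
    exact (g.pos x v h).ne' (hv v)

theorem update_vec2_zero {V : Type*} (v w u : V) :
    Function.update ![v, w] 0 u = ![u, w] := by
  ext i; fin_cases i <;> rfl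

theorem update_vec2_one {V : Type*} (v w u : V) :
    Function.update ![v, w] 1 u = ![v, u] := by
  ext i; fin_cases i <;> rfl

/-- `α` as a skew homomorphism `T_x X → T_x^* X`, `v ↦ α(v, ·)`. -/
def formHom {x : X} (α : TangentSpace (𝓡 4) x [⋀^Fin 2]→L[ℝ] ℝ) :
    TangentSpace (𝓡 4) x →ₗ[ℝ] Module.Dual ℝ (TangentSpace (𝓡 4) x) :=
  LinearMap.mk₂ ℝ (fun v w => α ![v, w])
    (fun v v' w => by
      have h := α.map_update_add ![v, w] 0 v v'
      simpa only [update_vec2_zero] using h)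
    (fun c v w => by
      have h := α.map_update_smul ![v, w] 0 c v
      simpa only [update_vec2_zero] using h)
    (fun v w w' => by
      have h := α.map_update_add ![v, w] 1 w w'
      simpa only [update_vec2_one] using h)
    (fun c v w => by
      have h := α.map_update_smul ![v, w] 1 c w
      simpa only [update_vec2_one] using h)

/-- The endomorphism `g⁻¹α` of `T_x X`; so `g(g⁻¹α v, w) = α(v, w)`. -/
def gInv (g : Metric4 X) (x : X) (α : TangentSpace (𝓡 4) x [⋀^Fin 2]→L[ℝ] ℝ) :
    TangentSpace (𝓡 4) x →ₗ[ℝ] TangentSpace (𝓡 4) x :=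
  ((metricForm g x).toDual (metricForm_nondegenerate g x)).symm.toLinearMap ∘ₗ formHom α

theorem inner_gInv (g : Metric4 X) (x : X) (α : TangentSpace (𝓡 4) x [⋀^Fin 2]→L[ℝ] ℝ)
    (v w : TangentSpace (𝓡 4) x) : g.inner x (gInv g x α v) w = α ![v, w] := by
  have h := LinearMap.BilinForm.apply_toDual_symm_apply
    (hB := metricForm_nondegenerate g x) (formHom α v) w
  exact h

/-- The norm of a 2-form at `x`, for which the `eⁱ ∧ eʲ` with `i < j` are orthonormal when the `eⁱ`
are; that is, `|α|² = ∑_{i<j} α(eᵢ, eⱼ)² = - (1/2) tr ((g⁻¹α)²)`. -/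
def formNorm (g : Metric4 X) (x : X) (α : TangentSpace (𝓡 4) x [⋀^Fin 2]→L[ℝ] ℝ) : ℝ :=
  Real.sqrt (-(1 / 2) * LinearMap.trace ℝ (TangentSpace (𝓡 4) x) (gInv g x α ∘ₗ gInv g x α))

/-- The almost complex structure `J = √2 g⁻¹Ω / |Ω|` off the zero set of `Ω`. -/
def acs (g : Metric4 X) (Ω : TwoForm X) (x : X) :
    TangentSpace (𝓡 4) x →L[ℝ] TangentSpace (𝓡 4) x :=
  (Real.sqrt 2 / formNorm g x (Ω x)) • LinearMap.toContinuousLinearMap (gInv g x (Ω x))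

/-- The space `T^{1,0}` of complex 1-forms at `x` of type `(1,0)`: `α ∘ J = i α`. -/
def T10 {x : X} (J : TangentSpace (𝓡 4) x →L[ℝ] TangentSpace (𝓡 4) x) :
    Submodule ℂ (TangentSpace (𝓡 4) x →L[ℝ] ℂ) where
  carrier := {α | ∀ v, α (J v) = Complex.I * α v}
  add_mem' := fun {a b} ha hb v => by
    have h1 := ha v
    have h2 := hb v
    simp [h1, h2, mul_add]
  zero_mem' := fun v => by simp
  smul_mem' := fun c a ha v => by
    have h1 := ha v
    simp [h1]
    ring

/-- The fibre at `x` of the canonical bundle `K = Λ² T^{1,0}` of `J = √2 g⁻¹Ω / |Ω|`, in the space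
of complex 2-forms at `x`: it is spanned by the wedge products of forms in `T^{1,0}`. -/
def canonicalBundle (g : Metric4 X) (Ω : TwoForm X) (x : X) :
    Submodule ℂ (TangentSpace (𝓡 4) x [⋀^Fin 2]→L[ℝ] (Bundle.Trivial X ℂ x)) :=
  Submodule.span ℂ {θ | ∃ α ∈ T10 (acs g Ω x), ∃ β ∈ T10 (acs g Ω x),
    ∀ v w, θ ![v, w] = α v * β w - α w * β v}

/-- The model fibre of the bundle of complex 2-forms. -/
abbrev ComplexForms : Type := E4 [⋀^Fin 2]→L[ℝ] ℂ

/-- The almost complex structure `J` extends, as a continuous almost complex structure, over the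
set `U`. -/
def ExtendsOver (g : Metric4 X) (Ω : TwoForm X) (U : Set X) : Prop :=
  ∃ J : ∀ x : X, TangentSpace (𝓡 4) x →L[ℝ] TangentSpace (𝓡 4) x,
    ContinuousOn (fun x => (⟨x, J x⟩ : TotalSpace (E4 →L[ℝ] E4)
      (fun x : X => TangentSpace (𝓡 4) x →L[ℝ] TangentSpace (𝓡 4) x))) U ∧
    (∀ x ∈ U, ∀ v, J x (J x v) = -v) ∧
    ∀ x ∈ U, x ∉ zeroSet Ω → J x = acs g Ω x

end Manifold

end NearSymplectic

end

open NearSymplectic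

/-! `J` depends only on the positive ray through `Ω`, and near a zero `p` the form `Ω` is to first
order the linear map `∇Ω : N_p → Λ₊`. So as a normal sphere shrinks to `p`, `J` converges in each
direction `y ∈ S²` to the complex structure of the self-dual form `∇_y Ω` on `T_p X`. In an oriented
orthonormal basis this is `unitQuat (M y)`, and the orientation convention for `N` says that the 3 ×
3 matrix `M` has negative determinant. Such an `M` can be joined to `-1` by invertible matrices, so
only the family `y ↦ -y` has to be computed.

For `|w| = 1` the (2,0)-forms of `quat w` are the complex self-dual forms whose coefficient vector
satisfies `a × w = i a`. Taking real parts identifies this line with the plane orthogonal to `w`,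
with complex structure `x ↦ x × w`. For `w = -y` this is `T_y S²` with its usual complex structure,
of Chern number 2; `hasClutching_neg_sphere` shows it by explicit frames.

The limit becomes a homotopy through the contraction `H(y, t) = exp(t r y)` of the sphere to `p`.
`exists_frame` gives a continuous frame of `TX` along `H`. Read in it, `J` is a family of
endomorphisms of `ℝ⁴` over `S² × (0, 1]`, and the blow-up `FrameContinuousAt.tendsto_frameAcs`
extends it continuously to `t = 0`. This uses that `exp` has derivative 1 at zero
(`exists_exp_estimate`) and that `∇Ω` has self-dual values (`isSelfDualFor_nablaAtZero`). For `t >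
0` the form does not vanish on `H`, because `exp` is injective on the normal ball and fixes the zero
section. `HasClutching.homotopy` carries the Chern number from `t = 0` to `t = 1`, and
`HasClutching.hasWinding` shows that it does not depend on the frames: logarithms exist on the
contractible hemispheres.

The last assertion has a shorter proof: the limits of `J` along `v` and `-v` are opposite, so a
continuous extension would satisfy `J_p = -J_p`, hence `J_p = 0`, against `J_p² = -1`. -/

namespace NearSymplectic

set_option linter.unusedSectionVars false

/-! ### Families of complex lines over `S²` in a fixed vector space -/

section Lines

variable {W : Type*} [NormedAddCommGroup W] [NormedSpace ℂ W]

/-- `s` is a continuous frame over `A` of the family `L` of lines in the fixed space `W`. -/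
structure IsLineFrame (L : S2 → Submodule ℂ W) (A : Set S2) (s : S2 → W) : Prop where
  continuousOn : ContinuousOn s A
  ne_zero : ∀ y ∈ A, s y ≠ 0
  span_eq : ∀ y ∈ A, Submodule.span ℂ {s y} = L y

/-- The transition function from `sp` to `sm` along the equator has winding number `c`. -/
def HasWinding (sp sm : S2 → W) (c : ℤ) : Prop :=
  ∃ h : ℝ → ℂ, ContinuousOn h (Icc 0 (2 * Real.pi)) ∧
    (∀ t ∈ Icc 0 (2 * Real.pi), sm (equator t) = Complex.exp (h t) • sp (equator t)) ∧
    h (2 * Real.pi) - h 0 = 2 * Real.pi * Complex.I * c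

/-- The family of lines `L` has frames over the two hemispheres, whose transition function has
winding number `c`. -/
def HasClutching (L : S2 → Submodule ℂ W) (c : ℤ) : Prop :=
  ∃ sp sm : S2 → W, IsLineFrame L northHemisphere sp ∧ IsLineFrame L southHemisphere sm ∧
    HasWinding sp sm c

theorem continuous_equator : Continuous equator := by
  unfold equator
  refine Continuous.subtype_mk ?_ _
  refine (PiLp.continuous_toLp 2 _).comp ?_
  refine continuous_pi fun i => ?_
  fin_cases i <;> simp <;> fun_prop

theorem equator_mem_north (t : ℝ) : equator t ∈ northHemisphere := by
  simp [equator, northHemisphere]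

theorem equator_mem_south (t : ℝ) : equator t ∈ southHemisphere := by
  simp [equator, southHemisphere]

theorem equator_two_pi : equator (2 * Real.pi) = equator 0 := by
  simp [equator]

/-- A nowhere zero continuous function on a closed hemisphere has a continuous logarithm. -/
theorem exists_log_hemisphere {σ : ℝ} (hσ : σ * σ = 1) {u : S2 → ℂ}
    (hu : ContinuousOn u {y | 0 ≤ σ * (y : EuclideanSpace ℝ (Fin 3)) 2})
    (h0 : ∀ y : S2, 0 ≤ σ * (y : EuclideanSpace ℝ (Fin 3)) 2 → u y ≠ 0) :
    ∃ k : S2 → ℂ, ContinuousOn k {y | 0 ≤ σ * (y : EuclideanSpace ℝ (Fin 3)) 2} ∧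
      ∀ y : S2, 0 ≤ σ * (y : EuclideanSpace ℝ (Fin 3)) 2 → u y = Complex.exp (k y) := by
  classical
  set A : Set S2 := {y | 0 ≤ σ * (y : EuclideanSpace ℝ (Fin 3)) 2} with hA
  -- The pole of the hemisphere. The normalized segments from `N` to the points of `A` contract `A`
  -- within itself, and a logarithm is lifted along this contraction through the covering `exp`.
  let N : EuclideanSpace ℝ (Fin 3) := EuclideanSpace.single 2 σ
  let v : unitInterval × A → EuclideanSpace ℝ (Fin 3) := fun q =>
    (q.1 : ℝ) • (q.2.1 : EuclideanSpace ℝ (Fin 3)) + (1 - (q.1 : ℝ)) • N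
  have hv : Continuous v := by fun_prop
  have hv2 : ∀ q, σ * v q 2 =
      (q.1 : ℝ) * (σ * (q.2.1 : EuclideanSpace ℝ (Fin 3)) 2) + (1 - (q.1 : ℝ)) := by
    intro q
    simp only [v, N, PiLp.add_apply, PiLp.smul_apply, PiLp.single_apply, smul_eq_mul,
      if_true]
    linear_combination (1 - (q.1 : ℝ)) * hσ
  have hvn : ∀ q, v q ≠ 0 := by
    intro q hq
    have h1 := hv2 q
    have h2 : (0 : ℝ) ≤ σ * (q.2.1 : EuclideanSpace ℝ (Fin 3)) 2 := q.2.2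
    have h3 := mul_nonneg q.1.2.1 h2
    have h4 : (q.1 : ℝ) = 1 := by
      have := q.1.2.2
      rw [hq] at h1
      simp only [PiLp.zero_apply, mul_zero] at h1
      linarith
    have h5 : ‖(q.2.1 : EuclideanSpace ℝ (Fin 3))‖ = 1 := norm_eq_of_mem_sphere q.2.1
    simp only [v, h4, one_smul, sub_self, zero_smul, add_zero] at hq
    rw [hq, norm_zero] at h5
    exact zero_ne_one h5
  let cc : unitInterval × A → S2 := fun q =>
    ⟨(‖v q‖)⁻¹ • v q, by simp [norm_smul, hvn q]⟩
  have hcc : Continuous cc := by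
    refine Continuous.subtype_mk ?_ _
    exact (hv.norm.inv₀ fun q => norm_ne_zero_iff.2 (hvn q)).smul hv
  have hmem : ∀ q, cc q ∈ A := by
    intro q
    change 0 ≤ σ * ((‖v q‖)⁻¹ • v q) 2
    rw [PiLp.smul_apply, smul_eq_mul, mul_left_comm, hv2]
    have h2 : (0 : ℝ) ≤ σ * (q.2.1 : EuclideanSpace ℝ (Fin 3)) 2 := q.2.2
    have h3 := mul_nonneg q.1.2.1 h2
    have h4 := q.1.2.2
    have : 0 ≤ ‖v q‖⁻¹ := by positivity
    exact mul_nonneg this (by linarith)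
  have hc1 : ∀ a : A, cc (1, a) = a := by
    intro a
    apply Subtype.ext
    have h5 : ‖(a.1 : EuclideanSpace ℝ (Fin 3))‖ = 1 := norm_eq_of_mem_sphere a.1
    simp [cc, v, h5]
  have hN : ‖N‖ = 1 := by
    have : |σ| * |σ| = 1 := by rw [abs_mul_abs_self, hσ]
    have h1 : |σ| = 1 := by nlinarith [abs_nonneg σ]
    simp [N, h1]
  let N' : S2 := ⟨N, by simp [hN]⟩
  have hc0 : ∀ a : A, cc (0, a) = N' := by
    intro a
    apply Subtype.ext
    simp [cc, v, N', hN]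
  have hN'A : 0 ≤ σ * (N' : EuclideanSpace ℝ (Fin 3)) 2 := by
    simp only [N', N, PiLp.single_apply, if_true, hσ]
    exact zero_le_one
  let H : C(unitInterval × A, {z : ℂ // z ≠ 0}) :=
    ⟨fun q => ⟨u (cc q), h0 _ (hmem q)⟩, by
      refine Continuous.subtype_mk ?_ _
      exact hu.comp_continuous hcc hmem⟩
  let f : C(A, ℂ) := ContinuousMap.const _ (Complex.log (u N'))
  have hH : ∀ a, H (0, a) = (fun z : ℂ ↦ (⟨_, z.exp_ne_zero⟩ : {z : ℂ // z ≠ 0})) (f a) := by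
    intro a
    apply Subtype.ext
    simp only [H, f, ContinuousMap.coe_mk, ContinuousMap.const_apply, hc0,
      Complex.exp_log (h0 N' hN'A)]
  let K := Complex.isCoveringMap_exp.liftHomotopy H f hH
  have hK := Complex.isCoveringMap_exp.liftHomotopy_lifts H f hH
  refine ⟨fun y => if hy : y ∈ A then K (1, ⟨y, hy⟩) else 0, ?_, ?_⟩
  · rw [continuousOn_iff_continuous_domRestrict]
    have : A.domRestrict (fun y => if hy : y ∈ A then K (1, ⟨y, hy⟩) else 0) =
        fun a : A => K (1, a) := by
      ext a
      simp [a.2]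
    rw [this]
    exact K.continuous.comp (by fun_prop)
  · intro y hy
    have hy' : y ∈ A := hy
    have h1 := congrFun hK (1, ⟨y, hy'⟩)
    have h2 := congrArg Subtype.val h1
    simp only [Function.comp, H, ContinuousMap.coe_mk, hc1] at h2
    simp only [hy', dif_pos]
    exact h2.symm

theorem exists_log_north {u : S2 → ℂ} (hu : ContinuousOn u northHemisphere)
    (h0 : ∀ y ∈ northHemisphere, u y ≠ 0) :
    ∃ k : S2 → ℂ, ContinuousOn k northHemisphere ∧
      ∀ y ∈ northHemisphere, u y = Complex.exp (k y) := by
  have := exists_log_hemisphere (σ := 1) (by norm_num) (u := u)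
  simp only [one_mul] at this
  exact this hu h0

theorem exists_log_south {u : S2 → ℂ} (hu : ContinuousOn u southHemisphere)
    (h0 : ∀ y ∈ southHemisphere, u y ≠ 0) :
    ∃ k : S2 → ℂ, ContinuousOn k southHemisphere ∧
      ∀ y ∈ southHemisphere, u y = Complex.exp (k y) := by
  have := exists_log_hemisphere (σ := -1) (by norm_num) (u := u)
  simp only [neg_mul, one_mul, Left.nonneg_neg_iff] at this
  exact this hu h0

/-- Two frames of the same family of lines differ by a continuous nowhere zero function. -/
theorem IsLineFrame.exists_ratio {L : S2 → Submodule ℂ W} {A : Set S2} {s s' : S2 → W}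
    (hs : IsLineFrame L A s) (hs' : IsLineFrame L A s') :
    ∃ u : S2 → ℂ, ContinuousOn u A ∧ (∀ y ∈ A, u y ≠ 0) ∧ ∀ y ∈ A, s' y = u y • s y := by
  have h1 : ∀ y, ∃ c : ℂ, y ∈ A → s' y = c • s y := by
    intro y
    by_cases hy : y ∈ A
    · have : s' y ∈ Submodule.span ℂ {s y} := by
        rw [hs.span_eq y hy, ← hs'.span_eq y hy]
        exact Submodule.mem_span_singleton_self _
      obtain ⟨c, hc⟩ := Submodule.mem_span_singleton.1 this
      exact ⟨c, fun _ => hc.symm⟩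
    · exact ⟨0, fun h => absurd h hy⟩
  choose u hu using h1
  refine ⟨u, ?_, ?_, hu⟩
  · intro y hy
    -- A functional that does not vanish on `s y` exhibits the ratio near `y` as a quotient of
    -- continuous functions.
    obtain ⟨φ, hφ⟩ := SeparatingDual.exists_ne_zero (R := ℂ) (hs.ne_zero y hy)
    have hcs : ContinuousWithinAt (fun x => φ (s x)) A y :=
      φ.continuous.continuousAt.comp_continuousWithinAt (hs.continuousOn y hy)
    have hcs' : ContinuousWithinAt (fun x => φ (s' x)) A y :=
      φ.continuous.continuousAt.comp_continuousWithinAt (hs'.continuousOn y hy)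
    refine (hcs'.div hcs hφ).congr_of_eventuallyEq ?_ ?_
    · filter_upwards [hcs.eventually_ne hφ, self_mem_nhdsWithin] with x hx hxA
      rw [Pi.div_apply, hu x hxA, map_smul, smul_eq_mul, mul_div_cancel_right₀ _ hx]
    · rw [Pi.div_apply, hu y hy, map_smul, smul_eq_mul, mul_div_cancel_right₀ _ hφ]
  · intro y hy h
    apply hs'.ne_zero y hy
    rw [hu y hy, h, zero_smul]

/-- The winding number of the transition function does not depend on the frames. -/
theorem HasClutching.hasWinding {L : S2 → Submodule ℂ W} {c : ℤ} (hL : HasClutching L c)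
    {sp sm : S2 → W} (hp : IsLineFrame L northHemisphere sp)
    (hm : IsLineFrame L southHemisphere sm) : HasWinding sp sm c := by
  obtain ⟨sp₀, sm₀, hp₀, hm₀, h, hh, he, hc⟩ := hL
  obtain ⟨u, hu, hu0, hus⟩ := hp.exists_ratio hp₀
  obtain ⟨v, hv, hv0, hvs⟩ := hm₀.exists_ratio hm
  obtain ⟨k, hk, hku⟩ := exists_log_north hu hu0
  obtain ⟨l, hl, hlv⟩ := exists_log_south hv hv0
  -- `sm = e^l sm₀` and `sp₀ = e^k sp`. As `l` and `k` are functions on the hemispheres, they take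
  -- the same values at `t = 0` and `t = 2π` and do not change the winding number.
  refine ⟨fun t => l (equator t) + h t + k (equator t), ?_, ?_, ?_⟩
  · exact ((hl.comp continuous_equator.continuousOn fun t _ => equator_mem_south t).add hh).add
      (hk.comp continuous_equator.continuousOn fun t _ => equator_mem_north t)
  · intro t ht
    rw [hvs _ (equator_mem_south t), he t ht, hus _ (equator_mem_north t),
      hlv _ (equator_mem_south t), hku _ (equator_mem_north t), smul_smul, smul_smul,
      Complex.exp_add, Complex.exp_add]
  · simp only [equator_two_pi]
    linear_combination hc

/-- A family of lines with nonzero winding number has no global frame. -/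
theorem HasWinding.eq_zero_of_self {s : S2 → W} {c : ℤ} (h : HasWinding s s c)
    (h0 : ∀ t, s (equator t) ≠ 0) : c = 0 := by
  obtain ⟨h, hh, he, hc⟩ := h
  have h1 : ∀ t ∈ Icc 0 (2 * Real.pi), Complex.exp (h t) = 1 := by
    intro t ht
    have h2 := he t ht
    by_contra hne
    have h3 : (Complex.exp (h t) - 1) • s (equator t) = 0 := by
      rw [sub_smul, one_smul, ← h2, sub_self]
    rcases smul_eq_zero.1 h3 with h4 | h4
    · exact hne (sub_eq_zero.1 h4)
    · exact h0 t h4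
  have hpi := Real.pi_pos
  have hle : (0 : ℝ) ≤ 2 * Real.pi := by positivity
  let H : C(unitInterval, ℂ) := ⟨fun t => h (t * (2 * Real.pi)), by
    refine hh.comp_continuous (by fun_prop) fun t => ⟨?_, ?_⟩
    · exact mul_nonneg t.2.1 hle
    · exact mul_le_of_le_one_left hle t.2.2⟩
  have h2 : ∀ t : unitInterval, Complex.exp (H t) = 1 := fun t =>
    h1 _ ⟨mul_nonneg t.2.1 hle, mul_le_of_le_one_left hle t.2.2⟩
  have h3 : H 0 = H 1 := by
    -- On a connected space a lift through a covering of a constant map is constant.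
    refine Complex.isCoveringMap_exp.const_of_comp H.continuous (fun a a' => ?_) 0 1
    apply Subtype.ext
    simp only [h2]
  have h4 : h 0 = h (2 * Real.pi) := by simpa [H] using h3
  rw [h4, sub_self] at hc
  have h5 : (2 * Real.pi * Complex.I : ℂ) ≠ 0 := by simp [Real.pi_ne_zero]
  have h6 := (mul_eq_zero.1 hc.symm).resolve_left h5
  exact_mod_cast h6

/-- Frames and their winding number are carried over by a continuous family of linear maps, which
are injective on the lines. -/
theorem HasClutching.map {W' : Type*} [NormedAddCommGroup W'] [NormedSpace ℂ W']
    {L : S2 → Submodule ℂ W} {L' : S2 → Submodule ℂ W'} {c : ℤ}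
    (hL : HasClutching L c) {T : S2 → W → W'} (hT : Continuous fun q : S2 × W => T q.1 q.2)
    (hsmul : ∀ y (a : ℂ) w, T y (a • w) = a • T y w)
    (hmem : ∀ y, ∀ w ∈ L y, T y w ∈ L' y) (hinj : ∀ y, ∀ w ∈ L y, T y w = 0 → w = 0)
    (hline : ∀ y, ∀ w ∈ L' y, w ≠ 0 → Submodule.span ℂ {w} = L' y) :
    HasClutching L' c := by
  obtain ⟨sp, sm, hp, hm, h, hh, he, hc⟩ := hL
  have key : ∀ {A s}, IsLineFrame L A s → IsLineFrame L' A fun y => T y (s y) := by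
    intro A s hs
    have hs0 : ∀ y ∈ A, s y ∈ L y := fun y hy => by
      rw [← hs.span_eq y hy]
      exact Submodule.mem_span_singleton_self _
    have hs1 : ∀ y ∈ A, T y (s y) ≠ 0 := fun y hy h0 =>
      hs.ne_zero y hy (hinj y _ (hs0 y hy) h0)
    exact ⟨hT.comp_continuousOn (continuousOn_id.prodMk hs.continuousOn), hs1,
      fun y hy => hline y _ (hmem y _ (hs0 y hy)) (hs1 y hy)⟩
  exact ⟨_, _, key hp, key hm, h, hh, fun t ht => by simp only [he t ht, hsmul], hc⟩

end Lines

/-! ### Transport along a family of projections -/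

/-- Currying turns `Q` into a continuous map from the compact interval to `C(Y, V)`, which is
uniformly continuous for the sup norm. This gives a mesh that serves all `y` at once. -/
theorem exists_dist_lt_of_continuous {V Y : Type*} [NormedAddCommGroup V]
    [TopologicalSpace Y] [CompactSpace Y] {Q : Y × unitInterval → V} (hQ : Continuous Q)
    {ε : ℝ} (hε : 0 < ε) :
    ∃ δ > 0, ∀ y (t t' : unitInterval), dist t t' < δ → ‖Q (y, t) - Q (y, t')‖ < ε := by
  let G : unitInterval → C(Y, V) := fun t => ⟨fun y => Q (y, t), by fun_prop⟩
  have hG : Continuous G := ContinuousMap.continuous_of_continuous_uncurry _ (by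
    change Continuous fun q : unitInterval × Y => Q (q.2, q.1)
    fun_prop)
  have hu := CompactSpace.uniformContinuous_of_continuous hG
  obtain ⟨δ, hδ, h⟩ := Metric.uniformContinuous_iff.1 hu ε hε
  refine ⟨δ, hδ, fun y t t' htt => ?_⟩
  have h1 := h htt
  have h2 := ContinuousMap.dist_apply_le_dist (f := G t) (g := G t') y
  rw [← dist_eq_norm]
  exact lt_of_le_of_lt h2 h1

/-- A continuous family of idempotents over `Y × [0, 1]`, with `Y` compact, can be trivialized in
the direction of `[0, 1]`. -/
theorem exists_transport {𝕜 W Y : Type*} [RCLike 𝕜] [NormedAddCommGroup W] [NormedSpace 𝕜 W]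
    [TopologicalSpace Y] [CompactSpace Y] (Q : Y × unitInterval → W →L[𝕜] W) (hQ : Continuous Q)
    (hid : ∀ q w, Q q (Q q w) = Q q w) :
    ∃ T : Y × unitInterval → W →L[𝕜] W, Continuous T ∧
      (∀ y t w, Q (y, 0) w = w → Q (y, t) (T (y, t) w) = T (y, t) w) ∧
      (∀ y t w, Q (y, 0) w = w → T (y, t) w = 0 → w = 0) ∧
      (∀ y w, Q (y, 0) w = w → T (y, 0) w = w) ∧
      ∀ S : W → W, (∀ q w, Q q (S w) = S (Q q w)) → ∀ q w, T q (S w) = S (T q w) := by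
  obtain ⟨δ, hδ, hclose⟩ := exists_dist_lt_of_continuous hQ one_pos
  obtain ⟨m, hm⟩ := exists_nat_one_div_lt hδ
  -- The points `j t / (m + 1)` subdivide `[0, t]` and not `[0, 1]`: thus the composite of the
  -- projections at these points is continuous in `t`, and at `t = 0` it fixes the image of `Q (y,
  -- 0)`.
  let τ : ℕ → unitInterval → unitInterval := fun j t =>
    Set.projIcc 0 1 zero_le_one ((j : ℝ) / (m + 1) * t)
  have hτ : ∀ j, Continuous (τ j) := fun j => continuous_projIcc.comp (by fun_prop)
  have hτ0 : ∀ t, τ 0 t = 0 := fun t => by simp [τ]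
  have hτz : ∀ j, τ j 0 = 0 := fun t => by simp [τ]
  have hτ1 : ∀ t, τ (m + 1) t = t := fun t => by
    have : ((m + 1 : ℕ) : ℝ) / (m + 1) = 1 := by
      push_cast
      exact div_self (by positivity)
    change Set.projIcc 0 1 zero_le_one (((m + 1 : ℕ) : ℝ) / (m + 1) * t) = t
    rw [this, one_mul, Set.projIcc_val]
  have hτd : ∀ j t, dist (τ (j + 1) t) (τ j t) < δ := by
    intro j t
    refine lt_of_le_of_lt ?_ hm
    have h1 : ∀ a b : ℝ, dist (Set.projIcc (0 : ℝ) 1 zero_le_one a)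
        (Set.projIcc (0 : ℝ) 1 zero_le_one b) ≤ |a - b| := fun a b =>
      abs_projIcc_sub_projIcc zero_le_one
    refine (h1 _ _).trans ?_
    have h2 : ((j + 1 : ℕ) : ℝ) / (m + 1) * (t : ℝ) - (j : ℝ) / (m + 1) * t = 1 / (m + 1) * t := by
      push_cast; ring
    rw [h2, abs_of_nonneg (mul_nonneg (by positivity) t.2.1)]
    exact mul_le_of_le_one_right (by positivity) t.2.2
  let T : ℕ → Y × unitInterval → W →L[𝕜] W := fun j q =>
    Nat.rec (ContinuousLinearMap.id 𝕜 W) (fun i S => (Q (q.1, τ (i + 1) q.2)).comp S) j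
  have hT0 : ∀ q, T 0 q = ContinuousLinearMap.id 𝕜 W := fun q => rfl
  have hTs : ∀ j q, T (j + 1) q = (Q (q.1, τ (j + 1) q.2)).comp (T j q) := fun j q => rfl
  have hTc : ∀ j, Continuous (T j) := by
    intro j
    induction j with
    | zero => exact continuous_const
    | succ j ih =>
      have hτj := hτ (j + 1)
      have : Continuous fun q : Y × unitInterval => Q (q.1, τ (j + 1) q.2) := by fun_prop
      exact this.clm_comp ih
  have hT : ∀ j y t w, Q (y, 0) w = w → Q (y, τ j t) (T j (y, t) w) = T j (y, t) w ∧
      (T j (y, t) w = 0 → w = 0) := by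
    intro j y t w hw
    induction j with
    | zero => simp [hT0, hτ0, hw]
    | succ j ih =>
      refine ⟨?_, fun h0 => ih.2 ?_⟩
      · rw [hTs]
        exact hid _ _
      · rw [hTs, ContinuousLinearMap.comp_apply] at h0
        by_contra hne
        -- If a projection kills a nonzero vector which the preceding one fixes, their difference
        -- has norm at least 1 on it; the mesh excludes this.
        have h1 := hclose y _ _ (hτd j t)
        have h2 : (Q (y, τ (j + 1) t) - Q (y, τ j t)) (T j (y, t) w) = - T j (y, t) w := by
          rw [sub_apply, ih.1]
          simp only at h0
          rw [h0, zero_sub]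
        have h3 := (Q (y, τ (j + 1) t) - Q (y, τ j t)).le_opNorm (T j (y, t) w)
        rw [h2, norm_neg] at h3
        have h4 := norm_pos_iff.2 hne
        nlinarith
  refine ⟨T (m + 1), hTc (m + 1), fun y t w hw => ?_, fun y t w hw => (hT (m + 1) y t w hw).2, ?_, ?_⟩
  · have := (hT (m + 1) y t w hw).1
    rwa [hτ1] at this
  · intro y w hw
    have : ∀ j, T j (y, 0) w = w := by
      intro j
      induction j with
      | zero => rfl
      | succ j ih => rw [hTs, ContinuousLinearMap.comp_apply, ih, hτz, hw]
    exact this (m + 1)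
  · intro S hS q w
    have : ∀ j, T j q (S w) = S (T j q w) := by
      intro j
      induction j with
      | zero => rfl
      | succ j ih =>
        rw [hTs, ContinuousLinearMap.comp_apply, ih, hS]
        rfl
    exact this (m + 1)

/-! ### Complex structures on 4-dimensional spaces -/

section ComplexStructures

variable {T : Type*} [AddCommGroup T] [Module ℝ T] [TopologicalSpace T]

section TwoForms

variable {M : Type*} [AddCommGroup M] [Module ℝ M] [TopologicalSpace M]

theorem twoForm_add_left (θ : T [⋀^Fin 2]→L[ℝ] M) (u v w : T) :
    θ ![u + v, w] = θ ![u, w] + θ ![v, w] := by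
  have h := θ.map_update_add ![u, w] 0 u v
  simpa only [update_vec2_zero] using h

theorem twoForm_smul_left (θ : T [⋀^Fin 2]→L[ℝ] M) (a : ℝ) (u w : T) :
    θ ![a • u, w] = a • θ ![u, w] := by
  have h := θ.map_update_smul ![u, w] 0 a u
  simpa only [update_vec2_zero] using h

theorem twoForm_swap (θ : T [⋀^Fin 2]→L[ℝ] M) (u v : T) : θ ![u, v] = -θ ![v, u] := by
  have h := θ.toAlternatingMap.map_swap ![v, u] (i := 0) (j := 1) (by decide)
  have h2 : ![v, u] ∘ (Equiv.swap (0 : Fin 2) 1) = ![u, v] := by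
    ext i; fin_cases i <;> rfl
  rw [h2] at h
  exact h

theorem twoForm_self (θ : T [⋀^Fin 2]→L[ℝ] M) (u : T) : θ ![u, u] = 0 :=
  θ.map_eq_zero_of_eq ![u, u] (i := 0) (j := 1) rfl (by decide)

theorem twoForm_neg_left (θ : T [⋀^Fin 2]→L[ℝ] M) (u w : T) : θ ![-u, w] = -θ ![u, w] := by
  rw [← neg_one_smul ℝ u, twoForm_smul_left, neg_one_smul]

theorem twoForm_add_right (θ : T [⋀^Fin 2]→L[ℝ] M) (u v w : T) :
    θ ![w, u + v] = θ ![w, u] + θ ![w, v] := by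
  have h := θ.map_update_add ![w, u] 1 u v
  simpa only [update_vec2_one] using h

theorem twoForm_smul_right (θ : T [⋀^Fin 2]→L[ℝ] M) (a : ℝ) (u w : T) :
    θ ![w, a • u] = a • θ ![w, u] := by
  have h := θ.map_update_smul ![w, u] 1 a u
  simpa only [update_vec2_one] using h

theorem twoForm_ext {θ η : T [⋀^Fin 2]→L[ℝ] M} (h : ∀ u v, θ ![u, v] = η ![u, v]) : θ = η := by
  ext v
  have : v = ![v 0, v 1] := by
    ext i; fin_cases i <;> rfl
  rw [this]
  exact h _ _

theorem twoForm_ext_basis {θ η : T [⋀^Fin 2]→L[ℝ] M} {ι : Type*} (b : Module.Basis ι ℝ T)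
    (h : ∀ i j, θ ![b i, b j] = η ![b i, b j]) : θ = η := by
  apply ContinuousAlternatingMap.toAlternatingMap_injective
  refine Module.Basis.ext_alternating b fun v _ => ?_
  have : (fun i => b (v i)) = ![b (v 0), b (v 1)] := by
    ext i; fin_cases i <;> rfl
  rw [this]
  exact h _ _

/-- The 2-form `α ∧ β`. -/
noncomputable def wedge {T : Type*} [AddCommGroup T] [Module ℝ T] [TopologicalSpace T]
    (α β : T →L[ℝ] ℂ) : T [⋀^Fin 2]→L[ℝ] ℂ where
  toFun v := α (v 0) * β (v 1) - α (v 1) * β (v 0)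
  map_update_add' := by
    intro _ v i x y
    fin_cases i <;> simp <;> ring
  map_update_smul' := by
    intro _ v i a x
    fin_cases i <;> simp <;> ring
  cont := by fun_prop
  map_eq_zero_of_eq' := by
    intro v i j h hij
    have h2 : v 0 = v 1 := by
      fin_cases i <;> fin_cases j <;> simp_all
    simp [h2]

theorem wedge_apply (α β : T →L[ℝ] ℂ) (u v : T) :
    wedge α β ![u, v] = α u * β v - α v * β u := rfl

end TwoForms

/-- The complex 2-forms of type `(2,0)` with respect to `J`. -/
def typeTwoZero (J : T → T) : Submodule ℂ (T [⋀^Fin 2]→L[ℝ] ℂ) where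
  carrier := {θ | ∀ u v, θ ![J u, v] = Complex.I * θ ![u, v]}
  add_mem' := fun {a b} ha hb u v => by
    have h1 := ha u v
    have h2 := hb u v
    simp [h1, h2, mul_add]
  zero_mem' := fun u v => by simp
  smul_mem' := fun c a ha u v => by
    have h1 := ha u v
    simp [h1]
    ring

theorem mem_typeTwoZero {J : T → T} {θ : T [⋀^Fin 2]→L[ℝ] ℂ} :
    θ ∈ typeTwoZero J ↔ ∀ u v, θ ![J u, v] = Complex.I * θ ![u, v] := Iff.rfl

theorem typeTwoZero_right {J : T → T} {θ : T [⋀^Fin 2]→L[ℝ] ℂ} (h : θ ∈ typeTwoZero J) (u v : T) :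
    θ ![u, J v] = Complex.I * θ ![u, v] := by
  rw [twoForm_swap, h, twoForm_swap θ v u]
  ring

/-- A complex structure on a 4-dimensional space has a basis `u, Ju, v, Jv`. -/
theorem exists_complex_basis {T : Type*} [AddCommGroup T] [Module ℝ T] (hd : Module.finrank ℝ T = 4) (J : T →ₗ[ℝ] T)
    (hJ : ∀ v, J (J v) = -v) :
    ∃ b : Module.Basis (Fin 4) ℝ T, b 1 = J (b 0) ∧ b 3 = J (b 2) := by
  have : Nontrivial T := Module.nontrivial_of_finrank_pos (R := ℝ) (by omega)
  have : FiniteDimensional ℝ T := Module.finite_of_finrank_pos (by omega)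
  obtain ⟨u, hu⟩ := exists_ne (0 : T)
  have hlt : Submodule.span ℝ {u, J u} ≠ ⊤ := by
    classical
    intro h
    have h1 := finrank_span_finset_le_card (R := ℝ) ({u, J u} : Finset T)
    rw [Set.finrank, Finset.coe_pair, h, finrank_top, hd] at h1
    have h2 := Finset.card_le_two (a := u) (b := J u)
    omega
  obtain ⟨v, hv⟩ : ∃ v, v ∉ Submodule.span ℝ {u, J u} := by
    by_contra hcon
    push Not at hcon
    exact hlt (Submodule.eq_top_iff'.2 hcon)
  have hli : LinearIndependent ℝ ![u, J u, v, J v] := by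
    rw [Fintype.linearIndependent_iff]
    intro c hc
    simp only [Fin.sum_univ_four, Matrix.cons_val] at hc
    have hc' := congrArg J hc
    simp only [map_add, map_smul, hJ, map_zero] at hc'
    have h23 : c 2 * c 2 + c 3 * c 3 = 0 := by
      by_contra hne
      apply hv
      -- With `J` in the role of `i`, the relation is multiplied by `c 2 - i c 3`, which eliminates
      -- `J v`.
      have h1 : (c 2 * c 2 + c 3 * c 3) • v =
          (-(c 2 * c 0 + c 3 * c 1)) • u + (-(c 2 * c 1 - c 3 * c 0)) • J u := by
        linear_combination (norm := module) c 2 • hc - c 3 • hc'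
      rw [Submodule.mem_span_pair]
      refine ⟨(c 2 * c 2 + c 3 * c 3)⁻¹ * (-(c 2 * c 0 + c 3 * c 1)),
        (c 2 * c 2 + c 3 * c 3)⁻¹ * (-(c 2 * c 1 - c 3 * c 0)), ?_⟩
      rw [mul_smul, mul_smul, ← smul_add, ← h1, smul_smul, inv_mul_cancel₀ hne, one_smul]
    have h2 : c 2 = 0 := by nlinarith [mul_self_nonneg (c 2), mul_self_nonneg (c 3)]
    have h3 : c 3 = 0 := by nlinarith [mul_self_nonneg (c 2), mul_self_nonneg (c 3)]
    rw [h2, h3] at hc hc'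
    have h01 : (c 0 * c 0 + c 1 * c 1) • u = 0 := by
      linear_combination (norm := module) c 0 • hc - c 1 • hc'
    have h01' := (smul_eq_zero.1 h01).resolve_right hu
    have h0 : c 0 = 0 := by nlinarith [mul_self_nonneg (c 0), mul_self_nonneg (c 1)]
    have h1 : c 1 = 0 := by nlinarith [mul_self_nonneg (c 0), mul_self_nonneg (c 1)]
    intro i
    fin_cases i <;> assumption
  let b := basisOfLinearIndependentOfCardEqFinrank hli (by simp [hd])
  exact ⟨b, by simp [b], by simp [b]⟩

variable [IsTopologicalAddGroup T] [ContinuousSMul ℝ T] [T2Space T]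

/-- For a complex structure on a 4-dimensional space, the forms of type `(2,0)` are the multiples
of the wedge product of two independent forms of type `(1,0)`. -/
theorem exists_wedge_generator (hd : Module.finrank ℝ T = 4) (J : T →ₗ[ℝ] T)
    (hJ : ∀ v, J (J v) = -v) :
    ∃ α β : T →L[ℝ] ℂ, (∀ v, α (J v) = Complex.I * α v) ∧ (∀ v, β (J v) = Complex.I * β v) ∧
      ∀ θ ∈ typeTwoZero J, ∃ c : ℂ, θ = c • wedge α β := by
  have : FiniteDimensional ℝ T := Module.finite_of_finrank_pos (by omega)
  obtain ⟨b, h1, h3⟩ := exists_complex_basis hd J hJ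
  have h1' : J (b 1) = -b 0 := by rw [h1, hJ]
  have h3' : J (b 3) = -b 2 := by rw [h3, hJ]
  let α : T →L[ℝ] ℂ := LinearMap.toContinuousLinearMap (b.constr ℝ ![1, Complex.I, 0, 0])
  let β : T →L[ℝ] ℂ := LinearMap.toContinuousLinearMap (b.constr ℝ ![0, 0, 1, Complex.I])
  have hα : ∀ i, α (b i) = ![1, Complex.I, 0, 0] i := fun i => by
    simp [α]
  have hβ : ∀ i, β (b i) = ![0, 0, 1, Complex.I] i := fun i => by
    simp [β]
  have key : ∀ γ : T →L[ℝ] ℂ, (∀ i, γ (J (b i)) = Complex.I * γ (b i)) →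
      ∀ v, γ (J v) = Complex.I * γ v := by
    intro γ h v
    have : γ.toLinearMap ∘ₗ J = Complex.I • γ.toLinearMap := b.ext fun i => by
      simpa using h i
    simpa using LinearMap.congr_fun this v
  have hαJ : ∀ v, α (J v) = Complex.I * α v := by
    refine key α fun i => ?_
    fin_cases i <;> simp [← h1, ← h3, h1', h3', hα]
  have hβJ : ∀ v, β (J v) = Complex.I * β v := by
    refine key β fun i => ?_
    fin_cases i <;> simp [← h1, ← h3, h1', h3', hβ]
  refine ⟨α, β, hαJ, hβJ, fun θ hθ => ⟨θ ![b 0, b 2], ?_⟩⟩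
  have hw : wedge α β ∈ typeTwoZero J := fun u v => by
    simp only [wedge_apply, hαJ, hβJ]
    ring
  -- Forms of type (2,0) are complex bilinear with respect to `J`, so one which vanishes on `(b 0, b
  -- 2)` vanishes on all pairs of basis vectors.
  set D := θ - θ ![b 0, b 2] • wedge α β with hD
  have hDJ : D ∈ typeTwoZero J := Submodule.sub_mem _ hθ (Submodule.smul_mem _ _ hw)
  have h02 : D ![b 0, b 2] = 0 := by
    simp [hD, wedge_apply, hα, hβ]
  have h20 : D ![b 2, b 0] = 0 := by rw [twoForm_swap, h02, neg_zero]
  have hz : D = 0 := by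
    refine twoForm_ext_basis b fun i j => ?_
    fin_cases i <;> fin_cases j <;>
      simp [h1, h3, hDJ _ _, typeTwoZero_right hDJ, twoForm_self, h02, h20]
  exact sub_eq_zero.1 hz

theorem span_eq_typeTwoZero (hd : Module.finrank ℝ T = 4) (J : T →ₗ[ℝ] T)
    (hJ : ∀ v, J (J v) = -v) {θ : T [⋀^Fin 2]→L[ℝ] ℂ} (hθ : θ ∈ typeTwoZero J) (h0 : θ ≠ 0) :
    Submodule.span ℂ {θ} = typeTwoZero J := by
  obtain ⟨α, β, -, -, h⟩ := exists_wedge_generator hd J hJ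
  apply le_antisymm
  · rw [Submodule.span_singleton_le_iff_mem]
    exact hθ
  · intro η hη
    obtain ⟨c, hc⟩ := h θ hθ
    obtain ⟨d, hd⟩ := h η hη
    have hc0 : c ≠ 0 := by
      rintro rfl
      exact h0 (hc.trans (zero_smul ℂ (wedge α β)))
    rw [Submodule.mem_span_singleton]
    exact ⟨d * c⁻¹, by rw [hc, smul_smul, mul_assoc, inv_mul_cancel₀ hc0, mul_one, ← hd]⟩

/-- This replaces the canonical bundle by a linear condition on 2-forms, for which there is a
projection that varies continuously with `J`. -/
theorem span_wedge_eq_typeTwoZero (hd : Module.finrank ℝ T = 4) (J : T →ₗ[ℝ] T)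
    (hJ : ∀ v, J (J v) = -v) :
    Submodule.span ℂ {θ : T [⋀^Fin 2]→L[ℝ] ℂ | ∃ α : T →L[ℝ] ℂ, (∀ v, α (J v) = Complex.I * α v) ∧
      ∃ β : T →L[ℝ] ℂ, (∀ v, β (J v) = Complex.I * β v) ∧
      ∀ v w, θ ![v, w] = α v * β w - α w * β v} = typeTwoZero J := by
  apply le_antisymm
  · rw [Submodule.span_le]
    rintro θ ⟨α, hα, β, hβ, h⟩ u v
    rw [h, h, hα, hβ]
    ring
  · intro θ hθ
    obtain ⟨α, β, hα, hβ, h⟩ := exists_wedge_generator hd J hJ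
    obtain ⟨c, hc⟩ := h θ hθ
    rw [hc]
    exact Submodule.smul_mem _ _ (Submodule.subset_span ⟨α, hα, β, hβ, fun v w => rfl⟩)

end ComplexStructures

/-! ### The projection to the forms of type `(2,0)` -/

/-- The projection of the complex 2-forms on `ℝ⁴` to the forms of type `(2,0)`. -/
noncomputable def projTwoZero (J : E4 →L[ℝ] E4) : ComplexForms →L[ℝ] ComplexForms :=
  -- The projection `(1 - iJ)/2` to the (1,0)-part is applied in both arguments. The mixed terms
  -- `θ(Ju, v) + θ(u, Jv)` are obtained by polarization from the pullbacks by `1 + J` and `J`, and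
  -- pullbacks depend continuously on the map.
  (1 / 4 : ℝ) • (ContinuousLinearMap.id ℝ _ - Complex.I •
    (ContinuousAlternatingMap.compContinuousLinearMapCLM (ContinuousLinearMap.id ℝ E4 + J) -
      ContinuousLinearMap.id ℝ _ - ContinuousAlternatingMap.compContinuousLinearMapCLM J) -
    ContinuousAlternatingMap.compContinuousLinearMapCLM J)

theorem continuous_projection_formula {V : Type*} [NormedAddCommGroup V] [NormedSpace ℝ V]
    [NormedSpace ℂ V] [SMulCommClass ℝ ℂ V] {X : Type*} [TopologicalSpace X]
    {A B : X → V →L[ℝ] V} (hA : Continuous A) (hB : Continuous B) :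
    Continuous fun x => (1 / 4 : ℝ) • (ContinuousLinearMap.id ℝ V -
      Complex.I • (A x - ContinuousLinearMap.id ℝ V - B x) - B x) := by
  fun_prop

theorem continuous_projTwoZero : Continuous projTwoZero := by
  have h : Continuous fun J : E4 →L[ℝ] E4 =>
      (ContinuousAlternatingMap.compContinuousLinearMapCLM J : ComplexForms →L[ℝ] ComplexForms) :=
    ContinuousAlternatingMap.continuous_compContinuousLinearMapCLM
  exact continuous_projection_formula (h.comp (by fun_prop :
    Continuous fun J : E4 →L[ℝ] E4 => ContinuousLinearMap.id ℝ E4 + J)) h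

set_option synthInstance.maxHeartbeats 400000 in
theorem projTwoZero_apply (J : E4 →L[ℝ] E4) (θ : ComplexForms) (u v : E4) :
    projTwoZero J θ ![u, v] = (1 / 4 : ℝ) * (θ ![u, v] - Complex.I * (θ ![J u, v] + θ ![u, J v]) -
      θ ![J u, J v]) := by
  have h : ∀ (A : E4 →L[ℝ] E4) (a b : E4), A ∘ ![a, b] = ![A a, A b] := fun A a b => by
    ext i : 1; fin_cases i <;> rfl
  have h' : (id + ⇑J) ∘ ![u, v] = ![u + J u, v + J v] := by
    ext i : 1; fin_cases i <;> rfl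
  simp [projTwoZero, h, h', twoForm_add_left, twoForm_add_right]
  ring

theorem projTwoZero_smul (J : E4 →L[ℝ] E4) (a : ℂ) (θ : ComplexForms) :
    projTwoZero J (a • θ) = a • projTwoZero J θ := by
  refine twoForm_ext fun u v => ?_
  rw [ContinuousAlternatingMap.smul_apply, projTwoZero_apply, projTwoZero_apply]
  simp
  ring

theorem projTwoZero_mem {J : E4 →L[ℝ] E4} (hJ : ∀ v, J (J v) = -v) (θ : ComplexForms) :
    projTwoZero J θ ∈ typeTwoZero J := by
  intro u v
  simp only [projTwoZero_apply, hJ, twoForm_neg_left]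
  push_cast
  linear_combination (1 / 4 : ℂ) * (θ ![u, J v] + θ ![J u, v]) * Complex.I_sq

theorem projTwoZero_of_mem {J : E4 →L[ℝ] E4} {θ : ComplexForms} (h : θ ∈ typeTwoZero J) :
    projTwoZero J θ = θ := by
  refine twoForm_ext fun u v => ?_
  rw [projTwoZero_apply, h u (J v), typeTwoZero_right h, h]
  push_cast
  linear_combination (-3 / 4 : ℂ) * θ ![u, v] * Complex.I_sq

theorem projTwoZero_eq_iff {J : E4 →L[ℝ] E4} (hJ : ∀ v, J (J v) = -v) {θ : ComplexForms} :
    projTwoZero J θ = θ ↔ θ ∈ typeTwoZero J :=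
  ⟨fun h => h ▸ projTwoZero_mem hJ θ, projTwoZero_of_mem⟩

/-- The winding number of the canonical bundle is invariant under homotopies of the complex
structure. -/
theorem HasClutching.homotopy {J : S2 × unitInterval → E4 →L[ℝ] E4} (hJc : Continuous J)
    (hJ : ∀ q v, J q (J q v) = -v) {c : ℤ}
    (h : HasClutching (fun y => typeTwoZero (J (y, 0))) c) :
    HasClutching (fun y => typeTwoZero (J (y, 1))) c := by
  obtain ⟨T, hT, h1, h2, -, h4⟩ := exists_transport (fun q => projTwoZero (J q))
    (continuous_projTwoZero.comp hJc)
    (fun q w => projTwoZero_of_mem (projTwoZero_mem (hJ q) w))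
  refine h.map (T := fun y => T (y, 1)) ?_ ?_ ?_ ?_ ?_
  · have : Continuous fun q : S2 × ComplexForms => T (q.1, 1) := by fun_prop
    exact this.clm_apply continuous_snd
  · intro y a w
    -- The transport was built from real linear maps; it commutes with complex scalars because the
    -- projections do.
    exact h4 (fun w => a • w) (fun q w => projTwoZero_smul _ _ _) _ _
  · intro y w hw
    have := h1 y 1 w (projTwoZero_of_mem hw)
    exact (projTwoZero_eq_iff (hJ _)).1 this
  · intro y w hw h0
    exact h2 y 1 w (projTwoZero_of_mem hw) h0
  · intro y w hw h0
    exact span_eq_typeTwoZero (by simp) (J (y, 1)).toLinearMap (hJ _) hw h0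

/-! ### The linear model -/

section LinearModel

/-- The endomorphism `w₁ I + w₂ J + w₃ K` of `ℝ⁴`, where `I, J, K` belong to the self-dual forms
`e⁰ ∧ e¹ + e² ∧ e³`, `e⁰ ∧ e² - e¹ ∧ e³`, `e⁰ ∧ e³ + e¹ ∧ e²`. -/
noncomputable def quat : (Fin 3 → ℝ) →ₗ[ℝ] E4 →L[ℝ] E4 where
  toFun w := LinearMap.toContinuousLinearMap
    { toFun := fun v => !₂[-(w 0 * v 1) - w 1 * v 2 - w 2 * v 3,
        w 0 * v 0 - w 2 * v 2 + w 1 * v 3, w 1 * v 0 + w 2 * v 1 - w 0 * v 3,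
        w 2 * v 0 - w 1 * v 1 + w 0 * v 2]
      map_add' := fun u v => by
        ext i; fin_cases i <;> simp <;> ring
      map_smul' := fun a v => by
        ext i; fin_cases i <;> simp <;> ring }
  map_add' u v := by
    ext x i; fin_cases i <;> simp <;> ring
  map_smul' a v := by
    ext x i; fin_cases i <;> simp <;> ring

theorem quat_apply (w : Fin 3 → ℝ) (v : E4) :
    quat w v = !₂[-(w 0 * v 1) - w 1 * v 2 - w 2 * v 3,
        w 0 * v 0 - w 2 * v 2 + w 1 * v 3, w 1 * v 0 + w 2 * v 1 - w 0 * v 3,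
        w 2 * v 0 - w 1 * v 1 + w 0 * v 2] := rfl

theorem quat_quat (w : Fin 3 → ℝ) (v : E4) :
    quat w (quat w v) = -(w 0 ^ 2 + w 1 ^ 2 + w 2 ^ 2) • v := by
  ext i
  fin_cases i <;> simp [quat_apply] <;> ring

theorem continuous_quat : Continuous quat := quat.continuous_of_finiteDimensional

/-- The normalization of `quat w`, a complex structure if `w ≠ 0`. -/
noncomputable def unitQuat (w : Fin 3 → ℝ) : E4 →L[ℝ] E4 :=
  (Real.sqrt (w 0 ^ 2 + w 1 ^ 2 + w 2 ^ 2))⁻¹ • quat w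

theorem sum_sq_pos {w : Fin 3 → ℝ} (hw : w ≠ 0) : 0 < w 0 ^ 2 + w 1 ^ 2 + w 2 ^ 2 := by
  by_contra h
  apply hw
  have h0 := sq_nonneg (w 0)
  have h1 := sq_nonneg (w 1)
  have h2 := sq_nonneg (w 2)
  ext i
  fin_cases i <;> simp <;> nlinarith

theorem unitQuat_unitQuat {w : Fin 3 → ℝ} (hw : w ≠ 0) (v : E4) :
    unitQuat w (unitQuat w v) = -v := by
  have h := sum_sq_pos hw
  have h2 := Real.mul_self_sqrt h.le
  have h3 := (Real.sqrt_pos.2 h).ne'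
  simp only [unitQuat, smul_apply, map_smul, quat_quat, smul_smul]
  rw [← neg_one_smul ℝ v]
  congr 1
  generalize Real.sqrt (w 0 ^ 2 + w 1 ^ 2 + w 2 ^ 2) = r at h2 h3 ⊢
  rw [← h2]
  field_simp

theorem continuousOn_unitQuat : ContinuousOn unitQuat {w | w ≠ 0} := by
  unfold unitQuat
  have h : Continuous fun w : Fin 3 → ℝ => Real.sqrt (w 0 ^ 2 + w 1 ^ 2 + w 2 ^ 2) := by fun_prop
  refine ContinuousOn.smul (ContinuousOn.inv₀ h.continuousOn fun w hw => ?_)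
    continuous_quat.continuousOn
  exact (Real.sqrt_pos.2 (sum_sq_pos hw)).ne'

/-- The coordinate functions, as complex 1-forms. -/
noncomputable def coordForm (i : Fin 4) : E4 →L[ℝ] ℂ :=
  Complex.ofRealCLM.comp (EuclideanSpace.proj i)

/-- The complex self-dual 2-form with coefficients `a`. -/
noncomputable def sdForm (a : Fin 3 → ℂ) : ComplexForms :=
  a 0 • (wedge (coordForm 0) (coordForm 1) + wedge (coordForm 2) (coordForm 3)) +
  a 1 • (wedge (coordForm 0) (coordForm 2) - wedge (coordForm 1) (coordForm 3)) +
  a 2 • (wedge (coordForm 0) (coordForm 3) + wedge (coordForm 1) (coordForm 2))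

theorem sdForm_apply (a : Fin 3 → ℂ) (u v : E4) :
    sdForm a ![u, v] = a 0 * (u 0 * v 1 - v 0 * u 1 + (u 2 * v 3 - v 2 * u 3)) +
      a 1 * (u 0 * v 2 - v 0 * u 2 - (u 1 * v 3 - v 1 * u 3)) +
      a 2 * (u 0 * v 3 - v 0 * u 3 + (u 1 * v 2 - v 1 * u 2)) := by
  simp [sdForm, wedge_apply, coordForm]
  ring

theorem sdForm_smul (c : ℂ) (a : Fin 3 → ℂ) : sdForm (c • a) = c • sdForm a := by
  refine twoForm_ext fun u v => ?_
  rw [ContinuousAlternatingMap.smul_apply, sdForm_apply, sdForm_apply]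
  simp
  ring

theorem sdForm_ne_zero {a : Fin 3 → ℂ} (ha : a ≠ 0) : sdForm a ≠ 0 := by
  intro h
  apply ha
  have key : ∀ u v : E4, sdForm a ![u, v] = 0 := fun u v => by rw [h]; rfl
  have h0 := key (EuclideanSpace.single 0 1) (EuclideanSpace.single 1 1)
  have h1 := key (EuclideanSpace.single 0 1) (EuclideanSpace.single 2 1)
  have h2 := key (EuclideanSpace.single 0 1) (EuclideanSpace.single 3 1)
  rw [sdForm_apply] at h0 h1 h2
  simp at h0 h1 h2
  ext i
  fin_cases i <;> simp [h0, h1, h2]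

/-- The hypotheses say `a · w = 0` and `a × w = i a`. The left side minus the right side of the
(2,0)-condition is a combination of these four equations, with coefficients the inner product of `u`
and `v` and the three self-dual components of `u ∧ v`. -/
theorem sdForm_mem {a : Fin 3 → ℂ} {w : Fin 3 → ℝ}
    (h : a 0 * w 0 + a 1 * w 1 + a 2 * w 2 = 0)
    (h0 : a 1 * w 2 - a 2 * w 1 = Complex.I * a 0)
    (h1 : a 2 * w 0 - a 0 * w 2 = Complex.I * a 1)
    (h2 : a 0 * w 1 - a 1 * w 0 = Complex.I * a 2) :
    sdForm a ∈ typeTwoZero (quat w) := by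
  intro u v
  rw [sdForm_apply, sdForm_apply, quat_apply]
  simp
  linear_combination -(u 0 * v 0 + u 1 * v 1 + u 2 * v 2 + u 3 * v 3 : ℂ) * h +
    (u 0 * v 1 - v 0 * u 1 + (u 2 * v 3 - v 2 * u 3) : ℂ) * h0 +
    (u 0 * v 2 - v 0 * u 2 - (u 1 * v 3 - v 1 * u 3) : ℂ) * h1 +
    (u 0 * v 3 - v 0 * u 3 + (u 1 * v 2 - v 1 * u 2) : ℂ) * h2

/-- Coefficients of the frame over the northern hemisphere. -/
noncomputable def northCoeff (y : EuclideanSpace ℝ (Fin 3)) : Fin 3 → ℂ :=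
  let z : ℂ := y 0 - Complex.I * y 1
  let d : ℂ := 1 + y 2
  ![d ^ 2 - z ^ 2, -(Complex.I * (d ^ 2 + z ^ 2)), -(2 * d * z)]

/-- Coefficients of the frame over the southern hemisphere. -/
noncomputable def southCoeff (y : EuclideanSpace ℝ (Fin 3)) : Fin 3 → ℂ :=
  let z : ℂ := y 0 + Complex.I * y 1
  let d : ℂ := 1 - y 2
  ![z ^ 2 - d ^ 2, -(Complex.I * (z ^ 2 + d ^ 2)), -(2 * d * z)]

theorem sphere_eq (y : S2) : ((y : EuclideanSpace ℝ (Fin 3)) 0 : ℂ) ^ 2 +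
    ((y : EuclideanSpace ℝ (Fin 3)) 1 : ℂ) ^ 2 + ((y : EuclideanSpace ℝ (Fin 3)) 2 : ℂ) ^ 2 = 1 := by
  have h : ‖(y : EuclideanSpace ℝ (Fin 3))‖ = 1 := norm_eq_of_mem_sphere y
  have h2 := EuclideanSpace.real_norm_sq_eq (y : EuclideanSpace ℝ (Fin 3))
  rw [h, Fin.sum_univ_three] at h2
  have h3 := congrArg (fun x : ℝ => (x : ℂ)) h2
  push_cast at h3
  rw [← h3]; norm_num

theorem northCoeff_mem (y : S2) : sdForm (northCoeff y) ∈
    typeTwoZero (quat (-(y : EuclideanSpace ℝ (Fin 3)).ofLp)) := by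
  have hs := sphere_eq y
  have hI := Complex.I_sq
  refine sdForm_mem ?_ ?_ ?_ ?_ <;> simp [northCoeff] <;> grind

theorem southCoeff_mem (y : S2) : sdForm (southCoeff y) ∈
    typeTwoZero (quat (-(y : EuclideanSpace ℝ (Fin 3)).ofLp)) := by
  have hs := sphere_eq y
  have hI := Complex.I_sq
  refine sdForm_mem ?_ ?_ ?_ ?_ <;> simp [southCoeff] <;> grind

/-- Both coefficient vectors are isotropic, and quadratic in a spinor: `(1 + y₂, y₀ - i y₁)` in the
north, `(y₀ + i y₁, 1 - y₂)` in the south. The second spinor is `(y₀ + i y₁)/(1 + y₂)` times the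
first, which on the equator is `e^{it}`. Squaring gives winding number 2. -/
theorem southCoeff_equator (t : ℝ) : southCoeff (equator t) =
    Complex.exp (2 * (t * Complex.I)) • northCoeff (equator t) := by
  have he : Complex.exp (2 * (t * Complex.I)) =
      (Complex.cos t + Complex.sin t * Complex.I) ^ 2 := by
    rw [← Complex.exp_mul_I, ← Complex.exp_nat_mul]
    norm_num
  have hcs := Complex.sin_sq_add_cos_sq (t : ℂ)
  have hI := Complex.I_sq
  rw [he]
  ext i
  fin_cases i <;> simp [northCoeff, southCoeff, equator] <;> grind

theorem coe_ne_zero (y : S2) : (y : EuclideanSpace ℝ (Fin 3)).ofLp ≠ 0 := by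
  intro h
  have h1 : ‖(y : EuclideanSpace ℝ (Fin 3))‖ = 1 := norm_eq_of_mem_sphere y
  have h2 : (y : EuclideanSpace ℝ (Fin 3)) = 0 := by
    ext i; exact congrFun h i
  rw [h2, norm_zero] at h1
  exact zero_ne_one h1

theorem unitQuat_neg_sphere (y : S2) : unitQuat (-(y : EuclideanSpace ℝ (Fin 3)).ofLp) =
    quat (-(y : EuclideanSpace ℝ (Fin 3)).ofLp) := by
  have h2 := EuclideanSpace.real_norm_sq_eq (y : EuclideanSpace ℝ (Fin 3))
  rw [norm_eq_of_mem_sphere y, Fin.sum_univ_three] at h2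
  simp [unitQuat, ← h2]

/-- The canonical bundle of the family of complex structures `-y`, for `y ∈ S²`. -/
theorem hasClutching_neg_sphere :
    HasClutching (fun y => typeTwoZero (unitQuat (-(y : EuclideanSpace ℝ (Fin 3)).ofLp))) 2 := by
  have hsd : Continuous sdForm := by unfold sdForm; fun_prop
  have hfr : ∀ (s : EuclideanSpace ℝ (Fin 3) → Fin 3 → ℂ) (A : Set S2), Continuous s →
      (∀ y : S2, sdForm (s y) ∈ typeTwoZero (quat (-(y : EuclideanSpace ℝ (Fin 3)).ofLp))) →
      (∀ y ∈ A, s y ≠ 0) →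
      IsLineFrame (fun y => typeTwoZero (unitQuat (-(y : EuclideanSpace ℝ (Fin 3)).ofLp))) A
        fun y => sdForm (s y) := by
    intro s A hs hm h0
    refine ⟨(hsd.comp (hs.comp continuous_subtype_val)).continuousOn,
      fun y hy => sdForm_ne_zero (h0 y hy), fun y hy => ?_⟩
    refine span_eq_typeTwoZero (by simp)
      (unitQuat (-(y : EuclideanSpace ℝ (Fin 3)).ofLp)).toLinearMap
      (unitQuat_unitQuat (neg_ne_zero.2 (coe_ne_zero y))) ?_ (sdForm_ne_zero (h0 y hy))
    have := hm y
    rw [← unitQuat_neg_sphere] at this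
    exact this
  refine ⟨_, _, hfr northCoeff _ ?_ northCoeff_mem ?_, hfr southCoeff _ ?_ southCoeff_mem ?_, ?_⟩
  · refine continuous_pi fun i => ?_
    fin_cases i <;> simp [northCoeff] <;> fun_prop
  · intro y hy h
    have hy' : (0 : ℝ) ≤ (y : EuclideanSpace ℝ (Fin 3)) 2 := hy
    have h0 := congrFun h 0
    have h2 := congrFun h 2
    -- Here `d ≥ 1`. So a vanishing third coefficient forces `z = 0`, and then the first one is `d ^
    -- 2`.
    have hd : (1 + ((y : EuclideanSpace ℝ (Fin 3)) 2 : ℂ)) ≠ 0 := by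
      intro h
      have h' := congrArg Complex.re h
      simp at h'
      linarith
    simp [northCoeff, hd] at h0 h2
    rw [h2] at h0
    simp [hd] at h0
  · refine continuous_pi fun i => ?_
    fin_cases i <;> simp [southCoeff] <;> fun_prop
  · intro y hy h
    have hy' : (y : EuclideanSpace ℝ (Fin 3)) 2 ≤ 0 := hy
    have h0 := congrFun h 0
    have h2 := congrFun h 2
    have hd : (1 - ((y : EuclideanSpace ℝ (Fin 3)) 2 : ℂ)) ≠ 0 := by
      intro h
      have h' := congrArg Complex.re h
      simp at h'
      linarith
    simp [southCoeff, hd] at h0 h2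
    rw [h2] at h0
    simp [hd] at h0
  · refine ⟨fun t => 2 * (t * Complex.I), by fun_prop, fun t _ => ?_, ?_⟩
    · rw [← sdForm_smul, ← southCoeff_equator]
    · push_cast
      ring

/-- A real invertible 3 × 3 matrix can be joined to `1` or to `-1` by invertible matrices. -/
theorem exists_path_to_one_or_neg_one (M : Matrix (Fin 3) (Fin 3) ℝ) (hM : M.det ≠ 0) :
    ∃ f : ℝ → Matrix (Fin 3) (Fin 3) ℝ, Continuous f ∧ f 0 = M ∧ (f 1 = 1 ∨ f 1 = -1) ∧
      ∀ t ∈ Icc (0 : ℝ) 1, (f t).det ≠ 0 := by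
  let P : Matrix (Fin 3) (Fin 3) ℝ → Prop := fun M =>
    ∃ f : ℝ → Matrix (Fin 3) (Fin 3) ℝ, Continuous f ∧ f 0 = M ∧ (f 1 = 1 ∨ f 1 = -1) ∧
      ∀ t ∈ Icc (0 : ℝ) 1, (f t).det ≠ 0
  have hmul : ∀ A B, P A → P B → P (A * B) := by
    rintro A B ⟨f, hf, hf0, hf1, hfd⟩ ⟨g, hg, hg0, hg1, hgd⟩
    refine ⟨fun t => f t * g t, hf.mul hg, by simp only [hf0, hg0], ?_, fun t ht => ?_⟩
    · rcases hf1 with h | h <;> rcases hg1 with h' | h' <;> simp [h, h']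
    · rw [Matrix.det_mul]
      exact mul_ne_zero (hfd t ht) (hgd t ht)
  have hpos : ∀ a : ℝ, 0 < a → ∀ t ∈ Icc (0 : ℝ) 1, (1 - t) * a + t ≠ 0 := by
    rintro a ha t ⟨h0, h1⟩
    rcases eq_or_lt_of_le h0 with h | h
    · rw [← h]; simpa using ha.ne'
    · have := mul_nonneg (sub_nonneg.2 h1) ha.le
      linarith
  have hneg : ∀ a : ℝ, a < 0 → ∀ t ∈ Icc (0 : ℝ) 1, (1 - t) * a - t ≠ 0 := by
    intro a ha t ht h
    apply hpos (-a) (neg_pos.2 ha) t ht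
    linarith
  have hcs : ∀ t : ℝ, Real.cos (Real.pi * t) * Real.cos (Real.pi * t) +
      Real.sin (Real.pi * t) * Real.sin (Real.pi * t) = 1 := fun t => by
    have := Real.sin_sq_add_cos_sq (Real.pi * t)
    linarith
  have hd0 : ∀ a : ℝ, a ≠ 0 → P !![a, 0, 0; 0, 1, 0; 0, 0, 1] := by
    intro a ha
    rcases lt_or_gt_of_ne ha with h | h
    -- While the negative entry moves to `-1`, a half turn of the two other coordinates makes the
    -- path end at the scalar matrix `-1`.
    · refine ⟨fun t => !![(1 - t) * a - t, 0, 0; 0, Real.cos (Real.pi * t), -Real.sin (Real.pi * t);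
        0, Real.sin (Real.pi * t), Real.cos (Real.pi * t)], ?_, ?_, Or.inr ?_, fun t ht => ?_⟩
      · refine continuous_matrix fun i j => ?_
        fin_cases i <;> fin_cases j <;> simp <;> fun_prop
      · simp
      · ext i j; fin_cases i <;> fin_cases j <;> simp
      · rw [Matrix.det_fin_three]
        simpa [mul_assoc, ← mul_add, hcs] using hneg a h t ht
    · refine ⟨fun t => !![(1 - t) * a + t, 0, 0; 0, 1, 0; 0, 0, 1], ?_, ?_, Or.inl ?_,
        fun t ht => ?_⟩
      · refine continuous_matrix fun i j => ?_
        fin_cases i <;> fin_cases j <;> simp <;> fun_prop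
      · simp
      · ext i j; fin_cases i <;> fin_cases j <;> simp
      · rw [Matrix.det_fin_three]
        simpa using hpos a h t ht
  have hd1 : ∀ a : ℝ, a ≠ 0 → P !![1, 0, 0; 0, a, 0; 0, 0, 1] := by
    intro a ha
    rcases lt_or_gt_of_ne ha with h | h
    · refine ⟨fun t => !![Real.cos (Real.pi * t), 0, -Real.sin (Real.pi * t);
        0, (1 - t) * a - t, 0; Real.sin (Real.pi * t), 0, Real.cos (Real.pi * t)], ?_, ?_,
        Or.inr ?_, fun t ht => ?_⟩
      · refine continuous_matrix fun i j => ?_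
        fin_cases i <;> fin_cases j <;> simp <;> fun_prop
      · simp
      · ext i j; fin_cases i <;> fin_cases j <;> simp
      · have h1 := hneg a h t ht
        rw [Matrix.det_fin_three]
        simp
        intro h2
        apply h1
        linear_combination h2 - ((1 - t) * a - t) * hcs t
    · refine ⟨fun t => !![1, 0, 0; 0, (1 - t) * a + t, 0; 0, 0, 1], ?_, ?_, Or.inl ?_,
        fun t ht => ?_⟩
      · refine continuous_matrix fun i j => ?_
        fin_cases i <;> fin_cases j <;> simp <;> fun_prop
      · simp
      · ext i j; fin_cases i <;> fin_cases j <;> simp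
      · rw [Matrix.det_fin_three]
        simpa using hpos a h t ht
  have hd2 : ∀ a : ℝ, a ≠ 0 → P !![1, 0, 0; 0, 1, 0; 0, 0, a] := by
    intro a ha
    rcases lt_or_gt_of_ne ha with h | h
    · refine ⟨fun t => !![Real.cos (Real.pi * t), -Real.sin (Real.pi * t), 0;
        Real.sin (Real.pi * t), Real.cos (Real.pi * t), 0; 0, 0, (1 - t) * a - t], ?_, ?_,
        Or.inr ?_, fun t ht => ?_⟩
      · refine continuous_matrix fun i j => ?_
        fin_cases i <;> fin_cases j <;> simp <;> fun_prop
      · simp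
      · ext i j; fin_cases i <;> fin_cases j <;> simp
      · have h1 := hneg a h t ht
        rw [Matrix.det_fin_three]
        simp
        intro h2
        apply h1
        linear_combination h2 - ((1 - t) * a - t) * hcs t
    · refine ⟨fun t => !![1, 0, 0; 0, 1, 0; 0, 0, (1 - t) * a + t], ?_, ?_, Or.inl ?_,
        fun t ht => ?_⟩
      · refine continuous_matrix fun i j => ?_
        fin_cases i <;> fin_cases j <;> simp <;> fun_prop
      · simp
      · ext i j; fin_cases i <;> fin_cases j <;> simp
      · rw [Matrix.det_fin_three]
        simpa using hpos a h t ht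
  refine Matrix.diagonal_transvection_induction_of_det_ne_zero P M hM ?_ ?_
    fun A B _ _ hA hB => hmul A B hA hB
  · intro D hD
    rw [Matrix.det_diagonal, Fin.prod_univ_three] at hD
    have h : Matrix.diagonal D = !![D 0, 0, 0; 0, 1, 0; 0, 0, 1] *
        (!![1, 0, 0; 0, D 1, 0; 0, 0, 1] * !![1, 0, 0; 0, 1, 0; 0, 0, D 2]) := by
      ext i j; fin_cases i <;> fin_cases j <;> simp [Matrix.mul_apply, Fin.sum_univ_three]
    rw [h]
    have h01 := left_ne_zero_of_mul hD
    exact hmul _ _ (hd0 _ (left_ne_zero_of_mul h01))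
      (hmul _ _ (hd1 _ (right_ne_zero_of_mul h01)) (hd2 _ (right_ne_zero_of_mul hD)))
  · intro t
    refine ⟨fun s => Matrix.transvection t.i t.j ((1 - s) * t.c), ?_, ?_, Or.inl ?_, fun s _ => ?_⟩
    · refine continuous_matrix fun i j => ?_
      simp only [Matrix.transvection, Matrix.add_apply, Matrix.single_apply]
      split_ifs <;> fun_prop
    · simp [Matrix.TransvectionStruct.toMatrix]
    · simp
    · rw [Matrix.det_transvection_of_ne _ _ t.hij]
      exact one_ne_zero

/-- The canonical bundle of the linear model has first Chern number `2`. -/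
theorem hasClutching_unitQuat (M : Matrix (Fin 3) (Fin 3) ℝ) (hM : M.det < 0) :
    HasClutching (fun y =>
      typeTwoZero (unitQuat (M.mulVec (y : EuclideanSpace ℝ (Fin 3)).ofLp))) 2 := by
  obtain ⟨f, hf, h0, h1, hd⟩ := exists_path_to_one_or_neg_one M hM.ne
  -- The determinant keeps its negative sign along the path, which excludes the end point `1`.
  have h1' : f 1 = -1 := by
    refine h1.resolve_left fun h => ?_
    have hc : ContinuousOn (fun t => (f t).det) (Icc 0 1) := (hf.matrix_det).continuousOn
    have hsub := intermediate_value_Icc (zero_le_one (α := ℝ)) hc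
    obtain ⟨t, ht, ht0⟩ := hsub (show (0 : ℝ) ∈ _ from ⟨by rw [h0]; exact hM.le, by rw [h]; simp⟩)
    exact hd t ht ht0
  have hne : ∀ (t : unitInterval) (y : S2),
      (f (1 - t)).mulVec (y : EuclideanSpace ℝ (Fin 3)).ofLp ≠ 0 := by
    intro t y h
    refine hd (1 - t) ⟨by linarith [t.2.2], by linarith [t.2.1]⟩ ?_
    exact Matrix.exists_mulVec_eq_zero_iff.1 ⟨_, coe_ne_zero y, h⟩
  -- The path is run backwards, from the computed case `-1` to `M`.
  have key := HasClutching.homotopy (c := 2)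
    (J := fun q => unitQuat ((f (1 - q.2)).mulVec (q.1 : EuclideanSpace ℝ (Fin 3)).ofLp))
    (continuousOn_unitQuat.comp_continuous (by
      refine Continuous.matrix_mulVec (hf.comp (by fun_prop)) ?_
      fun_prop) fun q => hne q.2 q.1)
    (fun q => unitQuat_unitQuat (hne q.2 q.1))
    (by simpa [h1', Matrix.neg_mulVec] using hasClutching_neg_sphere)
  simpa [h0] using key

end LinearModel

/-! ### The almost complex structure of a 2-form, read in a frame -/

section Frames

/-- A 2-form on `ℝ⁴` as a map to the dual space. -/
noncomputable def curryForm (a : E4 [⋀^Fin 2]→L[ℝ] ℝ) : E4 →L[ℝ] E4 →L[ℝ] ℝ :=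
  LinearMap.toContinuousLinearMap
    { toFun := fun u => LinearMap.toContinuousLinearMap
        { toFun := fun v => a ![u, v]
          map_add' := fun v w => twoForm_add_right a v w u
          map_smul' := fun c v => twoForm_smul_right a c v u }
      map_add' := fun u v => by
        ext w; exact twoForm_add_left a u v w
      map_smul' := fun c u => by
        ext w; exact twoForm_smul_left a c u w }

theorem curryForm_apply (a : E4 [⋀^Fin 2]→L[ℝ] ℝ) (u v : E4) : curryForm a u v = a ![u, v] := rfl

theorem continuous_curryForm : Continuous curryForm := by
  refine continuous_clm_apply.2 fun u => continuous_clm_apply.2 fun v => ?_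
  simp only [curryForm_apply]
  fun_prop

/-- The endomorphism `G⁻¹ a` for a metric `G` and a 2-form `a` on `ℝ⁴`. -/
noncomputable def raise (G : E4 →L[ℝ] E4 →L[ℝ] ℝ) (a : E4 [⋀^Fin 2]→L[ℝ] ℝ) : E4 →L[ℝ] E4 :=
  (ContinuousLinearMap.inverse G).comp (curryForm a)

/-- Trace of the square of an endomorphism. -/
noncomputable def trSq (A : E4 →L[ℝ] E4) : ℝ := LinearMap.trace ℝ E4 (A.toLinearMap ∘ₗ A.toLinearMap)

/-- The almost complex structure of the metric `G` and the 2-form `a` on `ℝ⁴`. -/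
noncomputable def frameAcs (G : E4 →L[ℝ] E4 →L[ℝ] ℝ) (a : E4 [⋀^Fin 2]→L[ℝ] ℝ) : E4 →L[ℝ] E4 :=
  (Real.sqrt 2 / Real.sqrt (-(1 / 2) * trSq (raise G a))) • raise G a

/-- `ContinuousLinearMap.inverse` takes the value zero off the isomorphisms; definiteness places `G`
among them, where inversion is continuous. -/
theorem exists_equiv_of_pos {G : E4 →L[ℝ] E4 →L[ℝ] ℝ} (hG : ∀ u, u ≠ 0 → 0 < G u u) :
    ∃ e : E4 ≃L[ℝ] E4 →L[ℝ] ℝ, (e : E4 →L[ℝ] E4 →L[ℝ] ℝ) = G := by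
  have hinj : Function.Injective G.toLinearMap := by
    rw [← LinearMap.ker_eq_bot, LinearMap.ker_eq_bot']
    intro u hu
    by_contra h
    have h1 := hG u h
    have h2 : G u = 0 := hu
    rw [h2] at h1
    exact lt_irrefl _ h1
  have hd : Module.finrank ℝ E4 = Module.finrank ℝ (E4 →L[ℝ] ℝ) := by
    rw [← (LinearMap.toContinuousLinearMap (𝕜 := ℝ) (E := E4) (F' := ℝ)).finrank_eq]
    simp
  refine ⟨(LinearEquiv.ofInjectiveOfFinrankEq _ hinj hd).toContinuousLinearEquiv, ?_⟩
  ext u v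
  rfl

theorem apply_raise {G : E4 →L[ℝ] E4 →L[ℝ] ℝ} (hG : ∀ u, u ≠ 0 → 0 < G u u)
    (a : E4 [⋀^Fin 2]→L[ℝ] ℝ) (u v : E4) : G (raise G a u) v = a ![u, v] := by
  obtain ⟨e, rfl⟩ := exists_equiv_of_pos hG
  simp [raise, curryForm_apply]

theorem continuousAt_raise {G : E4 →L[ℝ] E4 →L[ℝ] ℝ} (hG : ∀ u, u ≠ 0 → 0 < G u u)
    (a : E4 [⋀^Fin 2]→L[ℝ] ℝ) :
    ContinuousAt (fun p : (E4 →L[ℝ] E4 →L[ℝ] ℝ) × (E4 [⋀^Fin 2]→L[ℝ] ℝ) => raise p.1 p.2)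
      (G, a) := by
  obtain ⟨e, rfl⟩ := exists_equiv_of_pos hG
  have h1 : ContinuousAt (fun p : (E4 →L[ℝ] E4 →L[ℝ] ℝ) × (E4 [⋀^Fin 2]→L[ℝ] ℝ) =>
      ContinuousLinearMap.inverse p.1) ((e : E4 →L[ℝ] E4 →L[ℝ] ℝ), a) :=
    ContinuousAt.comp (f := Prod.fst) (g := ContinuousLinearMap.inverse)
      (contDiffAt_map_inverse (n := 0) e).continuousAt continuousAt_fst
  have h2 : ContinuousAt (fun p : (E4 →L[ℝ] E4 →L[ℝ] ℝ) × (E4 [⋀^Fin 2]→L[ℝ] ℝ) =>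
      curryForm p.2) ((e : E4 →L[ℝ] E4 →L[ℝ] ℝ), a) :=
    (continuous_curryForm.comp continuous_snd).continuousAt
  exact h1.clm_comp h2

theorem continuous_trSq : Continuous trSq := by
  let τ : (E4 →L[ℝ] E4) →ₗ[ℝ] ℝ :=
    { toFun := fun A => LinearMap.trace ℝ E4 A.toLinearMap
      map_add' := fun A B => by simp
      map_smul' := fun c A => by simp }
  have hτ : Continuous τ := τ.continuous_of_finiteDimensional
  have h : Continuous fun A : E4 →L[ℝ] E4 => A.comp A := by fun_prop
  exact hτ.comp h

theorem continuousAt_frameAcs {G : E4 →L[ℝ] E4 →L[ℝ] ℝ} (hG : ∀ u, u ≠ 0 → 0 < G u u)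
    {a : E4 [⋀^Fin 2]→L[ℝ] ℝ} (ha : trSq (raise G a) < 0) :
    ContinuousAt (fun p : (E4 →L[ℝ] E4 →L[ℝ] ℝ) × (E4 [⋀^Fin 2]→L[ℝ] ℝ) => frameAcs p.1 p.2)
      (G, a) := by
  have h := continuousAt_raise hG a
  have h2 : ContinuousAt (fun p : (E4 →L[ℝ] E4 →L[ℝ] ℝ) × (E4 [⋀^Fin 2]→L[ℝ] ℝ) =>
      -(1 / 2) * trSq (raise p.1 p.2)) (G, a) :=
    (ContinuousAt.comp (g := trSq) continuous_trSq.continuousAt h).const_mul _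
  unfold frameAcs
  refine ContinuousAt.smul (ContinuousAt.div₀ (continuousAt_const (y := Real.sqrt 2)) h2.sqrt ?_) h
  · exact (Real.sqrt_pos.2 (by linarith)).ne'

theorem raise_smul (G : E4 →L[ℝ] E4 →L[ℝ] ℝ) (c : ℝ) (a : E4 [⋀^Fin 2]→L[ℝ] ℝ) :
    raise G (c • a) = c • raise G a := by
  ext u : 1
  have : curryForm (c • a) u = c • curryForm a u := by
    ext v; rfl
  simp [raise, this]

theorem trSq_smul (c : ℝ) (A : E4 →L[ℝ] E4) : trSq (c • A) = c ^ 2 * trSq A := by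
  simp [trSq, LinearMap.smul_comp, LinearMap.comp_smul]
  ring

/-- This homogeneity of degree zero is what makes the blow-up work: `Ω` can be replaced by `t⁻¹ Ω`,
which has a nonzero limit at a zero of `Ω`. -/
theorem frameAcs_smul (G : E4 →L[ℝ] E4 →L[ℝ] ℝ) {c : ℝ} (hc : 0 < c)
    (a : E4 [⋀^Fin 2]→L[ℝ] ℝ) : frameAcs G (c • a) = frameAcs G a := by
  have h : -(1 / 2) * (c ^ 2 * trSq (raise G a)) = c ^ 2 * (-(1 / 2) * trSq (raise G a)) := by ring
  rw [frameAcs, frameAcs, raise_smul, trSq_smul, h, Real.sqrt_mul (sq_nonneg c),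
    Real.sqrt_sq hc.le, smul_smul]
  congr 1
  generalize Real.sqrt (-(1 / 2) * trSq (raise G a)) = r
  by_cases h0 : r = 0
  · simp [h0]
  · field_simp

/-- The reason why the limits of `J` along opposite directions at a zero disagree. -/
theorem frameAcs_neg (G : E4 →L[ℝ] E4 →L[ℝ] ℝ) (a : E4 [⋀^Fin 2]→L[ℝ] ℝ) :
    frameAcs G (-a) = -frameAcs G a := by
  have h : raise G (-a) = -raise G a := by
    rw [← neg_one_smul ℝ a, raise_smul]
    ext u : 1
    simp
  have h2 : trSq (-raise G a) = trSq (raise G a) := by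
    rw [← neg_one_smul ℝ (raise G a), trSq_smul]
    ring
  rw [frameAcs, frameAcs, h, h2, smul_neg]

/-- The square of the endomorphism `G⁻¹ a` is a multiple of the identity. -/
def HasScalarSquare (G : E4 →L[ℝ] E4 →L[ℝ] ℝ) (a : E4 [⋀^Fin 2]→L[ℝ] ℝ) : Prop :=
  ∀ u, raise G a (raise G a u) = (1 / 4 * trSq (raise G a)) • u

theorem HasScalarSquare.smul {G : E4 →L[ℝ] E4 →L[ℝ] ℝ} {a : E4 [⋀^Fin 2]→L[ℝ] ℝ}
    (h : HasScalarSquare G a) (c : ℝ) : HasScalarSquare G (c • a) := by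
  intro u
  simp only [raise_smul, trSq_smul, smul_apply, map_smul, h u, smul_smul]
  congr 1
  ring

/-- Self-duality is tested on oriented orthonormal bases, which vary with the point. A scalar square
involves no basis, and since its factor is a quarter of the trace, which is continuous, it passes to
limits. -/
theorem HasScalarSquare.of_tendsto {ι : Type*} {l : Filter ι} [l.NeBot]
    {G : ι → E4 →L[ℝ] E4 →L[ℝ] ℝ} {a : ι → E4 [⋀^Fin 2]→L[ℝ] ℝ} {G₀ : E4 →L[ℝ] E4 →L[ℝ] ℝ}
    {a₀ : E4 [⋀^Fin 2]→L[ℝ] ℝ} (hG : Filter.Tendsto G l (𝓝 G₀)) (ha : Filter.Tendsto a l (𝓝 a₀))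
    (hpos : ∀ u, u ≠ 0 → 0 < G₀ u u) (h : ∀ᶠ i in l, HasScalarSquare (G i) (a i)) :
    HasScalarSquare G₀ a₀ := by
  have h1 : Filter.Tendsto (fun i => raise (G i) (a i)) l (𝓝 (raise G₀ a₀)) :=
    (continuousAt_raise hpos a₀).tendsto.comp (hG.prodMk_nhds ha)
  intro u
  have h2 : Filter.Tendsto (fun i => raise (G i) (a i) (raise (G i) (a i) u)) l
      (𝓝 (raise G₀ a₀ (raise G₀ a₀ u))) := by
    have hc : Continuous fun A : E4 →L[ℝ] E4 => A (A u) := by fun_prop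
    exact (hc.tendsto _).comp h1
  have h3 : Filter.Tendsto (fun i => (1 / 4 * trSq (raise (G i) (a i))) • u) l
      (𝓝 ((1 / 4 * trSq (raise G₀ a₀)) • u)) :=
    ((continuous_trSq.tendsto _).comp h1 |>.const_mul (1 / 4)).smul_const u
  refine tendsto_nhds_unique h2 (h3.congr' ?_)
  filter_upwards [h] with i hi
  exact (hi u).symm

theorem frameAcs_frameAcs {G : E4 →L[ℝ] E4 →L[ℝ] ℝ} {a : E4 [⋀^Fin 2]→L[ℝ] ℝ}
    (h : HasScalarSquare G a) (ha : trSq (raise G a) < 0) (u : E4) :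
    frameAcs G a (frameAcs G a u) = -u := by
  have h1 : 0 < -(1 / 2) * trSq (raise G a) := by linarith
  have h2 := Real.mul_self_sqrt h1.le
  have h3 := (Real.sqrt_pos.2 h1).ne'
  have h4 := Real.mul_self_sqrt (zero_le_two (α := ℝ))
  simp only [frameAcs, smul_apply, map_smul, h u, smul_smul]
  rw [← neg_one_smul ℝ u]
  congr 1
  -- `raise G a` squares to `trSq / 4`, and the square of the normalizing factor is `-4 / trSq`.
  have h5 : trSq (raise G a) = -2 * (Real.sqrt (-(1 / 2) * trSq (raise G a)) *
      Real.sqrt (-(1 / 2) * trSq (raise G a))) := by rw [h2]; ring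
  generalize Real.sqrt (-(1 / 2) * trSq (raise G a)) = r at h3 h5 ⊢
  rw [h5]
  field_simp
  rw [sq, h4]
  ring

end Frames

/-! ### Tangent spaces of `X` read in a frame; oriented orthonormal bases. -/

section Pointwise

variable {X : Type*} [TopologicalSpace X] [ChartedSpace E4 X] [IsManifold (𝓡 4) ∞ X]

/-- The endomorphism `√2 g⁻¹α / |α|` of `T_x X`. -/
noncomputable def acsAt (g : Metric4 X) (x : X) (α : TangentSpace (𝓡 4) x [⋀^Fin 2]→L[ℝ] ℝ) :
    TangentSpace (𝓡 4) x →L[ℝ] TangentSpace (𝓡 4) x :=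
  (Real.sqrt 2 / formNorm g x α) • LinearMap.toContinuousLinearMap (gInv g x α)

/-- The metric at `x`, read in a frame. -/
noncomputable def pullMetric (g : Metric4 X) (x : X) (A : E4 →L[ℝ] TangentSpace (𝓡 4) x) :
    E4 →L[ℝ] E4 →L[ℝ] ℝ :=
  (ContinuousLinearMap.precomp ℝ A).comp ((g.inner x).comp A)

theorem pullMetric_pos (g : Metric4 X) (x : X) {A : E4 →L[ℝ] TangentSpace (𝓡 4) x}
    (hA : Function.Injective A) (u : E4) (hu : u ≠ 0) : 0 < pullMetric g x A u u :=
  g.pos x (A u) fun h => hu (hA (h.trans (map_zero A).symm))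

theorem ext_inner (g : Metric4 X) (x : X) {u v : TangentSpace (𝓡 4) x}
    (h : ∀ w, g.inner x u w = g.inner x v w) : u = v := by
  by_contra hne
  have h1 := g.pos x (u - v) (sub_ne_zero.2 hne)
  have h2 : g.inner x (u - v) (u - v) = 0 := by
    rw [g.inner x |>.map_sub]
    exact sub_eq_zero.2 (h _)
  rw [h2] at h1
  exact lt_irrefl _ h1

theorem compContinuousLinearMap_pair {T : Type*} [AddCommGroup T] [Module ℝ T]
    [TopologicalSpace T] {M : Type*} [AddCommGroup M] [Module ℝ M] [TopologicalSpace M]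
    {T' : Type*} [AddCommGroup T'] [Module ℝ T'] [TopologicalSpace T']
    (α : T [⋀^Fin 2]→L[ℝ] M) (A : T' →L[ℝ] T) (u v : T') :
    α.compContinuousLinearMap A ![u, v] = α ![A u, A v] := by
  have : A ∘ ![u, v] = ![A u, A v] := by
    ext i : 1; fin_cases i <;> rfl
  rw [ContinuousAlternatingMap.compContinuousLinearMap_apply, this]

/-- `g⁻¹α` is characterized by its inner products with all vectors, and these are preserved when
metric and form are pulled back together. -/
theorem gInv_frame (g : Metric4 X) (x : X) (α : TangentSpace (𝓡 4) x [⋀^Fin 2]→L[ℝ] ℝ)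
    (A : E4 ≃L[ℝ] TangentSpace (𝓡 4) x) (u : E4) :
    gInv g x α (A u) = A (raise (pullMetric g x A) (α.compContinuousLinearMap A) u) := by
  refine ext_inner g x fun w => ?_
  obtain ⟨v, rfl⟩ := A.surjective w
  rw [inner_gInv]
  have h := apply_raise (G := pullMetric g x A) (pullMetric_pos g x A.injective)
    (α.compContinuousLinearMap (A : E4 →L[ℝ] TangentSpace (𝓡 4) x)) u v
  rw [compContinuousLinearMap_pair] at h
  exact h.symm

theorem trace_frame (g : Metric4 X) (x : X) (α : TangentSpace (𝓡 4) x [⋀^Fin 2]→L[ℝ] ℝ)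
    (A : E4 ≃L[ℝ] TangentSpace (𝓡 4) x) :
    LinearMap.trace ℝ (TangentSpace (𝓡 4) x) (gInv g x α ∘ₗ gInv g x α) =
      trSq (raise (pullMetric g x A) (α.compContinuousLinearMap A)) := by
  rw [trSq, ← LinearMap.trace_conj' _ A.toLinearEquiv]
  congr 1
  ext w
  obtain ⟨u, rfl⟩ := A.surjective w
  have h : A.toLinearEquiv.symm (A u) = u := A.symm_apply_apply u
  rw [LinearEquiv.conj_apply_apply, h, LinearMap.comp_apply, gInv_frame, gInv_frame]
  rfl

theorem formNorm_frame (g : Metric4 X) (x : X) (α : TangentSpace (𝓡 4) x [⋀^Fin 2]→L[ℝ] ℝ)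
    (A : E4 ≃L[ℝ] TangentSpace (𝓡 4) x) :
    formNorm g x α =
      Real.sqrt (-(1 / 2) * trSq (raise (pullMetric g x A) (α.compContinuousLinearMap A))) := by
  rw [formNorm, trace_frame g x α A]

theorem acsAt_frame (g : Metric4 X) (x : X) (α : TangentSpace (𝓡 4) x [⋀^Fin 2]→L[ℝ] ℝ)
    (A : E4 ≃L[ℝ] TangentSpace (𝓡 4) x) (u : E4) :
    acsAt g x α (A u) = A (frameAcs (pullMetric g x A) (α.compContinuousLinearMap A) u) := by
  rw [acsAt, frameAcs, formNorm_frame g x α A]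
  simp [gInv_frame g x α A]

/-- The frame of a basis. -/
noncomputable def basisFrame {x : X} (e : Module.Basis (Fin 4) ℝ (TangentSpace (𝓡 4) x)) :
    E4 ≃L[ℝ] TangentSpace (𝓡 4) x :=
  ((WithLp.linearEquiv 2 ℝ (Fin 4 → ℝ)).trans e.equivFun.symm).toContinuousLinearEquiv

theorem basisFrame_apply {x : X} (e : Module.Basis (Fin 4) ℝ (TangentSpace (𝓡 4) x)) (u : E4) :
    basisFrame e u = ∑ i, u i • e i := by
  change e.equivFun.symm u.ofLp = _
  rw [Module.Basis.equivFun_symm_apply]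

theorem basisFrame_single {x : X} (e : Module.Basis (Fin 4) ℝ (TangentSpace (𝓡 4) x)) (i : Fin 4) :
    basisFrame e (EuclideanSpace.single i 1) = e i := by
  rw [basisFrame_apply, Finset.sum_eq_single i]
  · simp
  · intro j _ hj
    simp [hj]
  · simp

/-- An orthogonal basis of the symmetric form is normalized; adapting it to the orientation changes
vectors only by signs, which keeps it orthonormal. -/
theorem exists_isOrientedONB (g : Metric4 X) (o : Orientation4 X) (x : X) :
    ∃ e, IsOrientedONB g o x e := by
  have hsymm : LinearMap.IsSymm (metricForm g x) := ⟨fun u v => g.symm x u v⟩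
  have : Invertible (2 : ℝ) := invertibleOfNonzero two_ne_zero
  obtain ⟨b, hb⟩ := LinearMap.BilinForm.exists_orthogonal_basis hsymm
  have hd : Module.finrank ℝ (TangentSpace (𝓡 4) x) = 4 :=
    (finrank_euclideanSpace_fin : Module.finrank ℝ E4 = 4)
  let b' : Module.Basis (Fin 4) ℝ (TangentSpace (𝓡 4) x) := b.reindex (finCongr hd)
  have hb' : ∀ i j, i ≠ j → g.inner x (b' i) (b' j) = 0 := by
    intro i j hij
    simp only [b', Module.Basis.reindex_apply]
    exact hb fun h => hij ((finCongr hd).symm.injective h)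
  have hpos : ∀ i, 0 < g.inner x (b' i) (b' i) := fun i => g.pos x _ (b'.ne_zero i)
  let e : Module.Basis (Fin 4) ℝ (TangentSpace (𝓡 4) x) :=
    b'.isUnitSMul (w := fun i => (Real.sqrt (g.inner x (b' i) (b' i)))⁻¹)
      fun i => (inv_ne_zero (Real.sqrt_pos.2 (hpos i)).ne').isUnit
  have he : ∀ i j, g.inner x (e i) (e j) = if i = j then 1 else 0 := by
    intro i j
    simp only [e, Module.Basis.isUnitSMul_apply, map_smul, smul_apply, smul_eq_mul]
    split_ifs with h
    · subst h
      have h1 := Real.mul_self_sqrt (hpos i).le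
      have h2 := (Real.sqrt_pos.2 (hpos i)).ne'
      generalize Real.sqrt (g.inner x (b' i) (b' i)) = r at h1 h2 ⊢
      rw [← h1]
      field_simp
    · rw [hb' i j h, mul_zero, mul_zero]
  refine ⟨e.adjustToOrientation (o.at_ x), fun i j => ?_, e.orientation_adjustToOrientation _⟩
  by_cases h : i = j
  · subst h
    rw [if_pos rfl]
    rcases e.adjustToOrientation_apply_eq_or_eq_neg (o.at_ x) i with h | h <;>
      simp [h, he]
  · rw [if_neg h]
    rcases e.adjustToOrientation_apply_eq_or_eq_neg (o.at_ x) i with h1 | h1 <;>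
    rcases e.adjustToOrientation_apply_eq_or_eq_neg (o.at_ x) j with h2 | h2 <;>
      simp [h1, h2, he, h]

theorem IsOrientedONB.reindex {g : Metric4 X} {o : Orientation4 X} {x : X}
    {e : Module.Basis (Fin 4) ℝ (TangentSpace (𝓡 4) x)} (he : IsOrientedONB g o x e)
    (σ : Equiv.Perm (Fin 4)) (hσ : Equiv.Perm.sign σ = 1) :
    IsOrientedONB g o x (e.reindex σ.symm) := by
  refine ⟨fun i j => ?_, ?_⟩
  · simp [he.1]
  · rw [← he.2, eq_comm, Module.Basis.orientation_eq_iff_det_pos]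
    have h : ⇑(e.reindex σ.symm) = e ∘ σ := by
      ext i; simp
    rw [h, AlternatingMap.map_perm, hσ, Module.Basis.det_self]
    simp

/-- Cyclic permutations of `e 1, e 2, e 3` are even, so the one condition required of every oriented
orthonormal basis yields all three. -/
theorem IsSelfDualAt.apply_basis {g : Metric4 X} {o : Orientation4 X} {x : X}
    {α : TangentSpace (𝓡 4) x [⋀^Fin 2]→L[ℝ] ℝ} (hα : IsSelfDualAt g o x α)
    {e : Module.Basis (Fin 4) ℝ (TangentSpace (𝓡 4) x)} (he : IsOrientedONB g o x e) :
    α ![e 2, e 3] = α ![e 0, e 1] ∧ α ![e 3, e 1] = α ![e 0, e 2] ∧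
      α ![e 1, e 2] = α ![e 0, e 3] := by
  refine ⟨hα e he, ?_, ?_⟩
  · have h := hα _ (he.reindex (Equiv.swap 1 2 * Equiv.swap 2 3) (by decide))
    simpa [Equiv.swap_apply_def] using h
  · have h := hα _ (he.reindex (Equiv.swap 1 3 * Equiv.swap 3 2) (by decide))
    simpa [Equiv.swap_apply_def] using h

end Pointwise

/-! ### Self-dual forms at a point -/

section SelfDual

variable {X : Type*} [TopologicalSpace X] [ChartedSpace E4 X] [IsManifold (𝓡 4) ∞ X]
  {g : Metric4 X} {o : Orientation4 X} {x : X}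
  {e : Module.Basis (Fin 4) ℝ (TangentSpace (𝓡 4) x)}

theorem IsOrientedONB.inner_frame (he : IsOrientedONB g o x e) (u v : E4) :
    g.inner x (basisFrame e u) (basisFrame e v) =
      u 0 * v 0 + u 1 * v 1 + u 2 * v 2 + u 3 * v 3 := by
  simp only [basisFrame_apply, Fin.sum_univ_four, map_add, map_smul, add_apply, smul_apply, he.1,
    smul_eq_mul]
  simp
  ring

theorem form_frame (α : TangentSpace (𝓡 4) x [⋀^Fin 2]→L[ℝ] ℝ) (u v : E4) :
    α ![basisFrame e u, basisFrame e v] =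
      (u 0 * v 1 - u 1 * v 0) * α ![e 0, e 1] + (u 0 * v 2 - u 2 * v 0) * α ![e 0, e 2] +
      (u 0 * v 3 - u 3 * v 0) * α ![e 0, e 3] + (u 1 * v 2 - u 2 * v 1) * α ![e 1, e 2] +
      (u 3 * v 1 - u 1 * v 3) * α ![e 3, e 1] + (u 2 * v 3 - u 3 * v 2) * α ![e 2, e 3] := by
  have h10 := twoForm_swap α (e 1) (e 0)
  have h20 := twoForm_swap α (e 2) (e 0)
  have h30 := twoForm_swap α (e 3) (e 0)
  have h21 := twoForm_swap α (e 2) (e 1)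
  have h13 := twoForm_swap α (e 1) (e 3)
  have h32 := twoForm_swap α (e 3) (e 2)
  simp only [basisFrame_apply, Fin.sum_univ_four, twoForm_add_left, twoForm_add_right,
    twoForm_smul_left, twoForm_smul_right, twoForm_self, smul_eq_mul, h10, h20, h30, h21, h13, h32]
  ring

/-- The form `α` is self-dual with respect to the basis `e`. -/
def IsSelfDualFor (e : Module.Basis (Fin 4) ℝ (TangentSpace (𝓡 4) x))
    (α : TangentSpace (𝓡 4) x [⋀^Fin 2]→L[ℝ] ℝ) : Prop :=
  α ![e 2, e 3] = α ![e 0, e 1] ∧ α ![e 3, e 1] = α ![e 0, e 2] ∧ α ![e 1, e 2] = α ![e 0, e 3]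

/-- The coefficients of a self-dual form. -/
noncomputable def sdCoeff (e : Module.Basis (Fin 4) ℝ (TangentSpace (𝓡 4) x))
    (α : TangentSpace (𝓡 4) x [⋀^Fin 2]→L[ℝ] ℝ) (j : Fin 3) : ℝ := α ![e 0, e j.succ]

theorem IsOrientedONB.raise_eq_quat (he : IsOrientedONB g o x e)
    {α : TangentSpace (𝓡 4) x [⋀^Fin 2]→L[ℝ] ℝ} (hα : IsSelfDualFor e α) :
    raise (pullMetric g x (basisFrame e)) (α.compContinuousLinearMap (basisFrame e)) =
      quat (sdCoeff e α) := by
  ext u : 1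
  apply (basisFrame e).injective
  refine ext_inner g x fun w => ?_
  obtain ⟨v, rfl⟩ := (basisFrame e).surjective w
  rw [← gInv_frame, inner_gInv, he.inner_frame, form_frame, hα.1, hα.2.1, hα.2.2, quat_apply]
  simp [sdCoeff]
  ring

theorem trSq_quat (w : Fin 3 → ℝ) : trSq (quat w) = -4 * (w 0 ^ 2 + w 1 ^ 2 + w 2 ^ 2) := by
  have h : (quat w).toLinearMap ∘ₗ (quat w).toLinearMap =
      (-(w 0 ^ 2 + w 1 ^ 2 + w 2 ^ 2)) • LinearMap.id := by
    ext v : 1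
    exact quat_quat w v
  rw [trSq, h, map_smul, LinearMap.trace_id]
  simp
  ring

theorem IsOrientedONB.frameAcs_eq (he : IsOrientedONB g o x e)
    {α : TangentSpace (𝓡 4) x [⋀^Fin 2]→L[ℝ] ℝ} (hα : IsSelfDualFor e α) :
    frameAcs (pullMetric g x (basisFrame e)) (α.compContinuousLinearMap (basisFrame e)) =
      unitQuat (sdCoeff e α) := by
  rw [frameAcs, he.raise_eq_quat hα, trSq_quat, unitQuat]
  congr 1
  have h : -(1 / 2) * (-4 * (sdCoeff e α 0 ^ 2 + sdCoeff e α 1 ^ 2 + sdCoeff e α 2 ^ 2)) =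
    2 * (sdCoeff e α 0 ^ 2 + sdCoeff e α 1 ^ 2 + sdCoeff e α 2 ^ 2) := by ring
  have h2 : Real.sqrt 2 ≠ 0 := by simp
  rw [h, Real.sqrt_mul zero_le_two, div_mul_eq_div_div, div_self h2, one_div]

theorem IsSelfDualFor.sdCoeff_ne_zero {α : TangentSpace (𝓡 4) x [⋀^Fin 2]→L[ℝ] ℝ}
    (hα : IsSelfDualFor e α) (h0 : α ≠ 0) : sdCoeff e α ≠ 0 := by
  intro h
  apply h0
  have h1 : α ![e 0, e 1] = 0 := congrFun h 0
  have h2 : α ![e 0, e 2] = 0 := congrFun h 1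
  have h3 : α ![e 0, e 3] = 0 := congrFun h 2
  refine twoForm_ext fun u v => ?_
  obtain ⟨u, rfl⟩ := (basisFrame e).surjective u
  obtain ⟨v, rfl⟩ := (basisFrame e).surjective v
  rw [form_frame, hα.1, hα.2.1, hα.2.2, h1, h2, h3]
  simp

/-- The trace does not depend on the frame, and in the basis `e` it is `-4` times a sum of squares.
-/
theorem IsOrientedONB.trSq_neg (he : IsOrientedONB g o x e)
    {α : TangentSpace (𝓡 4) x [⋀^Fin 2]→L[ℝ] ℝ} (hα : IsSelfDualFor e α) (h0 : α ≠ 0)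
    (A : E4 ≃L[ℝ] TangentSpace (𝓡 4) x) :
    trSq (raise (pullMetric g x A) (α.compContinuousLinearMap A)) < 0 := by
  rw [← trace_frame, trace_frame g x α (basisFrame e), he.raise_eq_quat hα, trSq_quat]
  have := sum_sq_pos (hα.sdCoeff_ne_zero h0)
  linarith

/-- The right side does not mention `A`, so the property can be moved from one frame to another. -/
theorem hasScalarSquare_frame_iff (α : TangentSpace (𝓡 4) x [⋀^Fin 2]→L[ℝ] ℝ)
    (A : E4 ≃L[ℝ] TangentSpace (𝓡 4) x) :
    HasScalarSquare (pullMetric g x A) (α.compContinuousLinearMap A) ↔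
      ∀ v, gInv g x α (gInv g x α v) =
        (1 / 4 * LinearMap.trace ℝ _ (gInv g x α ∘ₗ gInv g x α)) • v := by
  constructor
  · intro h v
    obtain ⟨u, rfl⟩ := A.surjective v
    rw [gInv_frame, gInv_frame, h u, trace_frame g x α A, map_smul]
  · intro h u
    apply A.injective
    rw [← gInv_frame, ← gInv_frame, h, trace_frame g x α A, map_smul]

theorem IsOrientedONB.hasScalarSquare (he : IsOrientedONB g o x e)
    {α : TangentSpace (𝓡 4) x [⋀^Fin 2]→L[ℝ] ℝ} (hα : IsSelfDualFor e α)
    (A : E4 ≃L[ℝ] TangentSpace (𝓡 4) x) :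
    HasScalarSquare (pullMetric g x A) (α.compContinuousLinearMap A) := by
  rw [hasScalarSquare_frame_iff, ← hasScalarSquare_frame_iff α (basisFrame e)]
  intro u
  rw [he.raise_eq_quat hα, quat_quat, trSq_quat]
  congr 1
  ring

/-- Let `P` and `Q` be the endomorphisms of the self-dual and anti-self-dual parts. They commute and
have scalar squares, so `(P + Q)²` is scalar only if `PQ = 0`. The entries of `PQ` are combinations
of products of a coefficient of `P` and one of `Q`; here are the products with the first coefficient
of `P`. -/
theorem mul_eq_zero_of_scalar_square {a b d d' b' a' c : ℝ}
    (h00 : -(a * a) + -(b * b) + -(d * d) = c) (h11 : -(a * a) + -(d' * d') + -(b' * b') = c)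
    (h22 : -(b * b) + -(d' * d') + -(a' * a') = c) (h33 : -(d * d) + -(b' * b') + -(a' * a') = c)
    (h03 : -(a * b') + b * a' = 0) (h12 : -(a * b) + b' * a' = 0)
    (h02 : a * d' + -(d * a') = 0) (h13 : -(a * d) + d' * a' = 0) :
    (a + a') * (a - a') = 0 ∧ (a + a') * (b - b') = 0 ∧ (a + a') * (d - d') = 0 :=
  ⟨by linear_combination (-1 / 2) * h00 + (-1 / 2) * h11 + (1 / 2) * h22 + (1 / 2) * h33,
    by linear_combination h03 - h12, by linear_combination -h13 - h02⟩

/-- If the square of `g⁻¹α` is scalar, then `α` is self-dual or anti-self-dual. -/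
theorem IsOrientedONB.mul_eq_zero_of_hasScalarSquare (he : IsOrientedONB g o x e)
    {α : TangentSpace (𝓡 4) x [⋀^Fin 2]→L[ℝ] ℝ}
    (h : HasScalarSquare (pullMetric g x (basisFrame e))
      (α.compContinuousLinearMap (basisFrame e))) :
    (α ![e 0, e 1] + α ![e 2, e 3]) * (α ![e 0, e 1] - α ![e 2, e 3]) = 0 ∧
    (α ![e 0, e 1] + α ![e 2, e 3]) * (α ![e 0, e 2] - α ![e 3, e 1]) = 0 ∧
    (α ![e 0, e 1] + α ![e 2, e 3]) * (α ![e 0, e 3] - α ![e 1, e 2]) = 0 := by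
  set R := raise (pullMetric g x (basisFrame e)) (α.compContinuousLinearMap (basisFrame e)) with hR
  have hc : ∀ u v : E4, R u 0 * v 0 + R u 1 * v 1 + R u 2 * v 2 + R u 3 * v 3 =
      α ![basisFrame e u, basisFrame e v] := by
    intro u v
    rw [← he.inner_frame, hR, ← gInv_frame, inner_gInv]
  simp only [form_frame] at hc
  have hR0 : ∀ u, R u 0 = _ := fun u => by simpa using hc u (EuclideanSpace.single 0 1)
  have hR1 : ∀ u, R u 1 = _ := fun u => by simpa using hc u (EuclideanSpace.single 1 1)
  have hR2 : ∀ u, R u 2 = _ := fun u => by simpa using hc u (EuclideanSpace.single 2 1)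
  have hR3 : ∀ u, R u 3 = _ := fun u => by simpa using hc u (EuclideanSpace.single 3 1)
  have hs : ∀ i j : Fin 4, R (R (EuclideanSpace.single i 1)) j =
      (1 / 4 * trSq R) * (if j = i then 1 else 0) := by
    intro i j
    rw [hR, h, ← hR]
    simp
  generalize 1 / 4 * trSq R = c at hs
  have h00 := hs 0 0
  have h11 := hs 1 1
  have h22 := hs 2 2
  have h33 := hs 3 3
  have h03 := hs 0 3
  have h12 := hs 1 2
  have h02 := hs 0 2
  have h13 := hs 1 3
  simp [hR0, hR1, hR2, hR3] at h00 h11 h22 h33 h03 h12 h02 h13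
  exact mul_eq_zero_of_scalar_square h00 h11 h22 h33 h03 h12 h02 h13

/-- A linear space of forms with scalar square, which contains a nonzero self-dual form, consists
of self-dual forms. -/
theorem IsOrientedONB.isSelfDualFor_of_linear (he : IsOrientedONB g o x e)
    {E : Type*} [AddCommGroup E] {D : E → TangentSpace (𝓡 4) x [⋀^Fin 2]→L[ℝ] ℝ}
    (hadd : ∀ u v, D (u + v) = D u + D v)
    (hs : ∀ v, HasScalarSquare (pullMetric g x (basisFrame e))
      ((D v).compContinuousLinearMap (basisFrame e)))
    {u : E} (hu : IsSelfDualFor e (D u)) (hu1 : D u ![e 0, e 1] = 1) (v : E) :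
    IsSelfDualFor e (D v) := by
  obtain ⟨h1, h2, h3⟩ := he.mul_eq_zero_of_hasScalarSquare (hs v)
  -- Adding `u` shifts the self-dual factor by 2 and leaves the anti-self-dual coefficients alone.
  -- So both `s q = 0` and `(s + 2) q = 0`, whence `q = 0`.
  obtain ⟨k1, k2, k3⟩ := he.mul_eq_zero_of_hasScalarSquare (hs (v + u))
  obtain ⟨u1, u2, u3⟩ := hu
  simp only [hadd, ContinuousAlternatingMap.add_apply, u1, u2, u3, hu1] at k1 k2 k3
  exact ⟨by linear_combination (h1 - k1) / 2, by linear_combination (h2 - k2) / 2,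
    by linear_combination (h3 - k3) / 2⟩

/-- There is a self-dual form with coefficients `(1, 0, 0)`. -/
theorem IsOrientedONB.exists_isSelfDualAt (he : IsOrientedONB g o x e) :
    ∃ α, IsSelfDualAt g o x α ∧ α ![e 0, e 1] = 1 := by
  let η : E4 [⋀^Fin 2]→L[ℝ] ℝ := Complex.reCLM.compContinuousAlternatingMap
    (wedge (coordForm 0) (coordForm 1) + wedge (coordForm 2) (coordForm 3))
  have hη : ∀ u v : E4, η ![u, v] = u 0 * v 1 - v 0 * u 1 + (u 2 * v 3 - v 2 * u 3) := by
    intro u v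
    simp [η, wedge_apply, coordForm]
  let B := basisFrame e
  have hα : ∀ u v, η.compContinuousLinearMap
      (B.symm : TangentSpace (𝓡 4) x →L[ℝ] E4) ![u, v] = η ![B.symm u, B.symm v] := fun u v =>
    compContinuousLinearMap_pair η _ u v
  have hB : ∀ i, B.symm (e i) = EuclideanSpace.single i 1 := fun i => by
    rw [← basisFrame_single e i]
    exact B.symm_apply_apply _
  refine ⟨η.compContinuousLinearMap (B.symm : TangentSpace (𝓡 4) x →L[ℝ] E4), ?_, ?_⟩
  · intro f hf
    rw [hα, hα, hη, hη]
    -- Self-duality must be verified on every oriented orthonormal basis `f`; `M` is the rotation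
    -- from `e` to `f`.
    let M : Matrix (Fin 4) (Fin 4) ℝ := Matrix.of fun i k => B.symm (f i) k
    have hMM : M * M.transpose = 1 := by
      ext i j
      have h1 := hf.1 i j
      have h2 := he.inner_frame (B.symm (f i)) (B.symm (f j))
      have h3 : ∀ v, basisFrame e (B.symm v) = v := fun v => B.apply_symm_apply v
      rw [h3, h3, h1] at h2
      rw [Matrix.mul_apply, Fin.sum_univ_four, Matrix.one_apply, h2]
      rfl
    have hdet : M.det = 1 := by
      have h1 : M.det * M.det = 1 := by
        have h2 := congrArg Matrix.det hMM
        rwa [Matrix.det_mul, Matrix.det_transpose, Matrix.det_one] at h2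
      have h2 : 0 < M.det := by
        have h3 := (Module.Basis.orientation_eq_iff_det_pos e f).1 (he.2.trans hf.2.symm)
        rw [Module.Basis.det_apply, ← Matrix.det_transpose] at h3
        have h4 : (e.toMatrix f).transpose = M := by
          ext i k
          have : f i = ∑ j, B.symm (f i) j • e j := by
            rw [← basisFrame_apply]
            exact (B.apply_symm_apply _).symm
          rw [Matrix.transpose_apply, Module.Basis.toMatrix_apply, this,
            Module.Basis.repr_sum_self]
          rfl
        rwa [h4] at h3
      nlinarith
    -- For a rotation each entry is its own cofactor. When the entries of row 1 are replaced by
    -- minors of the rows 0, 2, 3, the claim reduces to the inner products of row 0 with these rows.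
    have hadj : M.adjugate = M.transpose := by
      have h1 := Matrix.mul_adjugate M
      rw [hdet, one_smul] at h1
      calc M.adjugate = (M.transpose * M) * M.adjugate := by
            rw [mul_eq_one_comm.1 hMM, one_mul]
        _ = M.transpose := by rw [mul_assoc, h1, mul_one]
    have hb : ∀ k, M 1 k = (-1) ^ (1 + (k : ℕ)) *
        (M.submatrix (Fin.succAbove 1) (Fin.succAbove k)).det := by
      intro k
      have h1 : M 1 k = M.adjugate k 1 := by rw [hadj]; rfl
      rw [h1, Matrix.adjugate_fin_succ_eq_det_submatrix]
      simp
    have e00 := congrFun (congrFun hMM 0) 0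
    have e02 := congrFun (congrFun hMM 0) 2
    have e03 := congrFun (congrFun hMM 0) 3
    simp only [Matrix.mul_apply, Fin.sum_univ_four, Matrix.one_apply, Matrix.transpose_apply]
      at e00 e02 e03
    have b0 := hb 0
    have b1 := hb 1
    have b2 := hb 2
    have b3 := hb 3
    simp [Matrix.det_fin_three, Fin.succAbove] at b0 b1 b2 b3 e00 e02 e03
    change M 2 0 * M 3 1 - M 3 0 * M 2 1 + (M 2 2 * M 3 3 - M 3 2 * M 2 3) =
      M 0 0 * M 1 1 - M 1 0 * M 0 1 + (M 0 2 * M 1 3 - M 1 2 * M 0 3)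
    linear_combination (-(M 2 0 * M 3 1 - M 3 0 * M 2 1 + (M 2 2 * M 3 3 - M 3 2 * M 2 3))) * e00 +
      (M 0 0 * M 3 1 - M 3 0 * M 0 1 + (M 0 2 * M 3 3 - M 3 2 * M 0 3)) * e02 -
      (M 0 0 * M 2 1 - M 2 0 * M 0 1 + (M 0 2 * M 2 3 - M 2 2 * M 0 3)) * e03 -
      M 0 0 * b1 + M 0 1 * b0 - M 0 2 * b3 + M 0 3 * b2
  · rw [hα, hB, hB, hη]
    simp

end SelfDual

/-! ### Coordinates in charts, and continuity of frames and forms along a map. -/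

section Charts

variable {X : Type*} [TopologicalSpace X] [ChartedSpace E4 X] [IsManifold (𝓡 4) ∞ X]

/-- The coordinates of a tangent vector in the chart around `x₀`. -/
noncomputable def coordMap (x₀ x : X) : TangentSpace (𝓡 4) x →L[ℝ] E4 :=
  (trivializationAt E4 (TangentSpace (𝓡 4) : X → Type _) x₀).continuousLinearMapAt ℝ x

theorem coordFrame_coordMap {x₀ x : X} (hx : x ∈ (chartAt E4 x₀).source)
    (v : TangentSpace (𝓡 4) x) : coordFrame x₀ x (coordMap x₀ x v) = v :=
  Bundle.Trivialization.symmL_continuousLinearMapAt _ (by simpa using hx) v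

theorem coordMap_coordFrame {x₀ x : X} (hx : x ∈ (chartAt E4 x₀).source)
    (v : E4) : coordMap x₀ x (coordFrame x₀ x v) = v :=
  Bundle.Trivialization.continuousLinearMapAt_symmL _ (by simpa using hx) v

theorem coordFrame_injective {x₀ x : X} (hx : x ∈ (chartAt E4 x₀).source) :
    Function.Injective (coordFrame x₀ x) :=
  Function.LeftInverse.injective (coordMap_coordFrame hx)

/-- The coordinate frame as an isomorphism. -/
noncomputable def coordEquiv {x₀ x : X} (hx : x ∈ (chartAt E4 x₀).source) :
    E4 ≃L[ℝ] TangentSpace (𝓡 4) x :=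
  ContinuousLinearEquiv.equivOfInverse (coordFrame x₀ x) (coordMap x₀ x)
    (coordMap_coordFrame hx) (coordFrame_coordMap hx)

/-- The tangent space at `p` is `ℝ⁴` by way of the chart around `p` itself. Hence the derivatives
taken in this chart, in `nablaAtZero` and `HasVelocityAt`, refer to the vectors of `T_p X` as they
are. -/
theorem coordFrame_self (p : X) (v : E4) : coordFrame p p v = v := by
  have h := TangentBundle.symmL_trivializationAt_eq_core (I := 𝓡 4) (b₀ := p) (b := p)
    (mem_chart_source E4 p)
  rw [tangentBundleCore_coordChange_achart] at h
  have h2 : tangentCoordChange (𝓡 4) p p p v = v :=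
    tangentCoordChange_self (mem_extChartAt_source p)
  exact (DFunLike.congr_fun h v).trans h2

theorem coordMap_self (p : X) (v : TangentSpace (𝓡 4) p) : coordMap p p v = v := by
  have h := coordFrame_coordMap (mem_chart_source E4 p) v
  rwa [coordFrame_self] at h

theorem metricInChart_extChartAt (g : Metric4 X) {x₀ x : X} (hx : x ∈ (chartAt E4 x₀).source) :
    metricInChart g x₀ (extChartAt (𝓡 4) x₀ x) = pullMetric g x (coordFrame x₀ x) := by
  have h : (extChartAt (𝓡 4) x₀).symm (extChartAt (𝓡 4) x₀ x) = x :=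
    (extChartAt (𝓡 4) x₀).left_inv (by simpa using hx)
  change pullMetric g ((extChartAt (𝓡 4) x₀).symm (extChartAt (𝓡 4) x₀ x))
    (coordFrame x₀ ((extChartAt (𝓡 4) x₀).symm (extChartAt (𝓡 4) x₀ x))) = _
  rw [h]

theorem formInChart_extChartAt (Ω : TwoForm X) {x₀ x : X} (hx : x ∈ (chartAt E4 x₀).source) :
    formInChart Ω x₀ (extChartAt (𝓡 4) x₀ x) =
      (Ω x).compContinuousLinearMap (coordFrame x₀ x) := by
  have h : (extChartAt (𝓡 4) x₀).symm (extChartAt (𝓡 4) x₀ x) = x :=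
    (extChartAt (𝓡 4) x₀).left_inv (by simpa using hx)
  rw [formInChart, h]

/-- Smoothness of `g` is that of a section of a bundle of homomorphisms. Its coordinates in the
trivialization at `p`, composed with the inverse chart, are the matrix of the metric. -/
theorem contDiffAt_metricInChart (g : Metric4 X) (p : X) :
    ContDiffAt ℝ ∞ (metricInChart g p) (extChartAt (𝓡 4) p p) := by
  have h0 := (contMDiffAt_hom_bundle _).1 (g.contMDiff p)
  have h1 := h0.2
  have h2 : ContMDiffAt 𝓘(ℝ, E4) (𝓡 4) ∞ (extChartAt (𝓡 4) p).symm (extChartAt (𝓡 4) p p) :=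
    contMDiffWithinAt_extChartAt_symm_target p (mem_extChartAt_target p) |>.contMDiffAt
      (extChartAt_target_mem_nhds p)
  have h3 : (extChartAt (𝓡 4) p).symm (extChartAt (𝓡 4) p p) = p := extChartAt_to_inv p
  have h4 := ContMDiffAt.comp_of_eq (x := extChartAt (𝓡 4) p p) h1 h2 h3
  refine (contMDiffAt_iff_contDiffAt.1 h4).congr_of_eventuallyEq ?_
  filter_upwards [extChartAt_target_mem_nhds (I := 𝓡 4) p] with y hy
  have hy' : (extChartAt (𝓡 4) p).symm y ∈ (chartAt E4 p).source := by
    have := (extChartAt (𝓡 4) p).map_target hy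
    simpa using this
  ext u v
  have h5 := inCoordinates_apply_eq₂ (𝕜 := ℝ) (F₁ := E4) (F₂ := E4) (F₃ := ℝ)
    (E₁ := fun x : X => TangentSpace (𝓡 4) x) (E₂ := fun x : X => TangentSpace (𝓡 4) x)
    (E₃ := fun _ : X => ℝ) (x₀ := p) (ϕ := g.inner ((extChartAt (𝓡 4) p).symm y)) (v := u) (w := v)
    (by simpa using hy') (by simpa using hy') (by simp)
  refine Eq.trans ?_ h5.symm
  have h6 : ∀ z : ℝ, Bundle.Trivialization.linearMapAt ℝ
      (trivializationAt ℝ (fun _ : X => ℝ) p) ((extChartAt (𝓡 4) p).symm y) z = z := by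
    intro z
    rw [Bundle.Trivialization.coe_linearMapAt_of_mem _ (by simp)]
    rfl
  rw [h6, ← Bundle.Trivialization.symmL_apply (R := ℝ) _ (by simpa using hy'),
    ← Bundle.Trivialization.symmL_apply (R := ℝ) _ (by simpa using hy')]
  rfl

theorem metricInChart_pos (g : Metric4 X) {x₀ : X} {y : E4}
    (hy : y ∈ (extChartAt (𝓡 4) x₀).target) (u : E4) (hu : u ≠ 0) :
    0 < metricInChart g x₀ y u u := by
  refine pullMetric_pos g _ (coordFrame_injective ?_) u hu
  have := (extChartAt (𝓡 4) x₀).map_target hy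
  simpa using this

theorem formInChart_zero {Ω : TwoForm X} {p : X} (hp : p ∈ zeroSet Ω) :
    formInChart Ω p (extChartAt (𝓡 4) p p) = 0 := by
  rw [formInChart_extChartAt Ω (mem_chart_source E4 p), show Ω p = 0 from hp]
  rfl

theorem IsSmoothForm.contDiffAt {Ω : TwoForm X} (hΩ : IsSmoothForm Ω) (p : X) :
    ContDiffAt ℝ ∞ (formInChart Ω p) (extChartAt (𝓡 4) p p) :=
  (hΩ p).contDiffAt (extChartAt_target_mem_nhds p)

theorem nablaAtZero_add (Ω : TwoForm X) (p : X) (u v : TangentSpace (𝓡 4) p) :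
    nablaAtZero Ω p (u + v) = nablaAtZero Ω p u + nablaAtZero Ω p v :=
  (fderiv ℝ (formInChart Ω p) (extChartAt (𝓡 4) p p)).map_add u v

theorem nablaAtZero_smul (Ω : TwoForm X) (p : X) (c : ℝ) (v : TangentSpace (𝓡 4) p) :
    nablaAtZero Ω p (c • v) = c • nablaAtZero Ω p v :=
  (fderiv ℝ (formInChart Ω p) (extChartAt (𝓡 4) p p)).map_smul c v

/-- The derivative of a differentiable map, along a sequence of points `x + s v + o(s)`. -/
theorem HasFDerivAt.tendsto_blowup {E F : Type*} [NormedAddCommGroup E] [NormedSpace ℝ E]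
    [NormedAddCommGroup F] [NormedSpace ℝ F] {f : E → F} {f' : E →L[ℝ] F} {x : E}
    (hf : HasFDerivAt f f' x) (h0 : f x = 0) {ι : Type*} {l : Filter ι} {s : ι → ℝ} {y : ι → E}
    {v : E} (hs : Filter.Tendsto s l (𝓝[>] 0))
    (hy : Filter.Tendsto (fun i => (s i)⁻¹ • (y i - x)) l (𝓝 v)) :
    Filter.Tendsto (fun i => (s i)⁻¹ • f (y i)) l (𝓝 (f' v)) := by
  have hs0 : Filter.Tendsto s l (𝓝 0) := hs.mono_right nhdsWithin_le_nhds
  have hpos : ∀ᶠ i in l, 0 < s i := hs.eventually self_mem_nhdsWithin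
  have hd : Filter.Tendsto (fun i => y i - x) l (𝓝 0) := by
    have := hs0.smul hy
    rw [zero_smul] at this
    refine this.congr' ?_
    filter_upwards [hpos] with i hi
    rw [smul_inv_smul₀ hi.ne']
  have h := (hasFDerivWithinAt_univ.2 hf).lim hd (Filter.Eventually.of_forall fun _ => mem_univ _) hy
  simpa [h0] using h

/-- The frame `A` along the map `x` is continuous at `q₀`. -/
def FrameContinuousAt {Y : Type*} [TopologicalSpace Y] (x : Y → X)
    (A : ∀ q, E4 →L[ℝ] TangentSpace (𝓡 4) (x q)) (q₀ : Y) : Prop :=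
  ContinuousAt x q₀ ∧ ContinuousAt (fun q => (coordMap (x q₀) (x q)).comp (A q)) q₀

section FrameContinuity

variable {Y : Type*} [TopologicalSpace Y] {x : Y → X}
  {A : ∀ q, E4 →L[ℝ] TangentSpace (𝓡 4) (x q)} {q₀ : Y}

theorem FrameContinuousAt.eventually_mem (h : FrameContinuousAt x A q₀) :
    ∀ᶠ q in 𝓝 q₀, x q ∈ (chartAt E4 (x q₀)).source :=
  h.1.eventually ((chartAt E4 (x q₀)).open_source.mem_nhds (mem_chart_source E4 (x q₀)))

theorem FrameContinuousAt.tendsto_extChartAt (h : FrameContinuousAt x A q₀) :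
    Filter.Tendsto (fun q => extChartAt (𝓡 4) (x q₀) (x q)) (𝓝 q₀)
      (𝓝 (extChartAt (𝓡 4) (x q₀) (x q₀))) :=
  (continuousAt_extChartAt (x q₀)).tendsto.comp h.1

theorem FrameContinuousAt.continuousAt_pullMetric (h : FrameContinuousAt x A q₀) (g : Metric4 X) :
    ContinuousAt (fun q => pullMetric g (x q) (A q)) q₀ := by
  have h1 : ContinuousAt (fun q => metricInChart g (x q₀) (extChartAt (𝓡 4) (x q₀) (x q))) q₀ :=
    (contDiffAt_metricInChart g (x q₀)).continuousAt.tendsto.comp h.tendsto_extChartAt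
  have h2 := h.2
  have h3 : ContinuousAt (fun q => (ContinuousLinearMap.precomp ℝ
      ((coordMap (x q₀) (x q)).comp (A q))).comp
      ((metricInChart g (x q₀) (extChartAt (𝓡 4) (x q₀) (x q))).comp
        ((coordMap (x q₀) (x q)).comp (A q)))) q₀ := by
    refine continuousAt_clm_apply.2 fun u => continuousAt_clm_apply.2 fun v => ?_
    exact (h1.clm_apply (h2.clm_apply continuousAt_const)).clm_apply
      (h2.clm_apply continuousAt_const)
  refine h3.congr ?_
  filter_upwards [h.eventually_mem] with q hq
  ext u v
  rw [metricInChart_extChartAt g hq]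
  change g.inner (x q) (coordFrame (x q₀) (x q) (coordMap (x q₀) (x q) (A q u)))
    (coordFrame (x q₀) (x q) (coordMap (x q₀) (x q) (A q v))) = g.inner (x q) (A q u) (A q v)
  rw [coordFrame_coordMap hq, coordFrame_coordMap hq]

theorem continuousWithinAt_compContinuousLinearMap {V : Type*} [NormedAddCommGroup V]
    [NormedSpace ℝ V] {s : Set Y} {α : Y → E4 [⋀^Fin 2]→L[ℝ] V} {C : Y → E4 →L[ℝ] E4}
    (hα : ContinuousWithinAt α s q₀) (hC : ContinuousWithinAt C s q₀) :
    ContinuousWithinAt (fun q => (α q).compContinuousLinearMap (C q)) s q₀ := by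
  have h : Continuous fun C : E4 →L[ℝ] E4 => (ContinuousAlternatingMap.compContinuousLinearMapCLM C :
      (E4 [⋀^Fin 2]→L[ℝ] V) →L[ℝ] E4 [⋀^Fin 2]→L[ℝ] V) :=
    ContinuousAlternatingMap.continuous_compContinuousLinearMapCLM
  exact (h.continuousAt.comp_continuousWithinAt hC).clm_apply hα

theorem compContinuousLinearMap_coord {V : Type*} [AddCommGroup V] [Module ℝ V]
    [TopologicalSpace V] {x₀ y : X} (hy : y ∈ (chartAt E4 x₀).source)
    (α : TangentSpace (𝓡 4) y [⋀^Fin 2]→L[ℝ] V) (B : E4 →L[ℝ] TangentSpace (𝓡 4) y) :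
    (α.compContinuousLinearMap (coordFrame x₀ y)).compContinuousLinearMap
      ((coordMap x₀ y).comp B) = α.compContinuousLinearMap B := by
  refine ContinuousAlternatingMap.ext fun v => ?_
  change α (fun i => coordFrame x₀ y (coordMap x₀ y (B (v i)))) = α (fun i => B (v i))
  simp only [coordFrame_coordMap hy]

theorem FrameContinuousAt.continuousAt_form (h : FrameContinuousAt x A q₀) {Ω : TwoForm X}
    (hΩ : IsSmoothForm Ω) :
    ContinuousAt (fun q => (Ω (x q)).compContinuousLinearMap (A q)) q₀ := by
  have h1 : ContinuousAt (fun q => formInChart Ω (x q₀) (extChartAt (𝓡 4) (x q₀) (x q))) q₀ :=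
    (hΩ.contDiffAt (x q₀)).continuousAt.tendsto.comp h.tendsto_extChartAt
  have h2 := continuousWithinAt_univ _ _ |>.1 <| continuousWithinAt_compContinuousLinearMap
    h1.continuousWithinAt (h.2.continuousWithinAt (s := univ))
  refine h2.congr ?_
  filter_upwards [h.eventually_mem] with q hq
  rw [formInChart_extChartAt Ω hq, compContinuousLinearMap_coord hq]

/-- A complex 2-form, read in a frame. -/
noncomputable def frameForm {y : X} (B : E4 →L[ℝ] TangentSpace (𝓡 4) y)
    (θ : TangentSpace (𝓡 4) y [⋀^Fin 2]→L[ℝ] (Bundle.Trivial X ℂ y)) : ComplexForms :=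
  θ.compContinuousLinearMap B

theorem frameForm_apply {y : X} (B : E4 →L[ℝ] TangentSpace (𝓡 4) y)
    (θ : TangentSpace (𝓡 4) y [⋀^Fin 2]→L[ℝ] (Bundle.Trivial X ℂ y)) (u v : E4) :
    frameForm B θ ![u, v] = θ ![B u, B v] :=
  compContinuousLinearMap_pair θ B u v

/-- Continuity of complex 2-forms along `x`, read in a continuous frame. -/
theorem FrameContinuousAt.continuousWithinAt_iff (h : FrameContinuousAt x A q₀)
    (hA : ∀ q, Function.Bijective (A q)) {s : Set Y}
    {θ : ∀ q, TangentSpace (𝓡 4) (x q) [⋀^Fin 2]→L[ℝ] (Bundle.Trivial X ℂ (x q))} :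
    ContinuousWithinAt (fun q => (⟨x q, θ q⟩ : TotalSpace ComplexForms
      (fun x : X => TangentSpace (𝓡 4) x [⋀^Fin 2]→L[ℝ] (Bundle.Trivial X ℂ x)))) s q₀ ↔
    ContinuousWithinAt (fun q => frameForm (A q) (θ q)) s q₀ := by
  have h0 : ∀ᶠ q in 𝓝[s] q₀, x q ∈ (chartAt E4 (x q₀)).source :=
    h.eventually_mem.filter_mono nhdsWithin_le_nhds
  have h00 : x q₀ ∈ (chartAt E4 (x q₀)).source := mem_chart_source E4 (x q₀)
  have hiff := continuousWithinAt_continuousAlternatingMap_bundle (𝕜 := ℝ) (ι := Fin 2)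
    (F₁ := E4) (F₂ := ℂ) (E₁ := fun x : X => TangentSpace (𝓡 4) x) (E₂ := Bundle.Trivial X ℂ)
    (s := s) (x₀ := q₀) (fun q => ⟨x q, θ q⟩)
  have h1 : ∀ q, ContinuousAlternatingMap.inCoordinates E4 ℂ
      (E₁ := fun x : X => TangentSpace (𝓡 4) x) (E₂ := Bundle.Trivial X ℂ)
        (x q₀) (x q) (x q₀) (x q) (θ q) = frameForm (coordFrame (x q₀) (x q)) (θ q) := by
    intro q
    refine twoForm_ext fun u v => ?_
    rw [frameForm_apply]
    simp only [ContinuousAlternatingMap.inCoordinates]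
    rw [compContinuousLinearMap_pair]
    rw [ContinuousLinearMap.compContinuousAlternatingMap_coe]
    simp
    rfl
  simp only [h1] at hiff
  refine hiff.trans ((and_iff_right h.1.continuousWithinAt).trans ⟨fun h2 => ?_, fun h2 => ?_⟩)
  · refine (continuousWithinAt_compContinuousLinearMap h2
      h.2.continuousWithinAt).congr_of_eventuallyEq ?_ ?_
    · filter_upwards [h0] with q hq
      exact (compContinuousLinearMap_coord hq (θ q) (A q)).symm
    · exact (compContinuousLinearMap_coord h00 (θ q₀) (A q₀)).symm
  -- Conversely, the chart coordinates of the form are recovered by the inverse of the coordinate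
  -- matrix of the frame; this inverse is continuous because the matrix is invertible at `q₀`.
  · obtain ⟨e, he⟩ : ∃ e : E4 ≃L[ℝ] E4,
        (e : E4 →L[ℝ] E4) = (coordMap (x q₀) (x q₀)).comp (A q₀) := by
      have hinj : Function.Injective ((coordMap (x q₀) (x q₀)).comp (A q₀)).toLinearMap :=
        (Function.LeftInverse.injective (coordFrame_coordMap h00)).comp (hA q₀).1
      exact ⟨(LinearEquiv.ofInjectiveEndo _ hinj).toContinuousLinearEquiv, by ext; rfl⟩
    have h3 : ContinuousWithinAt (fun q => ContinuousLinearMap.inverse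
        ((coordMap (x q₀) (x q)).comp (A q))) s q₀ := by
      refine ContinuousAt.comp_continuousWithinAt (g := ContinuousLinearMap.inverse) ?_
        h.2.continuousWithinAt
      rw [← he]
      exact (contDiffAt_map_inverse (n := 0) e).continuousAt
    have h4 : ∀ q, x q ∈ (chartAt E4 (x q₀)).source →
        frameForm (coordFrame (x q₀) (x q)) (θ q) = (frameForm (A q) (θ q)).compContinuousLinearMap
          (ContinuousLinearMap.inverse ((coordMap (x q₀) (x q)).comp (A q))) := by
      intro q hq
      have hinj : Function.Injective ((coordMap (x q₀) (x q)).comp (A q)).toLinearMap :=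
        (Function.LeftInverse.injective (coordFrame_coordMap hq)).comp (hA q).1
      let e : E4 ≃L[ℝ] E4 := (LinearEquiv.ofInjectiveEndo _ hinj).toContinuousLinearEquiv
      have he : (coordMap (x q₀) (x q)).comp (A q) = e := by ext; rfl
      refine twoForm_ext fun u v => ?_
      rw [compContinuousLinearMap_pair, frameForm_apply, frameForm_apply, he,
        ContinuousLinearMap.inverse_equiv]
      have h5 : ∀ u, A q (e.symm u) = coordFrame (x q₀) (x q) u := by
        intro u
        conv_rhs => rw [← e.apply_symm_apply u]
        exact (coordFrame_coordMap hq _).symm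
      simp only [ContinuousLinearEquiv.coe_coe, h5]
    refine (continuousWithinAt_compContinuousLinearMap h2 h3).congr_of_eventuallyEq ?_ (h4 q₀ h00)
    filter_upwards [h0] with q hq
    exact h4 q hq

end FrameContinuity

end Charts

/-! ### Geodesics -/

section GeodesicEstimate

set_option maxSynthPendingDepth 3

variable {E : Type*} [NormedAddCommGroup E] [NormedSpace ℝ E]

/-- The lower bound `m` is the minimum of `G y u u` over the compact product of a closed ball and
the unit sphere; the other bounds come from continuity at `x`. -/
theorem exists_metric_bounds [FiniteDimensional ℝ E] [Nontrivial E] {G : E → E →L[ℝ] E →L[ℝ] ℝ}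
    {x : E} {U : Set E} (hU : U ∈ 𝓝 x) (hG : ContDiffAt ℝ 1 G x)
    (hpos : ∀ y ∈ U, ∀ u, u ≠ 0 → 0 < G y u u) :
    ∃ R > 0, ∃ m > 0, ∃ L > 0, ∃ M > 0, Metric.closedBall x R ⊆ U ∧
      ∀ y ∈ Metric.closedBall x R, DifferentiableAt ℝ G y ∧ ‖fderiv ℝ G y‖ ≤ M ∧ ‖G y‖ ≤ L ∧
        ∀ u, m * ‖u‖ ^ 2 ≤ G y u u := by
  have h1 : ∀ᶠ y in 𝓝 x, DifferentiableAt ℝ G y := by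
    filter_upwards [hG.eventually (by simp)] with y hy
    exact hy.differentiableAt (by simp)
  have h2 : ∀ᶠ y in 𝓝 x, ‖fderiv ℝ G y‖ < ‖fderiv ℝ G x‖ + 1 := by
    have : ContinuousAt (fun y => ‖fderiv ℝ G y‖) x :=
      ((hG.fderiv_right (m := 0) (by simp)).continuousAt).norm
    exact this.eventually_lt continuousAt_const (lt_add_one _)
  have h3 : ∀ᶠ y in 𝓝 x, ‖G y‖ < ‖G x‖ + 1 :=
    hG.continuousAt.norm.eventually_lt continuousAt_const (lt_add_one _)
  obtain ⟨R, hR, hball⟩ := Metric.nhds_basis_closedBall.eventually_iff.1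
    ((h1.and (h2.and h3)).and hU)
  have hc : ContinuousOn (fun q : E × E => G q.1 q.2 q.2)
      (Metric.closedBall x R ×ˢ Metric.sphere 0 1) := by
    intro q hq
    have hGc : ContinuousAt (fun q : E × E => G q.1) q :=
      ContinuousAt.comp (g := G) (hball hq.1).1.1.continuousAt continuousAt_fst
    exact ((hGc.clm_apply continuousAt_snd).clm_apply continuousAt_snd).continuousWithinAt
  have hcomp : IsCompact (Metric.closedBall x R ×ˢ Metric.sphere (0 : E) 1) :=
    (isCompact_closedBall x R).prod (isCompact_sphere 0 1)
  have hne : (Metric.closedBall x R ×ˢ Metric.sphere (0 : E) 1).Nonempty :=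
    (Metric.nonempty_closedBall.2 hR.le).prod (NormedSpace.sphere_nonempty.2 zero_le_one)
  obtain ⟨q, hq, hmin⟩ := hcomp.exists_isMinOn hne hc
  have hq2 : q.2 ≠ 0 := fun h => by simpa [h] using hq.2
  refine ⟨R, hR, G q.1 q.2 q.2, hpos _ (hball hq.1).2 _ hq2, ‖G x‖ + 1, by positivity,
    ‖fderiv ℝ G x‖ + 1, by positivity, fun y hy => (hball hy).2, fun y hy =>
    ⟨(hball hy).1.1, (hball hy).1.2.1.le, (hball hy).1.2.2.le, fun u => ?_⟩⟩
  by_cases hu : u = 0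
  · simp [hu]
  have hu' := norm_pos_iff.2 hu
  have h := hmin (show (y, ‖u‖⁻¹ • u) ∈ Metric.closedBall x R ×ˢ Metric.sphere (0 : E) 1 from
    ⟨hy, by simp [norm_smul, hu'.ne']⟩)
  simp only [mem_ofPred_eq, map_smul, smul_apply, smul_eq_mul] at h
  have h5 : G y u u = ‖u‖ ^ 2 * (‖u‖⁻¹ * (‖u‖⁻¹ * G y u u)) := by field_simp
  rw [h5, mul_comm]
  exact mul_le_mul_of_nonneg_left h (by positivity)

/-- A geodesic of the metric `G` with initial velocity `v` is close to the straight line. -/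
theorem geodesic_estimate {G : E → E →L[ℝ] E →L[ℝ] ℝ} {S : Set E} {m L M : ℝ} (hm : 0 < m)
    (hL : 0 < L) (hM : 0 < M) (hsymm : ∀ y u w, G y u w = G y w u)
    (hG : ∀ y ∈ S, DifferentiableAt ℝ G y ∧ ‖fderiv ℝ G y‖ ≤ M ∧ ‖G y‖ ≤ L ∧
        ∀ u, m * ‖u‖ ^ 2 ≤ G y u u) {c : ℝ → E} {v : E} {T : ℝ} (hT : 0 ≤ T) (hT1 : T ≤ 1)
    (hv : HasDerivAt c v 0)
    (hc : ∀ t ∈ Icc 0 T, c t ∈ S ∧ ContDiffAt ℝ 2 c t ∧ ∀ w,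
      G (c t) (deriv (deriv c) t) w + fderiv ℝ G (c t) (deriv c t) (deriv c t) w
        - 1 / 2 * fderiv ℝ G (c t) w (deriv c t) (deriv c t) = 0) :
    ‖c T - c 0‖ ≤ Real.sqrt (L / m) * ‖v‖ ∧
      ‖c T - c 0 - T • v‖ ≤ 3 / 2 * M * L / m ^ 2 * ‖v‖ ^ 2 := by
  have hd1 : ∀ t ∈ Icc 0 T, HasDerivAt c (deriv c t) t := fun t ht =>
    ((hc t ht).2.1.differentiableAt (by simp)).hasDerivAt
  have hd2 : ∀ t ∈ Icc 0 T, HasDerivAt (deriv c) (deriv (deriv c) t) t := by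
    intro t ht
    have h : ContDiffAt ℝ 1 (fderiv ℝ c) t := (hc t ht).2.1.fderiv_right (by norm_num)
    have h2 : DifferentiableAt ℝ (fun s => fderiv ℝ c s 1) t :=
      (h.differentiableAt (by simp)).clm_apply (differentiableAt_const _)
    have h3 : deriv c = fun s => fderiv ℝ c s 1 := by
      ext s; exact (fderiv_apply_one_eq_deriv).symm
    exact (h3 ▸ h2).hasDerivAt
  have h0 : (0 : ℝ) ∈ Icc 0 T := ⟨le_rfl, hT⟩
  have hv' : deriv c 0 = v := hv.deriv
  -- The geodesic equation with `w = c'` is half the derivative of the energy. Constant energy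
  -- bounds the speed.
  have henergy : ∀ t ∈ Icc 0 T, HasDerivAt (fun t => G (c t) (deriv c t) (deriv c t)) 0 t := by
    intro t ht
    have h1 : HasDerivAt (fun t => G (c t)) (fderiv ℝ G (c t) (deriv c t)) t :=
      (hG _ (hc t ht).1).1.hasFDerivAt.comp_hasDerivAt t (hd1 t ht)
    have h2 := (h1.clm_apply (hd2 t ht)).clm_apply (hd2 t ht)
    refine h2.congr_deriv ?_
    have h3 := (hc t ht).2.2 (deriv c t)
    have h4 := hsymm (c t) (deriv c t) (deriv (deriv c) t)
    simp only [add_apply]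
    linarith
  have hconst : ∀ t ∈ Icc 0 T, G (c t) (deriv c t) (deriv c t) = G (c 0) v v := by
    intro t ht
    have := constant_of_has_deriv_right_zero (f := fun t => G (c t) (deriv c t) (deriv c t))
      (a := 0) (b := T) (fun t ht => (henergy t ht).continuousAt.continuousWithinAt)
      (fun t ht => (henergy t ⟨ht.1, ht.2.le⟩).hasDerivWithinAt) t ht
    rw [this, hv']
  have hspeed : ∀ t ∈ Icc 0 T, ‖deriv c t‖ ^ 2 ≤ L / m * ‖v‖ ^ 2 := by
    intro t ht
    have h1 := (hG _ (hc t ht).1).2.2.2 (deriv c t)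
    rw [hconst t ht] at h1
    have h2 : G (c 0) v v ≤ L * ‖v‖ ^ 2 := by
      have h3 := (G (c 0)).le_opNorm₂ v v
      have h4 := (hG _ (hc 0 h0).1).2.2.1
      calc G (c 0) v v ≤ ‖G (c 0) v v‖ := Real.le_norm_self _
        _ ≤ ‖G (c 0)‖ * ‖v‖ * ‖v‖ := h3
        _ ≤ L * ‖v‖ * ‖v‖ := by gcongr
        _ = L * ‖v‖ ^ 2 := by ring
    rw [div_mul_eq_mul_div, le_div_iff₀ hm]
    linarith
  have hspeed' : ∀ t ∈ Icc 0 T, ‖deriv c t‖ ≤ Real.sqrt (L / m) * ‖v‖ := by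
    intro t ht
    refine abs_le_of_sq_le_sq' ?_ (by positivity) |>.2
    rw [mul_pow, Real.sq_sqrt (by positivity)]
    exact hspeed t ht
  -- The geodesic equation with `w = c''` bounds `m ‖c''‖²` by `(1 + 1/2) M ‖c'‖² ‖c''‖`. Two
  -- integrations then give the estimate.
  have hacc : ∀ t ∈ Icc 0 T, ‖deriv (deriv c) t‖ ≤ 3 / 2 * M * L / m ^ 2 * ‖v‖ ^ 2 := by
    intro t ht
    have h1 := (hc t ht).2.2 (deriv (deriv c) t)
    obtain ⟨-, hM', -, hm'⟩ := hG _ (hc t ht).1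
    have h2 := hm' (deriv (deriv c) t)
    have h3 := hspeed t ht
    generalize deriv (deriv c) t = a at *
    generalize deriv c t = b at *
    have h5 : ∀ x y z : E, |fderiv ℝ G (c t) x y z| ≤ M * ‖x‖ * ‖y‖ * ‖z‖ := by
      intro x y z
      calc |fderiv ℝ G (c t) x y z| ≤ ‖fderiv ℝ G (c t) x‖ * ‖y‖ * ‖z‖ :=
            (fderiv ℝ G (c t) x).le_opNorm₂ y z
        _ ≤ (M * ‖x‖) * ‖y‖ * ‖z‖ := by
            gcongr
            exact (fderiv ℝ G (c t)).le_of_opNorm_le hM' x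
    have h6 := abs_le.1 (h5 b b a)
    have h7 := abs_le.1 (h5 a b b)
    have h8 : m * ‖a‖ ^ 2 ≤ 3 / 2 * M * ‖b‖ ^ 2 * ‖a‖ := by nlinarith
    by_cases ha : ‖a‖ = 0
    · rw [ha]; positivity
    · have ha' : 0 < ‖a‖ := lt_of_le_of_ne (norm_nonneg a) (Ne.symm ha)
      have h9 : m * ‖a‖ ≤ 3 / 2 * M * ‖b‖ ^ 2 := by
        refine le_of_mul_le_mul_right ?_ ha'
        nlinarith
      have h10 : m * ‖a‖ ≤ 3 / 2 * M * (L / m * ‖v‖ ^ 2) := h9.trans (by gcongr)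
      calc ‖a‖ = m * ‖a‖ / m := by field_simp
        _ ≤ 3 / 2 * M * (L / m * ‖v‖ ^ 2) / m := by gcongr
        _ = _ := by field_simp
  have hTm : T ∈ Icc 0 T := ⟨hT, le_rfl⟩
  constructor
  · have h := norm_image_sub_le_of_norm_deriv_le_segment' (f := c) (f' := deriv c)
      (fun t ht => (hd1 t ht).hasDerivWithinAt) (fun t ht => hspeed' t ⟨ht.1, ht.2.le⟩) T hTm
    refine h.trans ?_
    exact mul_le_of_le_one_right (by positivity) (by linarith)
  · have h1 : ∀ t ∈ Icc 0 T, ‖deriv c t - v‖ ≤ 3 / 2 * M * L / m ^ 2 * ‖v‖ ^ 2 := by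
      intro t ht
      have h := norm_image_sub_le_of_norm_deriv_le_segment' (f := deriv c) (f' := deriv (deriv c))
        (fun t ht => (hd2 t ht).hasDerivWithinAt) (fun t ht => hacc t ⟨ht.1, ht.2.le⟩) t ht
      rw [hv'] at h
      exact h.trans (mul_le_of_le_one_right (by positivity) (by linarith [ht.2]))
    have h2 := norm_image_sub_le_of_norm_deriv_le_segment' (f := fun t => c t - t • v)
      (f' := fun t => deriv c t - v) (fun t ht => by
        have := (hd1 t ht).sub ((hasDerivAt_id t).smul_const v)
        rw [one_smul] at this
        exact this.hasDerivWithinAt) (fun t ht => h1 t ⟨ht.1, ht.2.le⟩) T hTm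
    have h3 : c T - c 0 - T • v = c T - T • v - (c 0 - (0 : ℝ) • v) := by simp; abel
    rw [h3]
    exact h2.trans (mul_le_of_le_one_right (by positivity) (by linarith))

end GeodesicEstimate

/-! ### The exponential map near zero. -/

section Exponential

variable {X : Type*} [TopologicalSpace X] [ChartedSpace E4 X] [IsManifold (𝓡 4) ∞ X]

theorem metricInChart_symm (g : Metric4 X) (x₀ : X) (y u w : E4) :
    metricInChart g x₀ y u w = metricInChart g x₀ y w u := g.symm _ _ _

/-- The exponential map has derivative `1` at zero. -/
theorem exists_exp_estimate [T2Space X] (g : Metric4 X) (p : X) :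
    ∃ ρ > 0, ∃ C, ∀ v : E4, ‖v‖ ≤ ρ → ∀ q, IsExp g p v q →
      q ∈ (chartAt E4 p).source ∧
      ‖extChartAt (𝓡 4) p q - extChartAt (𝓡 4) p p - v‖ ≤ C * ‖v‖ ^ 2 := by
  obtain ⟨R, hR, m, hm, L, hL, M, hM, hsub, hG⟩ := exists_metric_bounds
    (extChartAt_target_mem_nhds (I := 𝓡 4) p) ((contDiffAt_metricInChart g p).of_le (by simp))
    (fun y hy => metricInChart_pos g hy)
  -- With this radius the speed bound confines the geodesic to the ball of radius `R / 2`. The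
  -- estimate holds for every end point `q`, so uniqueness of geodesics is not needed for the value
  -- chosen in `riemExp`.
  refine ⟨R / 2 / Real.sqrt (L / m), by positivity, 3 / 2 * M * L / m ^ 2, ?_⟩
  rintro v hv q ⟨γ, δ, hδ, hγ, ⟨h0, -, hder⟩, rfl⟩
  have hκ : 0 < Real.sqrt (L / m) := by positivity
  have hv' : Real.sqrt (L / m) * ‖v‖ ≤ R / 2 := by
    rw [le_div_iff₀ hκ] at hv
    linarith
  set φ := extChartAt (𝓡 4) p with hφ
  let U : Set X := φ.source ∩ φ ⁻¹' Metric.ball (φ p) R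
  have hUo : IsOpen U :=
    (continuousOn_extChartAt p).isOpen_inter_preimage (isOpen_extChartAt_source p)
      Metric.isOpen_ball
  have hcont : ∀ t ∈ Icc (0 : ℝ) 1, ContinuousAt γ t := fun t ht =>
    (hγ t ⟨by linarith [ht.1], by linarith [ht.2]⟩).1
  have key : ∀ T, 0 ≤ T → T ≤ 1 → (∀ t ∈ Icc 0 T, γ t ∈ U) →
      ‖φ (γ T) - φ p‖ ≤ Real.sqrt (L / m) * ‖v‖ ∧
      ‖φ (γ T) - φ p - T • v‖ ≤ 3 / 2 * M * L / m ^ 2 * ‖v‖ ^ 2 := by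
    intro T hT hT1 hU
    have h := geodesic_estimate (S := Metric.closedBall (φ p) R) hm hL hM
      (metricInChart_symm g p) hG (c := fun t => φ (γ t)) (v := v) hT hT1 hder (fun t ht => by
        have h1 := (hγ t ⟨by linarith [ht.1], by linarith [ht.2]⟩).2 p (hU t ht).1
        exact ⟨Metric.ball_subset_closedBall (hU t ht).2, h1⟩)
    simpa [h0] using h
  have hall : ∀ t ∈ Icc (0 : ℝ) 1, γ t ∈ U := by
    by_contra! hne
    obtain ⟨t₀, ht₀, ht₀U⟩ := hne
    have hB : IsCompact (Icc (0 : ℝ) 1 ∩ γ ⁻¹' Uᶜ) := by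
      refine isCompact_Icc.of_isClosed_subset ?_ inter_subset_left
      exact ContinuousOn.preimage_isClosed_of_isClosed
        (fun t ht => (hcont t ht).continuousWithinAt) isClosed_Icc hUo.isClosed_compl
    obtain ⟨t₁, ⟨ht₁, ht₁U⟩, hmin⟩ := hB.exists_isLeast ⟨t₀, ht₀, ht₀U⟩
    have hpU : p ∈ U := ⟨mem_extChartAt_source p, Metric.mem_ball_self hR⟩
    have ht₁0 : 0 < t₁ := by
      refine lt_of_le_of_ne ht₁.1 ?_
      rintro rfl
      exact ht₁U (h0 ▸ hpU)
    have hbefore : ∀ t ∈ Ico 0 t₁, γ t ∈ U := by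
      intro t ht
      by_contra h
      exact absurd (hmin ⟨⟨ht.1, ht.2.le.trans ht₁.2⟩, h⟩) (not_le.2 ht.2)
    -- Up to a first exit time from `U` the curve stays in `K`. As `K` is compact, hence closed in
    -- the Hausdorff space `X`, and lies in `U`, the exit point would lie in `U`.
    let K : Set X := φ.symm '' Metric.closedBall (φ p) (R / 2)
    have hsub2 : Metric.closedBall (φ p) (R / 2) ⊆ φ.target :=
      (Metric.closedBall_subset_closedBall (by linarith)).trans hsub
    have hK : IsClosed K :=
      ((isCompact_closedBall _ _).image_of_continuousOn
        ((continuousOn_extChartAt_symm p).mono hsub2)).isClosed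
    have hKU : K ⊆ U := by
      rintro _ ⟨y, hy, rfl⟩
      refine ⟨φ.map_target (hsub2 hy), ?_⟩
      rw [mem_preimage, φ.right_inv (hsub2 hy)]
      exact Metric.closedBall_subset_ball (by linarith) hy
    have hmem : ∀ t ∈ Ico 0 t₁, γ t ∈ K := by
      intro t ht
      have h := (key t ht.1 (ht.2.le.trans ht₁.2)
        (fun s hs => hbefore s ⟨hs.1, hs.2.trans_lt ht.2⟩)).1
      refine ⟨φ (γ t), ?_, φ.left_inv (hbefore t ht).1⟩
      rw [Metric.mem_closedBall, dist_eq_norm]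
      exact h.trans hv'
    have hlim : Filter.Tendsto γ (𝓝[Ico 0 t₁] t₁) (𝓝 (γ t₁)) :=
      (hcont t₁ ht₁).continuousWithinAt
    have hne : (𝓝[Ico 0 t₁] t₁).NeBot := by
      rw [← mem_closure_iff_nhdsWithin_neBot, closure_Ico ht₁0.ne]
      exact ⟨ht₁0.le, le_rfl⟩
    exact ht₁U (hKU (hK.mem_of_tendsto hlim
      (Filter.eventually_of_mem self_mem_nhdsWithin hmem)))
  refine ⟨by simpa [hφ] using (hall 1 ⟨zero_le_one, le_rfl⟩).1, ?_⟩
  simpa using (key 1 zero_le_one le_rfl hall).2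

theorem riemExp_isExp {g : Metric4 X} {u : TangentBundle (𝓡 4) X}
    (h : ∃ q, IsExp g u.1 u.2 q) : IsExp g u.1 u.2 (riemExp g u) := by
  rw [riemExp, dif_pos h]
  exact h.choose_spec

/-- For `v = 0` the estimate gives `q` the same coordinates as `p`. -/
theorem IsExp.eq_of_zero [T2Space X] {g : Metric4 X} {p q : X} (h : IsExp g p 0 q) : q = p := by
  obtain ⟨ρ, hρ, C, hC⟩ := exists_exp_estimate g p
  obtain ⟨h1, h2⟩ := hC 0 (by simpa using hρ.le) q h
  have h4 : extChartAt (𝓡 4) p q = extChartAt (𝓡 4) p p := by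
    simpa [sub_eq_zero] using h2
  exact (extChartAt (𝓡 4) p).injOn (by simpa using h1) (mem_extChartAt_source p) h4

end Exponential

/-! ### Pseudo-inverses `(B*B)⁻¹B*` and orthogonal projections. -/

section PseudoInverse

variable {E W : Type*} [NormedAddCommGroup E] [InnerProductSpace ℝ E] [FiniteDimensional ℝ E]
  [NormedAddCommGroup W] [InnerProductSpace ℝ W] [FiniteDimensional ℝ W]

/-- The left inverse of an injective map which vanishes on the orthogonal complement of the
image. -/
noncomputable def pseudoInv (B : E →L[ℝ] W) : W →L[ℝ] E :=
  (ContinuousLinearMap.inverse (B.adjoint.comp B)).comp B.adjoint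

theorem exists_equiv_adjoint_comp {B : E →L[ℝ] W} (hB : Function.Injective B) :
    ∃ e : E ≃L[ℝ] E, (e : E →L[ℝ] E) = B.adjoint.comp B := by
  have hinj : Function.Injective (B.adjoint.comp B).toLinearMap := by
    rw [← LinearMap.ker_eq_bot, LinearMap.ker_eq_bot']
    intro u hu
    have h1 : inner ℝ (B.adjoint (B u)) u = 0 := by
      rw [show B.adjoint (B u) = 0 from hu, inner_zero_left]
    rw [ContinuousLinearMap.adjoint_inner_left, inner_self_eq_zero] at h1
    exact hB (h1.trans (map_zero B).symm)
  exact ⟨(LinearEquiv.ofInjectiveEndo _ hinj).toContinuousLinearEquiv, by ext; rfl⟩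

theorem pseudoInv_apply {B : E →L[ℝ] W} (hB : Function.Injective B) (u : E) :
    pseudoInv B (B u) = u := by
  obtain ⟨e, he⟩ := exists_equiv_adjoint_comp hB
  have h : B.adjoint (B u) = e u := (DFunLike.congr_fun he u).symm
  rw [pseudoInv, ← he, ContinuousLinearMap.inverse_equiv, ContinuousLinearMap.comp_apply, h]
  exact e.symm_apply_apply u

/-- This formula makes the orthogonal projection to a moving subspace a continuous function of a
frame `B` of the subspace. -/
theorem starProjection_range_eq {B : E →L[ℝ] W} (hB : Function.Injective B) (w : W) :
    (LinearMap.range B.toLinearMap).starProjection w = B (pseudoInv B w) := by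
  refine (Submodule.eq_starProjection_of_mem_of_inner_eq_zero ⟨_, rfl⟩ ?_)
  rintro _ ⟨u, rfl⟩
  obtain ⟨e, he⟩ := exists_equiv_adjoint_comp hB
  have h : B.adjoint (B (pseudoInv B w)) = B.adjoint w := by
    have h1 : B.adjoint (B (pseudoInv B w)) = e (pseudoInv B w) :=
      (DFunLike.congr_fun he (pseudoInv B w)).symm
    rw [h1, pseudoInv, ← he, ContinuousLinearMap.inverse_equiv]
    exact e.apply_symm_apply _
  change inner ℝ (w - B (pseudoInv B w)) (B u) = 0
  rw [← ContinuousLinearMap.adjoint_inner_left, map_sub, h, sub_self, inner_zero_left]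

theorem continuousAt_pseudoInv {B : E →L[ℝ] W} (hB : Function.Injective B) :
    ContinuousAt (pseudoInv : (E →L[ℝ] W) → W →L[ℝ] E) B := by
  obtain ⟨e, he⟩ := exists_equiv_adjoint_comp hB
  have h0 : Continuous fun B : E →L[ℝ] W => B.adjoint :=
    (ContinuousLinearMap.adjoint (𝕜 := ℝ) (E := E) (F := W)).continuous
  have h1 : ContinuousAt (fun B : E →L[ℝ] W => ContinuousLinearMap.inverse (B.adjoint.comp B)) B := by
    refine ContinuousAt.comp (g := ContinuousLinearMap.inverse) ?_
      (h0.clm_comp continuous_id).continuousAt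
    rw [← he]
    exact (contDiffAt_map_inverse (n := 0) e).continuousAt
  exact h1.clm_comp h0.continuousAt

end PseudoInverse

/-! ### Continuous frames of the tangent bundle along a homotopy. -/

section Transport

variable {X : Type*} [TopologicalSpace X] [ChartedSpace E4 X] [IsManifold (𝓡 4) ∞ X]

theorem FrameContinuousAt.continuousAt_apply {Y : Type*} [TopologicalSpace Y] {x : Y → X}
    {A : ∀ q, E4 →L[ℝ] TangentSpace (𝓡 4) (x q)} {q₀ : Y} (h : FrameContinuousAt x A q₀) (u : E4) :
    ContinuousAt (fun q => (⟨x q, A q u⟩ : TangentBundle (𝓡 4) X)) q₀ := by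
  refine (FiberBundle.continuousAt_totalSpace E4 (fun q => (⟨x q, A q u⟩ : TangentBundle (𝓡 4) X))).2
    ⟨h.1, ?_⟩
  refine (h.2.clm_apply (continuousAt_const (y := u))).congr ?_
  filter_upwards [h.eventually_mem] with q hq
  exact Bundle.Trivialization.continuousLinearMapAt_apply_of_mem (R := ℝ) _ (by simpa using hq) _

theorem frameContinuousAt_coordFrame (x₀ : X) :
    FrameContinuousAt (fun x : X => x) (fun x => coordFrame x₀ x) x₀ := by
  refine ⟨continuousAt_id, (continuousAt_const (y := ContinuousLinearMap.id ℝ E4)).congr ?_⟩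
  filter_upwards [(chartAt E4 x₀).open_source.mem_nhds (mem_chart_source E4 x₀)] with x hx
  ext u : 1
  exact (coordMap_coordFrame hx u).symm

theorem continuousAt_mfderiv_coordFrame {W : Type*} [NormedAddCommGroup W] [NormedSpace ℝ W]
    {f : X → W} (hf : ContMDiff (𝓡 4) 𝓘(ℝ, W) ∞ f) (x₀ : X) :
    ContinuousAt (Y := E4 →L[ℝ] W)
      (fun x => (mfderiv (𝓡 4) 𝓘(ℝ, W) f x).comp (coordFrame x₀ x)) x₀ := by
  refine continuousAt_clm_apply.2 fun u => ?_
  have h1 := (frameContinuousAt_coordFrame x₀).continuousAt_apply u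
  have h2 : Continuous (tangentMap (𝓡 4) 𝓘(ℝ, W) f) := hf.continuous_tangentMap (by simp)
  have h3 : Continuous fun p : TangentBundle 𝓘(ℝ, W) W => p.2 :=
    (contMDiff_snd_tangentBundle_modelSpace W 𝓘(ℝ, W) (n := 0)).continuous
  exact (h3.comp h2).continuousAt.comp h1

/-- A homotopy `H` of maps to a compact manifold which is constant at time `0` is covered by a
continuous family of frames. -/
theorem exists_frame [T2Space X] [CompactSpace X] {Y : Type*} [TopologicalSpace Y] [CompactSpace Y]
    {H : Y × unitInterval → X} (hH : Continuous H) {p : X} (hp : ∀ y, H (y, 0) = p)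
    (A₀ : E4 ≃L[ℝ] TangentSpace (𝓡 4) p) :
    ∃ A : ∀ q, E4 ≃L[ℝ] TangentSpace (𝓡 4) (H q),
      (∀ q, FrameContinuousAt H (fun q => (A q : E4 →L[ℝ] TangentSpace (𝓡 4) (H q))) q) ∧
      ∀ y u, (A (y, 0) u : E4) = A₀ u := by
  -- An immersion in Euclidean space makes the tangent spaces the images of a continuous family of
  -- projections `P` of one space `W`. Transport along `P ∘ H` carries the frame at `p` to all of
  -- `H`.
  obtain ⟨n, f, hf, -, hinj⟩ := exists_embedding_euclidean_of_compact (I := 𝓡 4) (M := X)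
  let W := EuclideanSpace ℝ (Fin n)
  let D : ∀ x : X, TangentSpace (𝓡 4) x →L[ℝ] W := fun x => mfderiv (𝓡 4) 𝓘(ℝ, W) f x
  have hD : ∀ x, Function.Injective (D x) := hinj
  let B : ∀ x₀ x : X, E4 →L[ℝ] W := fun x₀ x => (D x).comp (coordFrame x₀ x)
  have hBc : ∀ x₀, ContinuousAt (B x₀) x₀ := fun x₀ => continuousAt_mfderiv_coordFrame hf x₀
  have hBi : ∀ x₀ x, x ∈ (chartAt E4 x₀).source → Function.Injective (B x₀ x) := fun x₀ x hx =>
    (hD x).comp (coordFrame_injective hx)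
  have hrange : ∀ x₀ x, x ∈ (chartAt E4 x₀).source →
      LinearMap.range (B x₀ x).toLinearMap = LinearMap.range (D x).toLinearMap := by
    intro x₀ x hx
    ext w
    constructor
    · rintro ⟨u, rfl⟩
      exact ⟨coordFrame x₀ x u, rfl⟩
    · rintro ⟨u, rfl⟩
      exact ⟨coordMap x₀ x u, congrArg (D x) (coordFrame_coordMap hx u)⟩
  let P : X → W →L[ℝ] W := fun x => (LinearMap.range (D x).toLinearMap).starProjection
  have hP : Continuous P := by
    refine continuous_iff_continuousAt.2 fun x₀ => ?_
    have h1 : ContinuousAt (fun x => (B x₀ x).comp (pseudoInv (B x₀ x))) x₀ :=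
      (hBc x₀).clm_comp (ContinuousAt.comp (g := pseudoInv)
        (continuousAt_pseudoInv (hBi x₀ x₀ (mem_chart_source E4 x₀))) (hBc x₀))
    refine h1.congr ?_
    filter_upwards [(chartAt E4 x₀).open_source.mem_nhds (mem_chart_source E4 x₀)] with x hx
    ext w : 1
    have := starProjection_range_eq (hBi x₀ x hx) w
    simp only [hrange x₀ x hx] at this
    exact this.symm
  have hPmem : ∀ x w, P x w = w ↔ ∃ u, D x u = w := fun x w =>
    Submodule.starProjection_eq_self_iff
  obtain ⟨T, hT, h1, h2, h3, -⟩ := exists_transport (fun q => P (H q)) (hP.comp hH)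
    (fun q w => (hPmem _ _).2 (by
      obtain ⟨u, hu⟩ := Submodule.starProjection_apply_mem (LinearMap.range (D (H q)).toLinearMap) w
      exact ⟨u, hu⟩))
  have hA₀ : ∀ y u, P (H (y, 0)) (D p (A₀ u)) = D p (A₀ u) := by
    intro y u
    rw [hp]
    exact (hPmem p _).2 ⟨_, rfl⟩
  have hex : ∀ q u, ∃ v, D (H q) v = T q (D p (A₀ u)) := fun q u =>
    (hPmem _ _).1 (h1 q.1 q.2 _ (hA₀ q.1 u))
  choose a ha using hex
  let A' : ∀ q, E4 →ₗ[ℝ] TangentSpace (𝓡 4) (H q) := fun q =>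
    { toFun := a q
      map_add' := fun u v => hD _ (by rw [map_add, ha, ha, ha, map_add, map_add, map_add])
      map_smul' := fun c u => hD _ (by
        rw [RingHom.id_apply, map_smul, ha, ha, map_smul, map_smul, map_smul]) }
  have hA' : ∀ q, Function.Injective (A' q) := by
    intro q
    rw [← LinearMap.ker_eq_bot, LinearMap.ker_eq_bot']
    intro u hu
    have h4 : T q (D p (A₀ u)) = 0 := by
      rw [← ha, show a q u = 0 from hu, map_zero]
    have h5 := h2 q.1 q.2 _ (hA₀ q.1 u) h4
    exact A₀.injective (hD p (by rw [h5, map_zero, map_zero]))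
  have hfin : ∀ x : X, Module.finrank ℝ E4 = Module.finrank ℝ (TangentSpace (𝓡 4) x) :=
    fun x => rfl
  refine ⟨fun q => (LinearEquiv.ofInjectiveOfFinrankEq (A' q) (hA' q)
    (hfin _)).toContinuousLinearEquiv, fun q₀ => ⟨hH.continuousAt, ?_⟩, fun y u => ?_⟩
  · have h4 : ContinuousAt (fun q => (pseudoInv (B (H q₀) (H q))).comp
        ((T q).comp ((D p).comp (A₀ : E4 →L[ℝ] TangentSpace (𝓡 4) p)))) q₀ := by
      refine ContinuousAt.clm_comp ?_ (hT.continuousAt.clm_comp continuousAt_const)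
      refine ContinuousAt.comp (g := pseudoInv)
        (continuousAt_pseudoInv (hBi (H q₀) (H q₀) (mem_chart_source E4 (H q₀)))) ?_
      exact ContinuousAt.comp (g := B (H q₀)) (hBc (H q₀)) hH.continuousAt
    refine h4.congr ?_
    have h5 : ∀ᶠ q in 𝓝 q₀, H q ∈ (chartAt E4 (H q₀)).source :=
      hH.continuousAt.eventually
        ((chartAt E4 (H q₀)).open_source.mem_nhds (mem_chart_source E4 (H q₀)))
    filter_upwards [h5] with q hq
    ext u : 1
    change pseudoInv (B (H q₀) (H q)) (T q (D p (A₀ u))) = coordMap (H q₀) (H q) (a q u)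
    rw [← ha]
    conv_lhs => rw [← coordFrame_coordMap hq (a q u)]
    exact pseudoInv_apply (hBi _ _ hq) _
  · have h4 : D (H (y, 0)) (a (y, 0) u) = D p (A₀ u) := (ha (y, 0) u).trans (h3 y _ (hA₀ y u))
    have h5 : ∀ (x : X) (v : TangentSpace (𝓡 4) x) (w : TangentSpace (𝓡 4) p), x = p →
        D x v = D p w → (v : E4) = w := by
      rintro x v w rfl h
      exact hD _ h
    exact h5 _ _ _ (hp y) h4

end Transport

/-! ### Blow-up of `Ω` and of `J` at a zero. -/

section BlowUp

variable {X : Type*} [TopologicalSpace X] [ChartedSpace E4 X] [IsManifold (𝓡 4) ∞ X]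
  {g : Metric4 X} {o : Orientation4 X} {Ω : TwoForm X}

/-- The rescaled form, read in a frame, converges to the derivative at a zero. -/
theorem FrameContinuousAt.tendsto_form {Y ι : Type*} [TopologicalSpace Y] {x : Y → X}
    {A : ∀ q, E4 →L[ℝ] TangentSpace (𝓡 4) (x q)} {q₀ : Y} (h : FrameContinuousAt x A q₀)
    (hΩ : IsSmoothForm Ω) (h0 : x q₀ ∈ zeroSet Ω) {l : Filter ι} {q : ι → Y}
    (hq : Filter.Tendsto q l (𝓝 q₀)) {τ : ι → ℝ} (hτ : Filter.Tendsto τ l (𝓝[>] 0)) {v : E4}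
    (hv : Filter.Tendsto (fun i => (τ i)⁻¹ • (extChartAt (𝓡 4) (x q₀) (x (q i)) -
      extChartAt (𝓡 4) (x q₀) (x q₀))) l (𝓝 v)) :
    Filter.Tendsto (fun i => (τ i)⁻¹ • (Ω (x (q i))).compContinuousLinearMap (A (q i))) l
      (𝓝 ((nablaAtZero Ω (x q₀) v).compContinuousLinearMap (A q₀))) := by
  have h1 : Filter.Tendsto (fun i => (τ i)⁻¹ • formInChart Ω (x q₀)
      (extChartAt (𝓡 4) (x q₀) (x (q i)))) l
      (𝓝 (fderiv ℝ (formInChart Ω (x q₀)) (extChartAt (𝓡 4) (x q₀) (x q₀)) v)) :=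
    HasFDerivAt.tendsto_blowup ((hΩ.contDiffAt (x q₀)).differentiableAt (by simp)).hasFDerivAt
      (formInChart_zero h0) hτ hv
  have h2 : Filter.Tendsto (fun i => (coordMap (x q₀) (x (q i))).comp (A (q i))) l
      (𝓝 ((coordMap (x q₀) (x q₀)).comp (A q₀))) := h.2.tendsto.comp hq
  have hc : Continuous fun C : E4 →L[ℝ] E4 => (ContinuousAlternatingMap.compContinuousLinearMapCLM C :
      (E4 [⋀^Fin 2]→L[ℝ] ℝ) →L[ℝ] E4 [⋀^Fin 2]→L[ℝ] ℝ) :=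
    ContinuousAlternatingMap.continuous_compContinuousLinearMapCLM
  have h3 := (isBoundedBilinearMap_apply.continuous.tendsto _).comp
    (((hc.tendsto _).comp h2).prodMk_nhds h1)
  have h4 : (fderiv ℝ (formInChart Ω (x q₀)) (extChartAt (𝓡 4) (x q₀) (x q₀)) v
      ).compContinuousLinearMap ((coordMap (x q₀) (x q₀)).comp (A q₀)) =
      (nablaAtZero Ω (x q₀) v).compContinuousLinearMap (A q₀) := by
    refine twoForm_ext fun u w => ?_
    rw [compContinuousLinearMap_pair, compContinuousLinearMap_pair]
    change nablaAtZero Ω (x q₀) v ![coordMap (x q₀) (x q₀) (A q₀ u),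
      coordMap (x q₀) (x q₀) (A q₀ w)] = _
    rw [coordMap_self, coordMap_self]
  rw [← h4]
  refine h3.congr' ?_
  filter_upwards [hq.eventually h.eventually_mem] with i hi
  change ((τ i)⁻¹ • formInChart Ω (x q₀) (extChartAt (𝓡 4) (x q₀) (x (q i)))
    ).compContinuousLinearMap ((coordMap (x q₀) (x (q i))).comp (A (q i))) = _
  rw [formInChart_extChartAt Ω hi, ← compContinuousLinearMap_coord hi (Ω (x (q i))) (A (q i))]
  rfl

/-- The point with coordinates `φ(p) + s v` in the chart `φ` around `p`. -/
noncomputable def chartLine (p : X) (v : E4) (s : ℝ) : X :=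
  (extChartAt (𝓡 4) p).symm (extChartAt (𝓡 4) p p + s • v)

theorem eventually_mem_chartLine (p : X) (v : E4) :
    ∀ᶠ s in 𝓝 (0 : ℝ), extChartAt (𝓡 4) p p + s • v ∈ (extChartAt (𝓡 4) p).target := by
  have h : Filter.Tendsto (fun s : ℝ => extChartAt (𝓡 4) p p + s • v) (𝓝 0)
      (𝓝 (extChartAt (𝓡 4) p p)) := by
    have : Continuous fun s : ℝ => extChartAt (𝓡 4) p p + s • v := by fun_prop
    simpa using this.tendsto 0
  exact h.eventually (extChartAt_target_mem_nhds p)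

theorem tendsto_chartLine (p : X) (v : E4) :
    Filter.Tendsto (chartLine p v) (𝓝[>] 0) (𝓝 p) := by
  have h : Filter.Tendsto (fun s : ℝ => extChartAt (𝓡 4) p p + s • v) (𝓝 0)
      (𝓝 (extChartAt (𝓡 4) p p)) := by
    have : Continuous fun s : ℝ => extChartAt (𝓡 4) p p + s • v := by fun_prop
    simpa using this.tendsto 0
  have h2 := (continuousAt_extChartAt_symm (I := 𝓡 4) p).tendsto.comp h
  rw [extChartAt_to_inv] at h2
  exact h2.mono_left nhdsWithin_le_nhds

theorem tendsto_chartLine_sub (p : X) (v : E4) :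
    Filter.Tendsto (fun s : ℝ => s⁻¹ • (extChartAt (𝓡 4) p (chartLine p v s) -
      extChartAt (𝓡 4) p p)) (𝓝[>] 0) (𝓝 v) := by
  refine tendsto_const_nhds.congr' ?_
  filter_upwards [(eventually_mem_chartLine p v).filter_mono nhdsWithin_le_nhds,
    self_mem_nhdsWithin] with s hs hs0
  rw [chartLine, (extChartAt (𝓡 4) p).right_inv hs, add_sub_cancel_left,
    inv_smul_smul₀ (ne_of_gt hs0)]

theorem pullMetric_coordFrame_pos (g : Metric4 X) (p : X) (u : E4) (hu : u ≠ 0) :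
    0 < pullMetric g p (coordFrame p p) u u :=
  pullMetric_pos g p (coordFrame_injective (mem_chart_source E4 p)) u hu

theorem tendsto_form_chartLine (hΩ : IsSmoothForm Ω) {p : X} (hp : p ∈ zeroSet Ω) (v : E4) :
    Filter.Tendsto (fun s : ℝ => s⁻¹ • (Ω (chartLine p v s)).compContinuousLinearMap
      (coordFrame p (chartLine p v s))) (𝓝[>] 0)
      (𝓝 ((nablaAtZero Ω p v).compContinuousLinearMap (coordFrame p p))) :=
  (frameContinuousAt_coordFrame p).tendsto_form hΩ hp (tendsto_chartLine p v) Filter.tendsto_id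
    (tendsto_chartLine_sub p v)

/-- The derivative is the limit of the rescaled forms along a line in the chart; these are
self-dual, hence have scalar squares. -/
theorem hasScalarSquare_nablaAtZero (hsd : IsSelfDualForm g o Ω) (hΩ : IsSmoothForm Ω) {p : X}
    (hp : p ∈ zeroSet Ω) (v : E4) (B : E4 ≃L[ℝ] TangentSpace (𝓡 4) p) :
    HasScalarSquare (pullMetric g p B) ((nablaAtZero Ω p v).compContinuousLinearMap B) := by
  have hG := ((frameContinuousAt_coordFrame p).continuousAt_pullMetric g).tendsto.comp
    (tendsto_chartLine p v)
  have h := HasScalarSquare.of_tendsto hG (tendsto_form_chartLine hΩ hp v)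
    (pullMetric_coordFrame_pos g p) ?_
  · rw [hasScalarSquare_frame_iff, ← hasScalarSquare_frame_iff _ (coordEquiv (mem_chart_source E4 p))]
    exact h
  · have h1 : ∀ᶠ s in 𝓝[>] (0 : ℝ), chartLine p v s ∈ (chartAt E4 p).source :=
      (tendsto_chartLine p v).eventually
        ((chartAt E4 p).open_source.mem_nhds (mem_chart_source E4 p))
    filter_upwards [h1] with s hs
    obtain ⟨e, he⟩ := exists_isOrientedONB g o (chartLine p v s)
    exact (he.hasScalarSquare ((hsd _).apply_basis he) (coordEquiv hs)).smul _

/-- A scalar square alone leaves each value self-dual or anti-self-dual. The values form a linear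
space, which by transversality contains a nonzero self-dual form; this decides the case for all of
them. -/
theorem isSelfDualFor_nablaAtZero (hsd : IsSelfDualForm g o Ω) (hΩ : IsSmoothForm Ω)
    (htrans : VanishesTransversely g o Ω) {p : X} (hp : p ∈ zeroSet Ω)
    {e : Module.Basis (Fin 4) ℝ (TangentSpace (𝓡 4) p)} (he : IsOrientedONB g o p e)
    (v : TangentSpace (𝓡 4) p) : IsSelfDualFor e (nablaAtZero Ω p v) := by
  obtain ⟨α, hα, hα1⟩ := he.exists_isSelfDualAt
  obtain ⟨u, rfl⟩ := htrans p hp α hα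
  exact he.isSelfDualFor_of_linear (nablaAtZero_add Ω p)
    (fun v => hasScalarSquare_nablaAtZero hsd hΩ hp v (basisFrame e)) (hα.apply_basis he) hα1 v

theorem trSq_nablaAtZero_neg (hsd : IsSelfDualForm g o Ω) (hΩ : IsSmoothForm Ω)
    (htrans : VanishesTransversely g o Ω) {p : X} (hp : p ∈ zeroSet Ω) {v : TangentSpace (𝓡 4) p}
    (hv : nablaAtZero Ω p v ≠ 0) (B : E4 ≃L[ℝ] TangentSpace (𝓡 4) p) :
    trSq (raise (pullMetric g p B) ((nablaAtZero Ω p v).compContinuousLinearMap B)) < 0 := by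
  obtain ⟨e, he⟩ := exists_isOrientedONB g o p
  exact he.trSq_neg (isSelfDualFor_nablaAtZero hsd hΩ htrans hp he v) hv B

/-- The almost complex structure, read in a continuous frame, converges at a zero along each
direction. -/
theorem FrameContinuousAt.tendsto_frameAcs {Y ι : Type*} [TopologicalSpace Y] {x : Y → X}
    {A : ∀ q, E4 →L[ℝ] TangentSpace (𝓡 4) (x q)} {q₀ : Y} (h : FrameContinuousAt x A q₀)
    (hA : Function.Bijective (A q₀)) (hsd : IsSelfDualForm g o Ω)
    (hΩ : IsSmoothForm Ω) (htrans : VanishesTransversely g o Ω) (h0 : x q₀ ∈ zeroSet Ω)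
    {l : Filter ι} {q : ι → Y}
    (hq : Filter.Tendsto q l (𝓝 q₀)) {τ : ι → ℝ} (hτ : Filter.Tendsto τ l (𝓝[>] 0)) {v : E4}
    (hv : Filter.Tendsto (fun i => (τ i)⁻¹ • (extChartAt (𝓡 4) (x q₀) (x (q i)) -
      extChartAt (𝓡 4) (x q₀) (x q₀))) l (𝓝 v)) (hne : nablaAtZero Ω (x q₀) v ≠ 0) :
    Filter.Tendsto (fun i => frameAcs (pullMetric g (x (q i)) (A (q i)))
      ((Ω (x (q i))).compContinuousLinearMap (A (q i)))) l
      (𝓝 (frameAcs (pullMetric g (x q₀) (A q₀))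
        ((nablaAtZero Ω (x q₀) v).compContinuousLinearMap (A q₀)))) := by
  let B : E4 ≃L[ℝ] TangentSpace (𝓡 4) (x q₀) :=
    (LinearEquiv.ofBijective (A q₀).toLinearMap hA).toContinuousLinearEquiv
  have hB : (B : E4 →L[ℝ] TangentSpace (𝓡 4) (x q₀)) = A q₀ := by ext; rfl
  have h1 := trSq_nablaAtZero_neg hsd hΩ htrans h0 hne B
  rw [hB] at h1
  have h2 := (continuousAt_frameAcs (pullMetric_pos g (x q₀) hA.1) h1).tendsto.comp
    (((h.continuousAt_pullMetric g).tendsto.comp hq).prodMk_nhds (h.tendsto_form hΩ h0 hq hτ hv))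
  refine h2.congr' ?_
  -- The factors `τ⁻¹` are positive, so they do not affect the almost complex structure.
  filter_upwards [hτ.eventually self_mem_nhdsWithin] with i hi
  exact frameAcs_smul _ (inv_pos.2 hi) _

theorem acs_frame (x : X) (A : E4 ≃L[ℝ] TangentSpace (𝓡 4) x) (u : E4) :
    acs g Ω x (A u) = A (frameAcs (pullMetric g x A) ((Ω x).compContinuousLinearMap A) u) :=
  acsAt_frame g x (Ω x) A u

/-- The almost complex structure does not extend over a zero. -/
theorem not_extendsOver (hsd : IsSelfDualForm g o Ω) (hΩ : IsSmoothForm Ω)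
    (htrans : VanishesTransversely g o Ω) {p : X} (hp : p ∈ zeroSet Ω) {U : Set X} (hU : U ∈ 𝓝 p) :
    ¬ ExtendsOver g Ω U := by
  rintro ⟨J, hJc, hJ, hJΩ⟩
  have h1 := ((continuousAt_hom_bundle (RingHom.id ℝ) _).1 (hJc.continuousAt hU)).2
  obtain ⟨e, he⟩ := exists_isOrientedONB g o p
  obtain ⟨α, hα, hα1⟩ := he.exists_isSelfDualAt
  obtain ⟨v, hv⟩ := htrans p hp α hα
  have hα0 : α ≠ 0 := by
    rintro rfl
    simp at hα1
  -- By continuity the value at `p` of an extension is the blow-up limit in every direction `v` with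
  -- `∇_v Ω ≠ 0`. Along such a direction `Ω` is nonzero close to `p`, so there the extension is the
  -- given structure.
  have key : ∀ v : TangentSpace (𝓡 4) p, nablaAtZero Ω p v ≠ 0 → ∀ u : E4,
      coordMap p p (J p (coordFrame p p u)) = frameAcs (pullMetric g p (coordFrame p p))
        ((nablaAtZero Ω p v).compContinuousLinearMap (coordFrame p p)) u := by
    intro v hv u
    have hb : Function.Bijective (coordFrame p p) := (coordEquiv (mem_chart_source E4 p)).bijective
    have h2 := (frameContinuousAt_coordFrame p).tendsto_frameAcs (g := g) hb hsd hΩ htrans hp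
      (tendsto_chartLine p v) Filter.tendsto_id (tendsto_chartLine_sub p v) hv
    have h3 := h1.tendsto.comp (tendsto_chartLine p v)
    have h4 := tendsto_form_chartLine hΩ hp v
    have h5 : ((nablaAtZero Ω p v).compContinuousLinearMap (coordFrame p p) :
        E4 [⋀^Fin 2]→L[ℝ] ℝ) ≠ 0 := by
      intro h
      apply hv
      refine twoForm_ext fun a b => ?_
      have h6 := congrArg (fun η : E4 [⋀^Fin 2]→L[ℝ] ℝ => η ![a, b]) h
      have h7 := congrArg₂ (fun a b => nablaAtZero Ω p v ![a, b]) (coordFrame_self p a)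
        (coordFrame_self p b)
      exact h7.symm.trans ((compContinuousLinearMap_pair _ _ a b).symm.trans h6)
    have h6 := h4.eventually (isOpen_ne.mem_nhds h5)
    have h7 := ((continuous_id.clm_apply (continuous_const (y := u))).tendsto _).comp h2
    have h8 := ((continuous_id.clm_apply (continuous_const (y := u))).tendsto _).comp h3
    refine tendsto_nhds_unique h8 (h7.congr' ?_)
    filter_upwards [h6, (tendsto_chartLine p v).eventually
      ((chartAt E4 p).open_source.mem_nhds (mem_chart_source E4 p)),
      (tendsto_chartLine p v).eventually hU] with s hs hs1 hs2
    have hs3 : chartLine p v s ∉ zeroSet Ω := by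
      intro h
      apply hs
      rw [show Ω (chartLine p v s) = 0 from h]
      refine twoForm_ext fun a b => ?_
      simp
    have h9 : acs g Ω (chartLine p v s) (coordFrame p (chartLine p v s) u) = _ :=
      acs_frame (chartLine p v s) (coordEquiv hs1) u
    change frameAcs _ _ u = coordMap p (chartLine p v s)
      (J (chartLine p v s) (coordFrame p (chartLine p v s) u))
    rw [hJΩ _ hs2 hs3, h9]
    exact (coordMap_coordFrame hs1 _).symm
  have hn : nablaAtZero Ω p (-v) = -nablaAtZero Ω p v :=
    (fderiv ℝ (formInChart Ω p) (extChartAt (𝓡 4) p p)).map_neg v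
  obtain ⟨u, hu⟩ := exists_ne (0 : E4)
  have k1 := key v (by rwa [hv])
  have k2 := key (-v) (by rw [hn, hv]; exact neg_ne_zero.2 hα0)
  have hneg : ((-nablaAtZero Ω p v).compContinuousLinearMap (coordFrame p p) :
      E4 [⋀^Fin 2]→L[ℝ] ℝ) = -(nablaAtZero Ω p v).compContinuousLinearMap (coordFrame p p) := rfl
  -- The directions `v` and `-v` give opposite values for the same endomorphism.
  have k3 : ∀ u : E4, coordMap p p (J p (coordFrame p p u)) = 0 := by
    intro u
    have h2 := k2 u
    rw [hn, hneg, frameAcs_neg, neg_apply, ← k1 u] at h2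
    have h3 := add_eq_zero_iff_eq_neg.2 h2
    rw [← two_smul ℝ] at h3
    exact (smul_eq_zero.1 h3).resolve_left two_ne_zero
  have k4 : ∀ w : TangentSpace (𝓡 4) p, J p w = 0 := by
    intro w
    have := k3 (coordMap p p w)
    rwa [coordFrame_coordMap (mem_chart_source E4 p), coordMap_self] at this
  have k5 := hJ p (mem_of_mem_nhds hU) (u : E4)
  rw [k4] at k5
  exact hu (neg_eq_zero.1 k5.symm)

end BlowUp

/-! ### The canonical bundle along a map of `S²`, read in a frame. -/

section CanonicalBundle

variable {X : Type*} [TopologicalSpace X] [ChartedSpace E4 X] [IsManifold (𝓡 4) ∞ X]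
  {g : Metric4 X} {o : Orientation4 X} {Ω : TwoForm X}

/-- Reading complex 2-forms in a frame, as a linear isomorphism. -/
noncomputable def frameFormEquiv {x : X} (A : E4 ≃L[ℝ] TangentSpace (𝓡 4) x) :
    (TangentSpace (𝓡 4) x [⋀^Fin 2]→L[ℝ] (Bundle.Trivial X ℂ x)) ≃ₗ[ℂ] ComplexForms where
  toFun θ := frameForm (A : E4 →L[ℝ] TangentSpace (𝓡 4) x) θ
  map_add' _ _ := rfl
  map_smul' _ _ := rfl
  invFun η := η.compContinuousLinearMap (A.symm : TangentSpace (𝓡 4) x →L[ℝ] E4)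
  left_inv θ := by
    refine ContinuousAlternatingMap.ext fun v => ?_
    change θ (fun i => A (A.symm (v i))) = θ v
    simp only [A.apply_symm_apply]
  right_inv η := by
    refine ContinuousAlternatingMap.ext fun v => ?_
    change η (fun i => A.symm (A (v i))) = η v
    simp only [A.symm_apply_apply]

/-- The complex structure of the 2-form in a frame. -/
noncomputable def frameStructure (g : Metric4 X) (Ω : TwoForm X) {x : X}
    (A : E4 ≃L[ℝ] TangentSpace (𝓡 4) x) : E4 →L[ℝ] E4 :=
  frameAcs (pullMetric g x A) ((Ω x).compContinuousLinearMap A)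

theorem frameStructure_sq (hsd : IsSelfDualForm g o Ω) {x : X} (hx : x ∉ zeroSet Ω)
    (A : E4 ≃L[ℝ] TangentSpace (𝓡 4) x) (u : E4) :
    frameStructure g Ω A (frameStructure g Ω A u) = -u := by
  obtain ⟨e, he⟩ := exists_isOrientedONB g o x
  have h := (hsd x).apply_basis he
  exact frameAcs_frameAcs (he.hasScalarSquare h A) (he.trSq_neg h hx A) u

theorem acs_acs (hsd : IsSelfDualForm g o Ω) {x : X} (hx : x ∉ zeroSet Ω)
    (v : TangentSpace (𝓡 4) x) : acs g Ω x (acs g Ω x v) = -v := by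
  let A : E4 ≃L[ℝ] TangentSpace (𝓡 4) x := coordEquiv (mem_chart_source E4 x)
  obtain ⟨u, rfl⟩ := A.surjective v
  have h := frameStructure_sq (g := g) hsd hx A u
  rw [acs_frame, acs_frame]
  exact (congrArg A h).trans (map_neg A u)

theorem mem_canonicalBundle (hsd : IsSelfDualForm g o Ω) {x : X} (hx : x ∉ zeroSet Ω)
    (θ : TangentSpace (𝓡 4) x [⋀^Fin 2]→L[ℝ] (Bundle.Trivial X ℂ x)) :
    θ ∈ canonicalBundle g Ω x ↔ ∀ u v, θ ![acs g Ω x u, v] = Complex.I * θ ![u, v] := by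
  have hd : Module.finrank ℝ (TangentSpace (𝓡 4) x) = 4 :=
    (finrank_euclideanSpace_fin : Module.finrank ℝ E4 = 4)
  have h := span_wedge_eq_typeTwoZero hd (acs g Ω x).toLinearMap (acs_acs hsd hx)
  have h2 : canonicalBundle g Ω x = typeTwoZero (T := TangentSpace (𝓡 4) x) (acs g Ω x) := h
  rw [h2]
  rfl

theorem frameForm_mem_iff (hsd : IsSelfDualForm g o Ω) {x : X} (hx : x ∉ zeroSet Ω)
    (A : E4 ≃L[ℝ] TangentSpace (𝓡 4) x)
    (θ : TangentSpace (𝓡 4) x [⋀^Fin 2]→L[ℝ] (Bundle.Trivial X ℂ x)) :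
    frameFormEquiv A θ ∈ typeTwoZero (frameStructure g Ω A) ↔ θ ∈ canonicalBundle g Ω x := by
  rw [mem_canonicalBundle hsd hx, mem_typeTwoZero]
  have h : ∀ u v, frameFormEquiv A θ ![u, v] = θ ![A u, A v] := fun u v =>
    frameForm_apply (A : E4 →L[ℝ] TangentSpace (𝓡 4) x) θ u v
  have h2 : ∀ u, A (frameStructure g Ω A u) = acs g Ω x (A u) := fun u => (acs_frame x A u).symm
  simp only [h, h2]
  constructor
  · intro h3 u v
    obtain ⟨u, rfl⟩ := A.surjective u
    obtain ⟨v, rfl⟩ := A.surjective v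
    exact h3 u v
  · intro h3 u v
    exact h3 _ _

theorem map_canonicalBundle (hsd : IsSelfDualForm g o Ω) {x : X} (hx : x ∉ zeroSet Ω)
    (A : E4 ≃L[ℝ] TangentSpace (𝓡 4) x) :
    (canonicalBundle g Ω x).map (frameFormEquiv A).toLinearMap =
      typeTwoZero (frameStructure g Ω A) := by
  ext η
  constructor
  · rintro ⟨θ, hθ, rfl⟩
    exact (frameForm_mem_iff hsd hx A θ).2 hθ
  · intro h
    obtain ⟨θ, rfl⟩ := (frameFormEquiv A).surjective η
    exact ⟨θ, (frameForm_mem_iff hsd hx A θ).1 h, rfl⟩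

theorem span_eq_canonicalBundle_iff (hsd : IsSelfDualForm g o Ω) {x : X} (hx : x ∉ zeroSet Ω)
    (A : E4 ≃L[ℝ] TangentSpace (𝓡 4) x)
    (θ : TangentSpace (𝓡 4) x [⋀^Fin 2]→L[ℝ] (Bundle.Trivial X ℂ x)) :
    Submodule.span ℂ {θ} = canonicalBundle g Ω x ↔
      Submodule.span ℂ {frameFormEquiv A θ} = typeTwoZero (frameStructure g Ω A) := by
  rw [← map_canonicalBundle hsd hx A]
  have h : Submodule.span ℂ {frameFormEquiv A θ} =
      (Submodule.span ℂ {θ}).map (frameFormEquiv A).toLinearMap := by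
    rw [Submodule.map_span, image_singleton]
    rfl
  rw [h]
  exact (Submodule.map_injective_of_injective (f := (frameFormEquiv A).toLinearMap)
    (frameFormEquiv A).injective).eq_iff.symm

variable {x : S2 → X} {A : ∀ y, E4 ≃L[ℝ] TangentSpace (𝓡 4) (x y)}

/-- A continuous frame of `TX` along `x` turns the pulled back canonical bundle into a family of
lines in the fixed space `ComplexForms`, to which the results on clutching apply. -/
theorem isFrameOn_iff (hsd : IsSelfDualForm g o Ω) (hx : ∀ y, x y ∉ zeroSet Ω)
    (hA : ∀ y, FrameContinuousAt x (fun y => (A y : E4 →L[ℝ] TangentSpace (𝓡 4) (x y))) y)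
    {S : Set S2} {s : ∀ y, TangentSpace (𝓡 4) (x y) [⋀^Fin 2]→L[ℝ] (Bundle.Trivial X ℂ (x y))} :
    IsFrameOn ComplexForms x (canonicalBundle g Ω) S s ↔
      IsLineFrame (fun y => typeTwoZero (frameStructure g Ω (A y))) S
        (fun y => frameFormEquiv (A y) (s y)) := by
  have h1 : ∀ y, ContinuousWithinAt (fun y => (⟨x y, s y⟩ : TotalSpace ComplexForms
      (fun x : X => TangentSpace (𝓡 4) x [⋀^Fin 2]→L[ℝ] (Bundle.Trivial X ℂ x)))) S y ↔
      ContinuousWithinAt (fun y => frameFormEquiv (A y) (s y)) S y := fun y =>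
    (hA y).continuousWithinAt_iff (fun y => (A y).bijective)
  have h2 : ∀ y, frameFormEquiv (A y) (s y) = 0 ↔ s y = 0 := fun y =>
    (frameFormEquiv (A y)).map_eq_zero_iff
  constructor
  · intro h
    exact ⟨fun y hy => (h1 y).1 (h.continuousOn y hy), fun y hy h0 => h.ne_zero y hy ((h2 y).1 h0),
      fun y hy => (span_eq_canonicalBundle_iff hsd (hx y) (A y) (s y)).1 (h.span_eq y hy)⟩
  · intro h
    exact ⟨fun y hy => (h1 y).2 (h.continuousOn y hy), fun y hy h0 => h.ne_zero y hy ((h2 y).2 h0),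
      fun y hy => (span_eq_canonicalBundle_iff hsd (hx y) (A y) (s y)).2 (h.span_eq y hy)⟩

theorem hasFirstChernNumber_of_hasClutching (hsd : IsSelfDualForm g o Ω)
    (hx : ∀ y, x y ∉ zeroSet Ω)
    (hA : ∀ y, FrameContinuousAt x (fun y => (A y : E4 →L[ℝ] TangentSpace (𝓡 4) (x y))) y) {c : ℤ}
    (h : HasClutching (fun y => typeTwoZero (frameStructure g Ω (A y))) c) :
    HasFirstChernNumber ComplexForms x (canonicalBundle g Ω) c := by
  constructor
  · obtain ⟨sp, sm, hp, hm, -⟩ := h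
    refine ⟨fun y => (frameFormEquiv (A y)).symm (sp y), fun y => (frameFormEquiv (A y)).symm (sm y),
      (isFrameOn_iff hsd hx hA).2 ?_, (isFrameOn_iff hsd hx hA).2 ?_⟩
    · simpa only [LinearEquiv.apply_symm_apply] using hp
    · simpa only [LinearEquiv.apply_symm_apply] using hm
  · intro sp sm hp hm
    obtain ⟨k, hk, hk2, hk3⟩ := h.hasWinding ((isFrameOn_iff hsd hx hA).1 hp)
      ((isFrameOn_iff hsd hx hA).1 hm)
    refine ⟨k, hk, fun t ht => ?_, hk3⟩
    apply (frameFormEquiv (A (equator t))).injective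
    rw [map_smul]
    exact hk2 t ht

theorem not_isTrivialLineBundle_of_hasClutching (hsd : IsSelfDualForm g o Ω)
    (hx : ∀ y, x y ∉ zeroSet Ω)
    (hA : ∀ y, FrameContinuousAt x (fun y => (A y : E4 →L[ℝ] TangentSpace (𝓡 4) (x y))) y) {c : ℤ}
    (hc : c ≠ 0) (h : HasClutching (fun y => typeTwoZero (frameStructure g Ω (A y))) c) :
    ¬ IsTrivialLineBundle ComplexForms x (canonicalBundle g Ω) := by
  rintro ⟨s, hs⟩
  have hs' := (isFrameOn_iff hsd hx hA).1 hs
  -- A global frame restricts to both hemispheres, with transition function 1.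
  have hw := h.hasWinding
    (⟨hs'.continuousOn.mono (subset_univ _), fun y _ => hs'.ne_zero y trivial,
      fun y _ => hs'.span_eq y trivial⟩)
    (⟨hs'.continuousOn.mono (subset_univ _), fun y _ => hs'.ne_zero y trivial,
      fun y _ => hs'.span_eq y trivial⟩)
  exact hc (hw.eq_zero_of_self fun t => hs'.ne_zero _ trivial)

end CanonicalBundle

/-! ### Normal spheres and the zero set. -/

section Spheres

variable {X : Type*} [TopologicalSpace X] [ChartedSpace E4 X] [IsManifold (𝓡 4) ∞ X]
  {g : Metric4 X} {o : Orientation4 X} {Ω : TwoForm X}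

/-- The vector with coordinates `y` in the frame `n`. -/
noncomputable def normalVector {p : X} (n : Fin 3 → TangentSpace (𝓡 4) p) (y : S2) :
    TangentSpace (𝓡 4) p := ∑ i, (y : EuclideanSpace ℝ (Fin 3)) i • n i

theorem continuous_normalVector {p : X} (n : Fin 3 → TangentSpace (𝓡 4) p) :
    Continuous (normalVector n) := by
  unfold normalVector
  fun_prop

theorem normalVector_mem {Z : Set X} {p : X} {n : Fin 3 → TangentSpace (𝓡 4) p}
    (hn : ∀ i, n i ∈ normalSpace g Z p) (a : ℝ) (y : S2) :
    a • normalVector n y ∈ normalSpace g Z p := by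
  intro v hv
  simp only [normalVector, Fin.sum_univ_three, map_smul, map_add, smul_apply, add_apply,
    hn _ v hv]
  simp

theorem inner_normalVector {p : X} {n : Fin 3 → TangentSpace (𝓡 4) p}
    (hn : ∀ i j, g.inner p (n i) (n j) = if i = j then 1 else 0) (a : ℝ) (y : S2) :
    g.inner p (a • normalVector n y) (a • normalVector n y) = a ^ 2 := by
  have hy : (y : EuclideanSpace ℝ (Fin 3)) 0 ^ 2 + (y : EuclideanSpace ℝ (Fin 3)) 1 ^ 2 +
      (y : EuclideanSpace ℝ (Fin 3)) 2 ^ 2 = 1 := by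
    have h := y.2
    rw [mem_sphere_zero_iff_norm, EuclideanSpace.norm_eq, Real.sqrt_eq_one] at h
    simpa [Fin.sum_univ_three] using h
  simp only [normalVector, Fin.sum_univ_three, map_smul, map_add, smul_apply, add_apply,
    hn, smul_eq_mul]
  simp
  linear_combination a ^ 2 * hy

/-- The matrix in `IsOrientedNormalONB` has the coefficients of `∇Ω (n i)` as its rows, so the
linear map `y ↦ ∇_y Ω` is given by its transpose. -/
theorem nablaAtZero_normalVector {p : X} (n : Fin 3 → TangentSpace (𝓡 4) p) (a : ℝ)
    (e : Module.Basis (Fin 4) ℝ (TangentSpace (𝓡 4) p)) (y : S2) :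
    sdCoeff e (nablaAtZero Ω p (a • normalVector n y)) =
      (a • (Matrix.of fun i j : Fin 3 => nablaAtZero Ω p (n i) ![e 0, e j.succ]).transpose).mulVec
        (y : EuclideanSpace ℝ (Fin 3)).ofLp := by
  ext j
  simp only [sdCoeff, normalVector, Fin.sum_univ_three, nablaAtZero_smul, nablaAtZero_add,
    Matrix.mulVec, dotProduct, Matrix.smul_apply, Matrix.transpose_apply, Matrix.of_apply,
    ContinuousAlternatingMap.smul_apply, ContinuousAlternatingMap.add_apply, smul_eq_mul]
  ring

theorem mem_normalBall {ε : X → ℝ} {p : X} (hp : p ∈ zeroSet Ω)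
    {n : Fin 3 → TangentSpace (𝓡 4) p} (hn : IsOrientedNormalONB g o Ω p n) {a : ℝ} (ha : 0 ≤ a)
    (haε : a < ε p) (y : S2) :
    (⟨p, a • normalVector n y⟩ : TangentBundle (𝓡 4) X) ∈ normalBall g (zeroSet Ω) ε := by
  refine ⟨hp, normalVector_mem hn.mem a y, ?_⟩
  rw [inner_normalVector hn.orthonormal, Real.sqrt_sq ha]
  exact haε

theorem riemExp_zero [T2Space X] {N₀ : Set (TangentBundle (𝓡 4) X)} (h : ExpEmbeds g N₀) {p : X}
    (hp : (⟨p, 0⟩ : TangentBundle (𝓡 4) X) ∈ N₀) : riemExp g ⟨p, 0⟩ = p :=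
  (riemExp_isExp (h.1 _ hp)).eq_of_zero

/-- If `exp u = z` were in `Z`, the zero vector at `z` would have the same image, and injectivity on
the normal ball would give `u = 0`. -/
theorem riemExp_notMem_zeroSet [T2Space X] {ε : X → ℝ} (hε : ∀ z ∈ zeroSet Ω, 0 < ε z)
    (h : ExpEmbeds g (normalBall g (zeroSet Ω) ε)) {u : TangentBundle (𝓡 4) X}
    (hu : u ∈ normalBall g (zeroSet Ω) ε) (hu0 : g.inner u.1 u.2 u.2 ≠ 0) :
    riemExp g u ∉ zeroSet Ω := by
  intro hz
  set z := riemExp g u with hzdef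
  have hz0 : (⟨z, 0⟩ : TangentBundle (𝓡 4) X) ∈ normalBall g (zeroSet Ω) ε :=
    ⟨hz, fun v _ => by simp, by simpa using hε z hz⟩
  have h1 : u = ⟨z, 0⟩ := by
    have := h.2.injective (a₁ := ⟨u, hu⟩) (a₂ := ⟨⟨z, 0⟩, hz0⟩) ((riemExp_zero h hz0).symm ▸ hzdef.symm)
    exact congrArg Subtype.val this
  have h2 : ∀ w : TangentBundle (𝓡 4) X, w = ⟨z, 0⟩ → g.inner w.1 w.2 w.2 = 0 := by
    rintro w rfl
    simp
  exact hu0 (h2 u h1)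

end Spheres

/-! ### Contraction of a normal sphere to its centre, and the resulting homotopy of complex
structures. -/

section Homotopy

variable {X : Type*} [TopologicalSpace X] [ChartedSpace E4 X] [IsManifold (𝓡 4) ∞ X]
  {g : Metric4 X} {o : Orientation4 X} {Ω : TwoForm X}

/-- The contraction of a normal sphere of radius `r` to its centre. -/
noncomputable def sphereContraction (g : Metric4 X) (p : X) (n : Fin 3 → TangentSpace (𝓡 4) p)
    (r : ℝ) (q : S2 × unitInterval) : X :=
  riemExp g ⟨p, ((q.2 : ℝ) * r) • normalVector n q.1⟩

theorem sphereContraction_one (p : X) (n : Fin 3 → TangentSpace (𝓡 4) p) (r : ℝ) (y : S2) :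
    sphereContraction g p n r (y, 1) = normalSphere g p n r y := by
  simp [sphereContraction, normalSphere, normalVector]

theorem sphereContraction_mem {ε : X → ℝ} {p : X} (hp : p ∈ zeroSet Ω)
    {n : Fin 3 → TangentSpace (𝓡 4) p} (hn : IsOrientedNormalONB g o Ω p n) {r : ℝ} (hr : 0 < r)
    (hrε : r < ε p) (q : S2 × unitInterval) :
    (⟨p, ((q.2 : ℝ) * r) • normalVector n q.1⟩ : TangentBundle (𝓡 4) X) ∈
      normalBall g (zeroSet Ω) ε :=
  mem_normalBall hp hn (mul_nonneg q.2.2.1 hr.le)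
    ((mul_le_of_le_one_left hr.le q.2.2.2).trans_lt hrε) q.1

theorem continuous_sphereContraction {ε : X → ℝ}
    (hexp : ExpEmbeds g (normalBall g (zeroSet Ω) ε)) {p : X} (hp : p ∈ zeroSet Ω)
    {n : Fin 3 → TangentSpace (𝓡 4) p} (hn : IsOrientedNormalONB g o Ω p n) {r : ℝ} (hr : 0 < r)
    (hrε : r < ε p) : Continuous (sphereContraction g p n r) := by
  have h1 : Continuous fun q : S2 × unitInterval => ((q.2 : ℝ) * r) • normalVector n q.1 :=
    (show Continuous fun q : S2 × unitInterval => (q.2 : ℝ) * r by fun_prop).smul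
      ((continuous_normalVector n).comp continuous_fst)
  have h2 : Continuous fun q : S2 × unitInterval =>
      (⟨p, ((q.2 : ℝ) * r) • normalVector n q.1⟩ : TangentBundle (𝓡 4) X) :=
    (FiberBundle.continuous_totalSpaceMk E4 (TangentSpace (𝓡 4) : X → Type _) p).comp h1
  exact hexp.2.continuous.comp (h2.subtype_mk fun q => sphereContraction_mem hp hn hr hrε q)

theorem sphereContraction_zero [T2Space X] {ε : X → ℝ} (hε : ∀ z ∈ zeroSet Ω, 0 < ε z)
    (hexp : ExpEmbeds g (normalBall g (zeroSet Ω) ε)) {p : X} (hp : p ∈ zeroSet Ω)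
    (n : Fin 3 → TangentSpace (𝓡 4) p) (r : ℝ) (y : S2) :
    sphereContraction g p n r (y, 0) = p := by
  have h : (⟨p, 0⟩ : TangentBundle (𝓡 4) X) ∈ normalBall g (zeroSet Ω) ε :=
    ⟨hp, fun v _ => by simp, by simpa using hε p hp⟩
  have h2 := riemExp_zero hexp h
  have h3 : ((((y, 0) : S2 × unitInterval).2 : ℝ) * r) • normalVector n y = 0 := by simp
  rw [sphereContraction, h3, h2]

theorem sphereContraction_notMem [T2Space X] {ε : X → ℝ} (hε : ∀ z ∈ zeroSet Ω, 0 < ε z)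
    (hexp : ExpEmbeds g (normalBall g (zeroSet Ω) ε)) {p : X} (hp : p ∈ zeroSet Ω)
    {n : Fin 3 → TangentSpace (𝓡 4) p} (hn : IsOrientedNormalONB g o Ω p n) {r : ℝ} (hr : 0 < r)
    (hrε : r < ε p) {q : S2 × unitInterval} (hq : q.2 ≠ 0) :
    sphereContraction g p n r q ∉ zeroSet Ω := by
  refine riemExp_notMem_zeroSet hε hexp (sphereContraction_mem hp hn hr hrε q) ?_
  rw [inner_normalVector hn.orthonormal]
  have h : (q.2 : ℝ) ≠ 0 := fun h => hq (Subtype.ext h)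
  positivity

/-- The contraction moves along the normal vectors to first order. -/
theorem tendsto_sphereContraction [T2Space X] {ε : X → ℝ}
    (hexp : ExpEmbeds g (normalBall g (zeroSet Ω) ε)) {p : X} (hp : p ∈ zeroSet Ω)
    {n : Fin 3 → TangentSpace (𝓡 4) p} (hn : IsOrientedNormalONB g o Ω p n) {r : ℝ} (hr : 0 < r)
    (hrε : r < ε p) (y₀ : S2) :
    Filter.Tendsto (fun q : S2 × unitInterval => (q.2 : ℝ)⁻¹ •
      (extChartAt (𝓡 4) p (sphereContraction g p n r q) - extChartAt (𝓡 4) p p))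
      (𝓝[{q | q.2 = 0}ᶜ] (y₀, 0)) (𝓝 (r • normalVector n y₀ : TangentSpace (𝓡 4) p)) := by
  obtain ⟨ρ, hρ, C, hC⟩ := exists_exp_estimate g p
  let w : S2 × unitInterval → E4 := fun q => r • normalVector n q.1
  have hw : Continuous w := ((continuous_normalVector n).comp continuous_fst).const_smul r
  have ht : Continuous fun q : S2 × unitInterval => (q.2 : ℝ) := by fun_prop
  have hsmall : ∀ᶠ q in 𝓝[{q | q.2 = 0}ᶜ] ((y₀, 0) : S2 × unitInterval), ‖(q.2 : ℝ) • w q‖ < ρ := by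
    have h1 : Filter.Tendsto (fun q : S2 × unitInterval => ‖(q.2 : ℝ) • w q‖) (𝓝 (y₀, 0)) (𝓝 0) := by
      have := (ht.smul hw).norm.tendsto (y₀, 0)
      simpa using this
    exact (h1.eventually (gt_mem_nhds hρ)).filter_mono nhdsWithin_le_nhds
  -- The quadratic error `C ‖t w‖²` of the exponential map, divided by `t`.
  have herr : Filter.Tendsto (fun q : S2 × unitInterval => C * (q.2 : ℝ) * ‖w q‖ ^ 2)
      (𝓝[{q | q.2 = 0}ᶜ] (y₀, 0)) (𝓝 0) := by
    have h1 : Continuous fun q : S2 × unitInterval => C * (q.2 : ℝ) * ‖w q‖ ^ 2 := by fun_prop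
    have h2 := h1.tendsto (y₀, 0)
    simp only [Set.Icc.coe_zero, mul_zero, zero_mul] at h2
    exact h2.mono_left nhdsWithin_le_nhds
  have hdiff : Filter.Tendsto (fun q : S2 × unitInterval => (q.2 : ℝ)⁻¹ •
      (extChartAt (𝓡 4) p (sphereContraction g p n r q) - extChartAt (𝓡 4) p p) - w q)
      (𝓝[{q | q.2 = 0}ᶜ] (y₀, 0)) (𝓝 0) := by
    refine squeeze_zero_norm' ?_ herr
    filter_upwards [hsmall, self_mem_nhdsWithin] with q hq hq0
    have hq1 : (q.2 : ℝ) ≠ 0 := fun h => hq0 (Subtype.ext h)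
    have hq2 : (0 : ℝ) < q.2 := lt_of_le_of_ne q.2.2.1 (Ne.symm hq1)
    have h1 : (((q.2 : ℝ) * r) • normalVector n q.1 : TangentSpace (𝓡 4) p) = (q.2 : ℝ) • w q :=
      mul_smul (q.2 : ℝ) r (normalVector n q.1)
    have h2 := riemExp_isExp (hexp.1 _ (sphereContraction_mem hp hn hr hrε q))
    have h3 := (hC _ hq.le (sphereContraction g p n r q) (h1 ▸ h2)).2
    have h4 : (q.2 : ℝ)⁻¹ • (extChartAt (𝓡 4) p (sphereContraction g p n r q) -
        extChartAt (𝓡 4) p p) - w q = (q.2 : ℝ)⁻¹ • (extChartAt (𝓡 4) p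
        (sphereContraction g p n r q) - extChartAt (𝓡 4) p p - (q.2 : ℝ) • w q) := by
      rw [smul_sub _ _ ((q.2 : ℝ) • w q), inv_smul_smul₀ hq1]
    rw [h4, norm_smul, norm_inv, Real.norm_of_nonneg hq2.le, inv_mul_le_iff₀ hq2]
    refine h3.trans (le_of_eq ?_)
    rw [norm_smul, Real.norm_of_nonneg hq2.le]
    ring
  have h5 := hdiff.add ((hw.tendsto (y₀, 0)).mono_left
    (nhdsWithin_le_nhds (s := {q : S2 × unitInterval | q.2 = 0}ᶜ)))
  simp only [sub_add_cancel, zero_add] at h5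
  exact h5

/-- The canonical bundle over a normal sphere, read in a suitable frame, is isomorphic to the one
of the linear model. -/
theorem exists_frame_hasClutching [T2Space X] [CompactSpace X] (hsd : IsSelfDualForm g o Ω)
    (hΩ : IsSmoothForm Ω) (htrans : VanishesTransversely g o Ω) {ε : X → ℝ}
    (hε : ∀ z ∈ zeroSet Ω, 0 < ε z)
    (hexp : ExpEmbeds g (normalBall g (zeroSet Ω) ε)) {p : X} (hp : p ∈ zeroSet Ω)
    {n : Fin 3 → TangentSpace (𝓡 4) p} (hn : IsOrientedNormalONB g o Ω p n) {r : ℝ} (hr : 0 < r)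
    (hrε : r < ε p) :
    ∃ A : ∀ y, E4 ≃L[ℝ] TangentSpace (𝓡 4) (normalSphere g p n r y),
      (∀ y, FrameContinuousAt (normalSphere g p n r)
        (fun y => (A y : E4 →L[ℝ] TangentSpace (𝓡 4) (normalSphere g p n r y))) y) ∧
      HasClutching (fun y => typeTwoZero (frameStructure g Ω (A y))) 2 := by
  obtain ⟨e, he⟩ := exists_isOrientedONB g o p
  have hHc := continuous_sphereContraction hexp hp hn hr hrε
  have hH0 := sphereContraction_zero hε hexp hp n r
  obtain ⟨A, hA, hA0⟩ := exists_frame hHc hH0 (basisFrame e)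
  -- The linear model. The factor `r` multiplies the determinant by `r³ > 0`, so its sign is the one
  -- in the orientation convention for `N`.
  let M : Matrix (Fin 3) (Fin 3) ℝ :=
    r • (Matrix.of fun i j : Fin 3 => nablaAtZero Ω p (n i) ![e 0, e j.succ]).transpose
  have hM : M.det < 0 := by
    rw [Matrix.det_smul, Matrix.det_transpose]
    exact mul_neg_of_pos_of_neg (by positivity) (hn.reversing e he)
  have hcoeff : ∀ y : S2, sdCoeff e (nablaAtZero Ω p (r • normalVector n y)) =
      M.mulVec (y : EuclideanSpace ℝ (Fin 3)).ofLp := nablaAtZero_normalVector n r e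
  have hMne : ∀ y : S2, M.mulVec (y : EuclideanSpace ℝ (Fin 3)).ofLp ≠ 0 := fun y h =>
    coe_ne_zero y (Matrix.eq_zero_of_mulVec_eq_zero hM.ne h)
  have hne : ∀ y : S2, nablaAtZero Ω p (r • normalVector n y) ≠ 0 := by
    intro y h
    apply hMne y
    rw [← hcoeff, h]
    rfl
  let J₀ : S2 → E4 →L[ℝ] E4 := fun y => unitQuat (M.mulVec (y : EuclideanSpace ℝ (Fin 3)).ofLp)
  have hJ₀ : ∀ y, frameAcs (pullMetric g p (basisFrame e))
      ((nablaAtZero Ω p (r • normalVector n y)).compContinuousLinearMap (basisFrame e)) = J₀ y := by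
    intro y
    rw [he.frameAcs_eq (isSelfDualFor_nablaAtZero hsd hΩ htrans hp he _), hcoeff]
  classical
  -- At `t = 0` the form vanishes and `frameStructure` has no meaning; the blow-up limit takes its
  -- place.
  let J : S2 × unitInterval → E4 →L[ℝ] E4 := fun q =>
    if q.2 = 0 then J₀ q.1 else frameStructure g Ω (A q)
  have hJ0 : ∀ y, J (y, 0) = J₀ y := fun y => if_pos rfl
  have hJ1 : ∀ y, J (y, 1) = frameStructure g Ω (A (y, 1)) := fun y => if_neg one_ne_zero
  have hJsq : ∀ q v, J q (J q v) = -v := by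
    intro q v
    by_cases hq : q.2 = 0
    · simp only [J, if_pos hq]
      exact unitQuat_unitQuat (hMne q.1) v
    · simp only [J, if_neg hq]
      exact frameStructure_sq hsd (sphereContraction_notMem hε hexp hp hn hr hrε hq) (A q) v
  have hJ₀c : Continuous J₀ := by
    have h1 : Continuous fun y : S2 => M.mulVec (y : EuclideanSpace ℝ (Fin 3)).ofLp :=
      Continuous.matrix_mulVec continuous_const
        ((PiLp.continuous_ofLp 2 _).comp continuous_subtype_val)
    exact continuousOn_unitQuat.comp_continuous h1 hMne
  have hclosed : IsClosed {q : S2 × unitInterval | q.2 = 0} :=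
    isClosed_eq continuous_snd continuous_const
  have hJc : Continuous J := by
    refine continuous_iff_continuousAt.2 fun q₀ => ?_
    by_cases hq₀ : q₀.2 = 0
    · obtain ⟨y₀, t₀⟩ := q₀
      obtain rfl : t₀ = 0 := hq₀
      -- At a point with `t = 0` continuity is checked separately within the slice `t = 0`, where
      -- `J` is the linear model, and within `t > 0`, where it is the blow-up.
      rw [← continuousWithinAt_univ, ← union_compl_self {q : S2 × unitInterval | q.2 = 0},
        continuousWithinAt_union]
      constructor
      · refine (hJ₀c.comp continuous_fst).continuousWithinAt.congr (fun q hq => ?_) (hJ0 y₀)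
        exact if_pos hq
      · have hzero : sphereContraction g p n r (y₀, 0) ∈ zeroSet Ω := by
          rw [hH0]
          exact hp
        -- The points `H(y₀, 0)` and `p` are equal, but not by definition; facts about tangent
        -- vectors at `p` are therefore stated for any `x` with `x = p`.
        have hpoint : ∀ (x : X) (B : E4 ≃L[ℝ] TangentSpace (𝓡 4) x) (v : E4), x = p →
            (∀ u, (B u : E4) = basisFrame e u) →
            frameAcs (pullMetric g x B) ((nablaAtZero Ω x v).compContinuousLinearMap B) =
            frameAcs (pullMetric g p (basisFrame e))
              ((nablaAtZero Ω p v).compContinuousLinearMap (basisFrame e)) := by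
          rintro x B v rfl h
          have : B = basisFrame e := ContinuousLinearEquiv.ext (funext h)
          rw [this]
        have hτ : Filter.Tendsto (fun q : S2 × unitInterval => (q.2 : ℝ))
            (𝓝[{q | q.2 = 0}ᶜ] (y₀, 0)) (𝓝[>] 0) := by
          refine tendsto_nhdsWithin_iff.2 ⟨?_, ?_⟩
          · have : Continuous fun q : S2 × unitInterval => (q.2 : ℝ) := by fun_prop
            exact (this.tendsto (y₀, 0)).mono_left nhdsWithin_le_nhds
          · filter_upwards [self_mem_nhdsWithin] with q hq
            exact lt_of_le_of_ne q.2.2.1 fun h => hq (Subtype.ext h.symm)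
        have hblow := tendsto_sphereContraction hexp hp hn hr hrε y₀
        have hv : ∀ x : X, x = p → Filter.Tendsto (fun q : S2 × unitInterval => (q.2 : ℝ)⁻¹ •
            (extChartAt (𝓡 4) x (sphereContraction g p n r q) - extChartAt (𝓡 4) x x))
            (𝓝[{q | q.2 = 0}ᶜ] (y₀, 0)) (𝓝 (r • normalVector n y₀ : TangentSpace (𝓡 4) p)) := by
          rintro x rfl
          exact hblow
        have hne' : ∀ x : X, x = p → nablaAtZero Ω x
            (r • normalVector n y₀ : TangentSpace (𝓡 4) p) ≠ 0 := by
          rintro x rfl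
          exact hne y₀
        have h2 := (hA (y₀, 0)).tendsto_frameAcs (g := g) (A (y₀, 0)).bijective hsd hΩ htrans hzero
          (l := 𝓝[{q | q.2 = 0}ᶜ] (y₀, 0)) (q := id) nhdsWithin_le_nhds hτ
          (hv _ (hH0 y₀)) (hne' _ (hH0 y₀))
        have h3 := (hpoint _ (A (y₀, 0)) (r • normalVector n y₀ : TangentSpace (𝓡 4) p) (hH0 y₀)
          (hA0 y₀)).trans ((hJ₀ y₀).trans (hJ0 y₀).symm)
        have h4 := le_of_le_of_eq h2 (congrArg 𝓝 h3)
        refine Filter.Tendsto.congr' ?_ h4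
        filter_upwards [self_mem_nhdsWithin] with q hq
        exact (if_neg hq).symm
    -- For `t > 0` the form is nonzero, and there the structure depends continuously on the metric
    -- and the form in the frame.
    · obtain ⟨e', he'⟩ := exists_isOrientedONB g o (sphereContraction g p n r q₀)
      have hx := sphereContraction_notMem hε hexp hp hn hr hrε hq₀
      have h1 := ((continuousAt_frameAcs (pullMetric_pos g _ (A q₀).injective)
        (he'.trSq_neg ((hsd _).apply_basis he') hx (A q₀))).tendsto.comp
        (((hA q₀).continuousAt_pullMetric g).tendsto.prodMk_nhds ((hA q₀).continuousAt_form hΩ)))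
      change Filter.Tendsto J _ (𝓝 (J q₀))
      rw [show J q₀ = frameStructure g Ω (A q₀) from if_neg hq₀]
      refine h1.congr' ?_
      filter_upwards [hclosed.isOpen_compl.mem_nhds hq₀] with q hq
      exact (if_neg hq).symm
  have hcl := HasClutching.homotopy hJc hJsq (c := 2) (by
    simp only [hJ0]
    exact hasClutching_unitQuat M hM)
  simp only [hJ1] at hcl
  -- The end of the contraction is the normal sphere only up to a proved equality, across which the
  -- frames have to be moved.
  have hfinal : ∀ x : S2 → X, (∀ y, sphereContraction g p n r (y, 1) = x y) →
      ∃ A : ∀ y, E4 ≃L[ℝ] TangentSpace (𝓡 4) (x y),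
      (∀ y, FrameContinuousAt x (fun y => (A y : E4 →L[ℝ] TangentSpace (𝓡 4) (x y))) y) ∧
      HasClutching (fun y => typeTwoZero (frameStructure g Ω (A y))) 2 := by
    intro x hx
    obtain rfl : (fun y => sphereContraction g p n r (y, 1)) = x := funext hx
    refine ⟨fun y => A (y, 1), fun y => ?_, hcl⟩
    have hι : ContinuousAt (fun y : S2 => (y, (1 : unitInterval))) y := by fun_prop
    exact ⟨ContinuousAt.comp (g := sphereContraction g p n r) (hA (y, 1)).1 hι,
      (hA (y, 1)).2.tendsto.comp hι⟩
  exact hfinal _ (sphereContraction_one p n r)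

end Homotopy

end NearSymplectic

theorem lemma2p1 {X : Type*} [TopologicalSpace X] [ChartedSpace E4 X]
    [IsManifold (𝓡 4) ∞ X] [T2Space X] [CompactSpace X]
    (g : Metric4 X) (o : Orientation4 X)
    (Ω : TwoForm X)
    (hsd : IsSelfDualForm g o Ω)
    (hharm : IsHarmonicForm g o Ω)
    (htrans : VanishesTransversely g o Ω) :
    (∀ ε : X → ℝ, ContinuousOn ε (zeroSet Ω) →
      (∀ z ∈ zeroSet Ω, 0 < ε z) →
      ExpEmbeds g (normalBall g (zeroSet Ω) ε) →
      ∀ p ∈ zeroSet Ω, ∀ n : Fin 3 → TangentSpace (𝓡 4) p,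
        IsOrientedNormalONB g o Ω p n →
        ∀ r : ℝ, 0 < r → r < ε p →
          (∀ y, normalSphere g p n r y ∉ zeroSet Ω) ∧
          HasFirstChernNumber ComplexForms
            (normalSphere g p n r) (canonicalBundle g Ω) 2 ∧
          ¬ IsTrivialLineBundle ComplexForms
            (normalSphere g p n r) (canonicalBundle g Ω)) ∧
    (∀ p ∈ zeroSet Ω, ∀ U ∈ 𝓝 p, ¬ ExtendsOver g Ω U) := by
  refine ⟨?_, fun p hp U hU => not_extendsOver hsd hharm.1 htrans hp hU⟩
  intro ε _ hε hexp p hp n hn r hr hrε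
  have hx : ∀ y, normalSphere g p n r y ∉ zeroSet Ω := by
    intro y
    rw [← sphereContraction_one]
    exact sphereContraction_notMem hε hexp hp hn hr hrε one_ne_zero
  obtain ⟨A, hA, hcl⟩ := exists_frame_hasClutching hsd hharm.1 htrans hε hexp hp hn hr hrε
  exact ⟨hx, hasFirstChernNumber_of_hasClutching hsd hx hA hcl,
    not_isTrivialLineBundle_of_hasClutching hsd hx hA two_ne_zero hcl⟩
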